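/- Let $T>0$, $d\in\mathbb N$, $\gamma=(\gamma_1,\gamma_2)\in(1/2,1]^2$ and $\eta\in(0,1)$ with $(1+\eta)\gamma_i>1$ for $i=1,2$. For $f$ on $[0,T]^2$ with values in a vector space and $s,t\in[0,T]^2$ put $\square_{s,t}f=f(t_1,t_2)-f(t_1,s_2)-f(s_1,t_2)+f(s_1,s_2)$. For a Banach space $E$, let $C^\gamma_tE=C^\gamma([0,T]^2;E)$ be the set of $f:[0,T]^2\to E$ for which there is $K<\infty$ such that for all $s,t\in[0,T]^2$ $$\|f(t_1,s_2)-f(s_1,s_2)\|_E\le K|t_1-s_1|^{\gamma_1},\quad \|f(s_1,t_2)-f(s_1,s_2)\|_E\le K|t_2-s_2|^{\gamma_2},\quad \|\square_{s,t}f\|_E\le K|t_1-s_1|^{\gamma_1}|t_2-s_2|^{\gamma_2},$$ and write $C^\gamma_t=C^\gamma_t\mathbb R^d$. Let $C^{2+\eta}_x$ be the Banach space of $C^2$ maps $g:\mathbb R^d\to\mathbb R^d$ for which $g$, $Dg$, $D^2g$ are bounded and $D^2g$ is globally $\eta$-Hölder continuous, with its usual norm. **Theorem (existence and uniqueness).**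 Let $A:[0,T]^2\times\mathbb R^d\to\mathbb R^d$ satisfy $A\in C^\gamma_tC^{2+\eta}_x$, and let $\xi\in C^\gamma_t$ satisfy $\square_{s,t}\xi=0$ for all $s,t\in[0,T]^2$ with $s_1<t_1$ and $s_2<t_2$. Then there is exactly one $\theta\in C^\gamma([0,T]^2;\mathbb R^d)$ such that $$\theta_t=\xi_t+\int_0^tA(ds,\theta_s)\qquad\text{for all }t\in[0,T]^2,$$ where the integral is the 2D nonlinear Young integral, that is, the limit (which is part of the claim to exist) $$\int_0^tA(ds,\theta_s)=\lim_{|\mathcal P|\to0}\ \sum_{[u,v]\in\mathcal P}(\square_{u,v}A)(\theta_u)$$ over all partitions $\mathcal P=\mathcal P^1\times\mathcal P^2$ of $[0,t_1]\times[0,t_2]$ into rectangles $[u,v]=[u_1,v_1]\times[u_2,v_2]$ given by partitions $\mathcal P^i$ of $[0,t_i]$, as the mesh tends to zero. -/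

import Mathlib

namespace NLY

/-- The parameter square `[0,T]²`. -/
def square (T : ℝ) : Set (ℝ × ℝ) := Set.Icc 0 T ×ˢ Set.Icc 0 T

/-- The rectangular increment
`□_{s,t} f = f(t₁,t₂) - f(t₁,s₂) - f(s₁,t₂) + f(s₁,s₂)`. -/
def rectInc {V : Type*} [AddCommGroup V] (f : ℝ × ℝ → V) (s t : ℝ × ℝ) : V :=
  f (t.1, t.2) - f (t.1, s.2) - f (s.1, t.2) + f (s.1, s.2)

/-- Membership in the jointly Hölder space `C^γ([0,T]²; E)`, where `E` is described by the relation
`NormLE v K`, read as `v ∈ E` and `‖v‖_E ≤ K`. The field takes its values in `E`, and the three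
seminorms `[f]_{(1,0),γ}`, `[f]_{(0,1),γ}`, `[f]_{(1,1),γ}` are finite (here: bounded by one
constant `K`). Values of `f` outside the square play no role. -/
def MemHolder {V : Type*} [AddCommGroup V] (NormLE : V → ℝ → Prop) (T : ℝ) (γ : ℝ × ℝ)
    (f : ℝ × ℝ → V) : Prop :=
  (∀ t ∈ square T, ∃ K : ℝ, NormLE (f t) K) ∧
  ∃ K : ℝ, 0 ≤ K ∧ ∀ s ∈ square T, ∀ t ∈ square T,
    NormLE (f (t.1, s.2) - f (s.1, s.2)) (K * |t.1 - s.1| ^ γ.1) ∧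
    NormLE (f (s.1, t.2) - f (s.1, s.2)) (K * |t.2 - s.2| ^ γ.2) ∧
    NormLE (rectInc f s t) (K * (|t.1 - s.1| ^ γ.1 * |t.2 - s.2| ^ γ.2))

/-- `C^γ_t`, that is `C^γ([0,T]²; E)` for a normed space `E`. -/
def MemHolderTime {E : Type*} [NormedAddCommGroup E] (T : ℝ) (γ : ℝ × ℝ) (f : ℝ × ℝ → E) : Prop :=
  MemHolder (fun (v : E) K => ‖v‖ ≤ K) T γ f

/-- `f` belongs to the space `C_b^{2+η}` of twice continuously differentiable maps on the whole space
which are bounded together with their first two derivatives and have a globally `η`-Hölder second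
derivative, and its norm (the largest of the four quantities
`‖f‖_∞`, `‖Df‖_∞`, `‖D²f‖_∞`, `[D²f]_η`) is at most `K`. -/
structure HolderTwoNormLE {E : Type*} [NormedAddCommGroup E] [NormedSpace ℝ E] (η : ℝ)
    (f : E → E) (K : ℝ) : Prop where
  contDiff : ContDiff ℝ 2 f
  bound_zero : ∀ x, ‖f x‖ ≤ K
  bound_one : ∀ x, ‖fderiv ℝ f x‖ ≤ K
  bound_two : ∀ x, ‖fderiv ℝ (fderiv ℝ f) x‖ ≤ K
  holder_two : ∀ x y, ‖fderiv ℝ (fderiv ℝ f) x - fderiv ℝ (fderiv ℝ f) y‖ ≤ K * ‖x - y‖ ^ η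

/-- `A ∈ C^γ_t C^{2+η}_x`: the map `t ↦ A(t, ·)` is a jointly `γ`-Hölder field with values
in `C_b^{2+η}`. -/
def MemHolderTimeSpace {E : Type*} [NormedAddCommGroup E] [NormedSpace ℝ E] (T : ℝ) (γ : ℝ × ℝ)
    (η : ℝ) (A : ℝ × ℝ → E → E) : Prop :=
  MemHolder (HolderTwoNormLE η) T γ A

/-- A partition `a = pt 0 < pt 1 < ⋯ < pt n = b` of the interval `[a,b]`
(the values `pt i` with `i > n` are irrelevant; if `a = b` then `n = 0`). -/
structure IntervalPartition (a b : ℝ) where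
  n : ℕ
  pt : ℕ → ℝ
  pt_zero : pt 0 = a
  pt_last : pt n = b
  pt_lt : ∀ i < n, pt i < pt (i + 1)

/-- The mesh of the partition is smaller than `δ`. -/
def IntervalPartition.MeshLT {a b : ℝ} (P : IntervalPartition a b) (δ : ℝ) : Prop :=
  ∀ i < P.n, P.pt (i + 1) - P.pt i < δ

/-- The Riemann type sum `∑_{[u,v] ∈ P × Q} □_{u,v} A (y_u)` over a grid. -/
def riemannSum {E : Type*} [AddCommGroup E] (A : ℝ × ℝ → E → E) (y : ℝ × ℝ → E)
    {a₁ b₁ a₂ b₂ : ℝ} (P : IntervalPartition a₁ b₁) (Q : IntervalPartition a₂ b₂) : E :=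
  ∑ i ∈ Finset.range P.n, ∑ j ∈ Finset.range Q.n,
    rectInc A (P.pt i, Q.pt j) (P.pt (i + 1), Q.pt (j + 1)) (y (P.pt i, Q.pt j))

/-- `I = ∫_0^t A(ds, y_s)` as a 2D nonlinear Young integral: `I` is the limit of the Riemann type
sums over all grid partitions of `[0,t₁] × [0,t₂]` as the mesh tends to zero. -/
def IsYoungIntegral {E : Type*} [NormedAddCommGroup E] (A : ℝ × ℝ → E → E) (y : ℝ × ℝ → E)
    (t : ℝ × ℝ) (I : E) : Prop :=
  ∀ ε > 0, ∃ δ > 0, ∀ (P : IntervalPartition 0 t.1) (Q : IntervalPartition 0 t.2),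
    P.MeshLT δ → Q.MeshLT δ → ‖riemannSum A y P Q - I‖ < ε

/-- `θ` solves `θ_t = ξ_t + ∫_0^t A(ds, θ_s)` for all `t ∈ [0,T]²`, where the integral exists as a
2D nonlinear Young integral. -/
def IsYoungSolution {E : Type*} [NormedAddCommGroup E] (T : ℝ) (A : ℝ × ℝ → E → E)
    (ξ θ : ℝ × ℝ → E) : Prop :=
  ∀ t ∈ square T, ∃ I : E, IsYoungIntegral A θ t I ∧ θ t = ξ t + I

end NLY

/-! The germ `germ A θ`, that is `□_{s,t}A` evaluated at `θ_s`, is almost additive in the rectangle: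
the field is exactly additive, so subdividing only moves the point of evaluation. A defect in
direction `i` has order `2γᵢ > 1`, one `γᵢ` coming from `A` and one from `θ`; the joint defect is a
rectangular increment of a smooth map along `θ` and has order `2γ₁` and `2γ₂` at once. Sewing in one
direction and then in the other (`norm_planarSew_sub_le`) gives an additive integral close to its
germ, and grid sums converge to it (`exists_norm_sum_sub_planarSew_le`).

For two paths `θ`, `θ'` at distance `D`, the defects of the difference of the germs must be of size
`D`. This uses one more derivative of `A`, and `D²A` is only `η`-Hölder, so the order drops to
`(1+η)γᵢ`, still larger than 1 (`norm_four_point_sub_le`, `planarDefectBound_sub`).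

A solution is a fixed point of `solMap`. The square is cut at a scale `h = T / N`, and `LocalHolder`
asks for Hölder constants `h^(-γᵢ)` on boxes of side `h`, so that oscillations there are at most 1.
An increment of the integral in one direction is a sum over at most `N` boxes, of total size about
`N h^γ₂` times the wanted power; since `γ₁ + γ₂ > 1`, a small `h` makes `solMap` preserve this class
(`localHolder_solMap`).

For the contraction no factor `N` may be lost at each iteration. As `□ξ = 0`, rectangular increments
of `solMap` are integrals over the same rectangle, and images agree on the axes. Rectangular
increments are weighted by `2^(t₁/h) 2^(t₂/h)`; summing boxes back to the axes is then a geometric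
series with a bounded factor, and `solMap` halves weighted bounds (`weightedBound_solMap_sub`).
Picard iteration gives existence on the whole square with no patching. Any two Hölder solutions lie
in the class for a sufficiently small common scale, which gives uniqueness. -/

open Filter Topology

namespace NLY

/-! ### One-parameter sewing lemma. -/

section Sewing

variable {E : Type*} [NormedAddCommGroup E]

/-- The defect of additivity `Ξ(s,t) - Ξ(s,u) - Ξ(u,t)` of a two-parameter function. -/
def defect (Ξ : ℝ → ℝ → E) (s u t : ℝ) : E := Ξ s t - Ξ s u - Ξ u t

/-- The defect of additivity is of order `α` on `[a,b]`. -/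
def DefectBound (Ξ : ℝ → ℝ → E) (a b C α : ℝ) : Prop :=
  ∀ s u t, a ≤ s → s ≤ u → u ≤ t → t ≤ b → ‖defect Ξ s u t‖ ≤ C * (t - s) ^ α

/-- Projection of the real line onto `[s,t]`. -/
def clamp (s t x : ℝ) : ℝ := max s (min t x)

lemma le_clamp (s t x : ℝ) : s ≤ clamp s t x := le_max_left _ _

lemma clamp_le {s t : ℝ} (h : s ≤ t) (x : ℝ) : clamp s t x ≤ t := max_le h (min_le_left _ _)

lemma clamp_mono (s t : ℝ) {x y : ℝ} (h : x ≤ y) : clamp s t x ≤ clamp s t y :=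
  max_le_max le_rfl (min_le_min le_rfl h)

lemma clamp_of_le {s t x : ℝ} (h : x ≤ s) : clamp s t x = s :=
  max_eq_left ((min_le_right _ _).trans h)

lemma clamp_of_ge {s t x : ℝ} (hst : s ≤ t) (h : t ≤ x) : clamp s t x = t := by
  rw [clamp, min_eq_left h, max_eq_right hst]

lemma clamp_sub_le (s t : ℝ) {x y : ℝ} (h : x ≤ y) : clamp s t y - clamp s t x ≤ y - x := by
  unfold clamp
  rcases max_cases s (min t y) with h1 | h1 <;> rcases max_cases s (min t x) with h2 | h2 <;>
    rcases min_cases t y with h3 | h3 <;> rcases min_cases t x with h4 | h4 <;> linarith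

/-- Points of the uniform grid with `2 ^ n` cells on `[0,T]`. -/
noncomputable def grid (T : ℝ) (n i : ℕ) : ℝ := i * (T / 2 ^ n)

lemma grid_succ_sub (T : ℝ) (n i : ℕ) : grid T n (i + 1) - grid T n i = T / 2 ^ n := by
  simp only [grid]; push_cast; ring

lemma grid_mono {T : ℝ} (hT : 0 ≤ T) (n i : ℕ) : grid T n i ≤ grid T n (i + 1) := by
  have := grid_succ_sub T n i
  have : 0 ≤ T / 2 ^ n := by positivity
  linarith

lemma grid_zero (T : ℝ) (n : ℕ) : grid T n 0 = 0 := by simp [grid]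

lemma grid_last (T : ℝ) (n : ℕ) : grid T n (2 ^ n) = T := by
  simp only [grid]; push_cast; field_simp

lemma grid_double (T : ℝ) (n i : ℕ) : grid T (n + 1) (2 * i) = grid T n i := by
  simp only [grid]; push_cast; field_simp; ring

/-- Riemann sum of `Ξ` over `[s,t]` along the dyadic grid of level `n` of `[0,T]`. -/
noncomputable def sewSum (T : ℝ) (n : ℕ) (Ξ : ℝ → ℝ → E) (s t : ℝ) : E :=
  ∑ i ∈ Finset.range (2 ^ n), Ξ (clamp s t (grid T n i)) (clamp s t (grid T n (i + 1)))

/-- The sewing of `Ξ`, the limit of its dyadic Riemann sums. -/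
noncomputable def sew (T : ℝ) (Ξ : ℝ → ℝ → E) (s t : ℝ) : E :=
  limUnder atTop fun n => sewSum T n Ξ s t

/-- The constant of the sewing lemma with exponent `α > 1`. -/
noncomputable def sewConst (α : ℝ) : ℝ := 2 / (1 - 2 ^ (1 - α))

lemma two_rpow_lt_one {α : ℝ} (hα : 1 < α) : (2 : ℝ) ^ (1 - α) < 1 :=
  Real.rpow_lt_one_of_one_lt_of_neg one_lt_two (by linarith)

lemma sewConst_nonneg {α : ℝ} (hα : 1 < α) : 0 ≤ sewConst α :=
  div_nonneg zero_le_two (by linarith [two_rpow_lt_one hα])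

/-- Closes the induction in `DefectBound.norm_sum_sub_le`: the two halves of a bisection reproduce
the constant times `2 ^ (1 - α)`, and each bisection spends two defects. -/
lemma sewConst_eq {α : ℝ} (hα : 1 < α) : sewConst α * 2 ^ (1 - α) + 2 = sewConst α := by
  have := two_rpow_lt_one hα
  have h : (1 - (2 : ℝ) ^ (1 - α)) ≠ 0 := by linarith
  unfold sewConst
  grind

lemma rpow_le_mul_of_le {x δ α : ℝ} (hα : 1 < α) (hx : 0 ≤ x) (hxδ : x ≤ δ) :
    x ^ α ≤ δ ^ (α - 1) * x := by
  have : x ^ α = x ^ (α - 1) * x := by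
    rw [← Real.rpow_add_one' hx (by linarith)]; ring_nf
  rw [this]
  gcongr

/-- Source of all convergence in the mesh: a power `α - 1 > 0` is given to the mesh and the
remaining linear factor telescopes. -/
lemma sum_rpow_le {p : ℕ → ℝ} {n : ℕ} {δ α : ℝ} (hα : 1 < α)
    (hp : ∀ i < n, p i ≤ p (i + 1)) (hδ : ∀ i < n, p (i + 1) - p i ≤ δ) :
    ∑ i ∈ Finset.range n, (p (i + 1) - p i) ^ α ≤ δ ^ (α - 1) * (p n - p 0) := by
  rw [← Finset.sum_range_sub, Finset.mul_sum]
  refine Finset.sum_le_sum fun i hi => ?_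
  have hi := Finset.mem_range.1 hi
  exact rpow_le_mul_of_le hα (by linarith [hp i hi]) (hδ i hi)

lemma DefectBound.diag {Ξ : ℝ → ℝ → E} {a b C α : ℝ} (h : DefectBound Ξ a b C α) (hα : 1 < α)
    {s : ℝ} (has : a ≤ s) (hsb : s ≤ b) : Ξ s s = 0 := by
  have := h s s s has le_rfl le_rfl hsb
  rw [sub_self, Real.zero_rpow (by linarith), mul_zero] at this
  simpa [defect] using this

/-- Young's maximal inequality. -/
lemma DefectBound.norm_sum_sub_le {Ξ : ℝ → ℝ → E} {a b C α : ℝ} (h : DefectBound Ξ a b C α)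
    (hα : 1 < α) (hC : 0 ≤ C) {p : ℕ → ℝ} (hp : Monotone p) (k m n : ℕ) (hk : n = m + k)
    (ha : a ≤ p m) (hb : p n ≤ b) :
    ‖∑ i ∈ Finset.Ico m n, Ξ (p i) (p (i + 1)) - Ξ (p m) (p n)‖ ≤
      sewConst α * C * (p n - p m) ^ α := by
  induction k using Nat.strong_induction_on generalizing m n with
  | _ k ih =>
  have hK := sewConst_nonneg hα
  have hmn : m ≤ n := by omega
  have hpmn := hp hmn
  rcases Nat.eq_zero_or_pos k with rfl | hkpos
  · obtain rfl : n = m := by omega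
    rw [Finset.Ico_self, Finset.sum_empty, h.diag hα ha hb, sub_zero, norm_zero, sub_self,
      Real.zero_rpow (by linarith), mul_zero]
  -- The cell from `p j` to `p (j + 1)` that meets the midpoint is removed. Both remaining pieces
  -- have at most half the length, and inserting `p j` and `p (j + 1)` costs two defects.
  set mid := (p m + p n) / 2 with hmid
  let j := Nat.findGreatest (fun j => m ≤ j ∧ p j ≤ mid) (n - 1)
  have hj : m ≤ j ∧ p j ≤ mid :=
    Nat.findGreatest_spec (P := fun j => m ≤ j ∧ p j ≤ mid) (m := m) (n := n - 1) (by omega)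
      ⟨le_rfl, by linarith⟩
  have hjn : j ≤ n - 1 := Nat.findGreatest_le _
  have hj1 : mid ≤ p (j + 1) := by
    rcases Nat.lt_or_ge (n - 1) (j + 1) with hlt | hge
    · have : j + 1 = n := by omega
      rw [this]; linarith
    · by_contra hcon
      exact Nat.findGreatest_is_greatest (P := fun j => m ≤ j ∧ p j ≤ mid) (n := n - 1)
        (Nat.lt_succ_self j) hge ⟨by omega, (not_le.1 hcon).le⟩
  have h1 := ih (j - m) (by omega) m j (by omega) ha ((hp (by omega : j ≤ n)).trans hb)
  have h2 := ih (n - (j + 1)) (by omega) (j + 1) n (by omega)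
    (ha.trans (hp (by omega : m ≤ j + 1))) hb
  have pmj := hp hj.1
  have pjj := hp (Nat.le_succ j)
  have pjn := hp (by omega : j + 1 ≤ n)
  simp only [Nat.succ_eq_add_one] at pjj
  have h3 := h (p m) (p j) (p n) ha pmj (pjj.trans pjn) hb
  have h4 := h (p j) (p (j + 1)) (p n) (ha.trans pmj) pjj pjn hb
  have hsum : ∑ i ∈ Finset.Ico m n, Ξ (p i) (p (i + 1)) - Ξ (p m) (p n) =
      (∑ i ∈ Finset.Ico m j, Ξ (p i) (p (i + 1)) - Ξ (p m) (p j)) +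
      (∑ i ∈ Finset.Ico (j + 1) n, Ξ (p i) (p (i + 1)) - Ξ (p (j + 1)) (p n)) -
      defect Ξ (p m) (p j) (p n) - defect Ξ (p j) (p (j + 1)) (p n) := by
    rw [← Finset.sum_Ico_consecutive _ hj.1 (by omega : j ≤ n),
      Finset.sum_eq_sum_Ico_succ_bot (by omega : j < n)]
    simp only [defect]
    abel
  rw [hsum]
  set r := p n - p m with hr
  have hr0 : 0 ≤ r := by linarith
  have half : (r / 2) ^ α * 2 = 2 ^ (1 - α) * r ^ α := by
    rw [Real.div_rpow hr0 zero_le_two, Real.rpow_sub two_pos, Real.rpow_one]; ring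
  have e1 : (p j - p m) ^ α ≤ (r / 2) ^ α :=
    Real.rpow_le_rpow (by linarith) (by linarith) (by linarith)
  have e2 : (p n - p (j + 1)) ^ α ≤ (r / 2) ^ α :=
    Real.rpow_le_rpow (by linarith) (by linarith) (by linarith)
  have e4 : (p n - p j) ^ α ≤ r ^ α :=
    Real.rpow_le_rpow (by linarith) (by linarith) (by linarith)
  have hKC : 0 ≤ sewConst α * C := mul_nonneg hK hC
  calc _ ≤ sewConst α * C * (r / 2) ^ α + sewConst α * C * (r / 2) ^ α + C * r ^ α
        + C * r ^ α := by
        refine (norm_sub_le _ _).trans (add_le_add ((norm_sub_le _ _).trans (add_le_add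
          ((norm_add_le _ _).trans (add_le_add ?_ ?_)) h3)) ?_)
        · exact h1.trans (by gcongr)
        · exact h2.trans (by gcongr)
        · exact h4.trans (by gcongr)
    _ = C * (sewConst α * ((r / 2) ^ α * 2) + 2 * r ^ α) := by ring
    _ = C * r ^ α * (sewConst α * 2 ^ (1 - α) + 2) := by rw [half]; ring
    _ = sewConst α * C * r ^ α := by rw [sewConst_eq hα]; ring

lemma sum_range_two_mul (f : ℕ → E) (n : ℕ) :
    ∑ i ∈ Finset.range (2 * n), f i = ∑ i ∈ Finset.range n, (f (2 * i) + f (2 * i + 1)) := by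
  induction n with
  | zero => simp
  | succ n ih =>
    rw [Nat.mul_succ, Finset.sum_range_succ, Finset.sum_range_succ, Finset.sum_range_succ, ih]
    abel

variable {T a b C α : ℝ} {Ξ : ℝ → ℝ → E}

/-- Grid cells outside `[s,t]` collapse to a point under `clamp` and add nothing, so one dyadic grid
of `[0,T]` serves all subintervals simultaneously. -/
lemma sum_clamp_rpow_le (hα : 1 < α) (ha : 0 ≤ a) (hb : b ≤ T) {s t : ℝ} (has : a ≤ s)
    (hst : s ≤ t) (htb : t ≤ b) (n : ℕ) :
    ∑ i ∈ Finset.range (2 ^ n), (clamp s t (grid T n (i + 1)) - clamp s t (grid T n i)) ^ α ≤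
      (T / 2 ^ n) ^ (α - 1) * (t - s) := by
  have hT : 0 ≤ T := by linarith
  have := sum_rpow_le (p := fun i => clamp s t (grid T n i)) (n := 2 ^ n) (δ := T / 2 ^ n) hα
    (fun i _ => clamp_mono s t (grid_mono hT n i))
    (fun i _ => by
      rw [← grid_succ_sub T n i]; exact clamp_sub_le s t (grid_mono hT n i))
  rwa [grid_last, grid_zero, clamp_of_ge hst (by linarith), clamp_of_le (by linarith)] at this

/-- The next level inserts one point into each clamped cell, and each insertion costs one defect. -/
lemma DefectBound.norm_sewSum_succ_sub_le (h : DefectBound Ξ a b C α) (hα : 1 < α) (hC : 0 ≤ C)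
    (ha : 0 ≤ a) (hb : b ≤ T) {s t : ℝ} (has : a ≤ s) (hst : s ≤ t) (htb : t ≤ b) (n : ℕ) :
    ‖sewSum T (n + 1) Ξ s t - sewSum T n Ξ s t‖ ≤ C * ((T / 2 ^ n) ^ (α - 1) * (t - s)) := by
  have hT : 0 ≤ T := by linarith
  rw [sewSum, sewSum, pow_succ', sum_range_two_mul, ← Finset.sum_sub_distrib]
  refine (norm_sum_le _ _).trans (le_trans ?_
    (mul_le_mul_of_nonneg_left (sum_clamp_rpow_le hα ha hb has hst htb n) hC))
  rw [Finset.mul_sum]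
  refine Finset.sum_le_sum fun i _ => ?_
  have e0 : grid T (n + 1) (2 * i + 1 + 1) = grid T n (i + 1) := grid_double T n (i + 1)
  rw [e0, grid_double, ← norm_neg]
  have m1 : grid T n i ≤ grid T (n + 1) (2 * i + 1) := by
    rw [← grid_double]; exact grid_mono hT _ _
  have m2 : grid T (n + 1) (2 * i + 1) ≤ grid T n (i + 1) := by
    rw [← e0]; exact grid_mono hT _ _
  have := h _ _ _ (has.trans (le_clamp s t (grid T n i))) (clamp_mono s t m1) (clamp_mono s t m2)
    ((clamp_le hst _).trans htb)
  refine le_trans (le_of_eq ?_) this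
  congr 1
  simp only [defect]
  abel

lemma DefectBound.norm_sewSum_sub_le (h : DefectBound Ξ a b C α) (hα : 1 < α) (hC : 0 ≤ C)
    (ha : 0 ≤ a) (hb : b ≤ T) {s t : ℝ} (has : a ≤ s) (hst : s ≤ t) (htb : t ≤ b) (n : ℕ) :
    ‖sewSum T n Ξ s t - Ξ s t‖ ≤ sewConst α * C * (t - s) ^ α := by
  have hT : 0 ≤ T := by linarith
  have e1 : clamp s t (grid T n (2 ^ n)) = t := by
    rw [grid_last]; exact clamp_of_ge hst (by linarith)
  have e0 : clamp s t (grid T n 0) = s := by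
    rw [grid_zero]; exact clamp_of_le (by linarith)
  have := h.norm_sum_sub_le hα hC (p := fun i => clamp s t (grid T n i))
    (monotone_nat_of_le_succ fun i => clamp_mono s t (grid_mono hT n i)) (2 ^ n) 0 (2 ^ n) (by simp)
    (has.trans (le_clamp _ _ _)) ((clamp_le hst _).trans htb)
  rw [← Finset.range_eq_Ico, e0, e1] at this
  exact this

lemma tendsto_mesh_rpow (T : ℝ) (hα : 1 < α) :
    Tendsto (fun n : ℕ => (T / 2 ^ n) ^ (α - 1)) atTop (𝓝 0) := by
  have h1 : Tendsto (fun n : ℕ => T / 2 ^ n) atTop (𝓝 0) :=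
    Tendsto.div_atTop tendsto_const_nhds (tendsto_pow_atTop_atTop_of_one_lt one_lt_two)
  have := h1.rpow_const (p := α - 1) (Or.inr (by linarith))
  rwa [Real.zero_rpow (by linarith)] at this

/-- Differences of consecutive dyadic levels decay geometrically with ratio `2 ^ (1 - α) < 1`. -/
lemma DefectBound.tendsto_sewSum [CompleteSpace E] (h : DefectBound Ξ a b C α) (hα : 1 < α)
    (hC : 0 ≤ C) (ha : 0 ≤ a) (hb : b ≤ T) {s t : ℝ} (has : a ≤ s) (hst : s ≤ t) (htb : t ≤ b) :
    Tendsto (fun n => sewSum T n Ξ s t) atTop (𝓝 (sew T Ξ s t)) := by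
  have hT : 0 ≤ T := by linarith
  refine CauchySeq.tendsto_limUnder (cauchySeq_of_le_geometric ((2 : ℝ) ^ (1 - α))
    (C * (T ^ (α - 1) * (t - s))) (two_rpow_lt_one hα) fun n => ?_)
  rw [dist_comm, dist_eq_norm]
  refine (h.norm_sewSum_succ_sub_le hα hC ha hb has hst htb n).trans (le_of_eq ?_)
  rw [Real.div_rpow hT (by positivity), ← Real.rpow_natCast, ← Real.rpow_natCast,
    ← Real.rpow_mul zero_le_two, ← Real.rpow_mul zero_le_two, div_eq_mul_inv,
    ← Real.rpow_neg zero_le_two]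
  ring_nf

lemma DefectBound.norm_sew_sub_le [CompleteSpace E] (h : DefectBound Ξ a b C α) (hα : 1 < α)
    (hC : 0 ≤ C) (ha : 0 ≤ a) (hb : b ≤ T) {s t : ℝ} (has : a ≤ s) (hst : s ≤ t) (htb : t ≤ b) :
    ‖sew T Ξ s t - Ξ s t‖ ≤ sewConst α * C * (t - s) ^ α :=
  le_of_tendsto ((h.tendsto_sewSum hα hC ha hb has hst htb).sub_const _).norm
    (Eventually.of_forall fun n => h.norm_sewSum_sub_le hα hC ha hb has hst htb n)

/-- Only the cell containing `u` spoils the additivity of a Riemann sum. Allowing the same error in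
every cell still yields a bound that vanishes with the mesh, so the limit is additive. -/
lemma DefectBound.norm_sewSum_defect_le (h : DefectBound Ξ a b C α) (hα : 1 < α) (hC : 0 ≤ C)
    (ha : 0 ≤ a) (hb : b ≤ T) {s u t : ℝ} (has : a ≤ s) (hsu : s ≤ u) (hut : u ≤ t)
    (htb : t ≤ b) (n : ℕ) :
    ‖sewSum T n Ξ s t - sewSum T n Ξ s u - sewSum T n Ξ u t‖ ≤
      C * ((T / 2 ^ n) ^ (α - 1) * (t - s)) := by
  have hT : 0 ≤ T := by linarith
  have hst := hsu.trans hut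
  have huu := h.diag hα (has.trans hsu) (hut.trans htb)
  rw [sewSum, sewSum, sewSum, ← Finset.sum_sub_distrib, ← Finset.sum_sub_distrib]
  refine (norm_sum_le _ _).trans (le_trans ?_
    (mul_le_mul_of_nonneg_left (sum_clamp_rpow_le hα ha hb has hst htb n) hC))
  rw [Finset.mul_sum]
  refine Finset.sum_le_sum fun i _ => ?_
  have hxy := grid_mono hT n i
  set x := grid T n i
  set y := grid T n (i + 1)
  have hpos : 0 ≤ C * (clamp s t y - clamp s t x) ^ α :=
    mul_nonneg hC (Real.rpow_nonneg (sub_nonneg.2 (clamp_mono s t hxy)) _)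
  have left : ∀ z, z ≤ u → clamp s u z = clamp s t z := fun z hz => by
    rw [clamp, clamp, min_eq_right hz, min_eq_right (hz.trans hut)]
  have right : ∀ z, u ≤ z → clamp u t z = clamp s t z := fun z hz => by
    rw [clamp, clamp, max_eq_right (le_min hut hz), max_eq_right (le_min hst (hsu.trans hz))]
  rcases le_total y u with hyu | huy
  · rw [left y hyu, left x (hxy.trans hyu), clamp_of_le hyu, clamp_of_le (hxy.trans hyu), huu]
    simpa using hpos
  rcases le_total u x with hux | hxu
  · rw [right x hux, right y huy, clamp_of_ge hsu hux, clamp_of_ge hsu huy, huu]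
    simpa using hpos
  rw [left x hxu, right y huy, clamp_of_ge hsu huy, clamp_of_le hxu]
  refine h _ u _ (has.trans (le_clamp _ _ _)) ?_ ?_ ((clamp_le hst _).trans htb)
  · rw [← left x hxu]; exact clamp_le hsu x
  · rw [← right y huy]; exact le_clamp u t y

lemma DefectBound.sew_add [CompleteSpace E] (h : DefectBound Ξ a b C α) (hα : 1 < α)
    (hC : 0 ≤ C) (ha : 0 ≤ a) (hb : b ≤ T) {s u t : ℝ} (has : a ≤ s) (hsu : s ≤ u) (hut : u ≤ t)
    (htb : t ≤ b) : sew T Ξ s t = sew T Ξ s u + sew T Ξ u t := by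
  have hT : 0 ≤ T := by linarith
  have lim := ((h.tendsto_sewSum hα hC ha hb has (hsu.trans hut) htb).sub
    (h.tendsto_sewSum hα hC ha hb has hsu (hut.trans htb))).sub
    (h.tendsto_sewSum hα hC ha hb (has.trans hsu) hut htb)
  have zero : Tendsto (fun n : ℕ => C * ((T / 2 ^ n) ^ (α - 1) * (t - s))) atTop (𝓝 0) := by
    simpa using ((tendsto_mesh_rpow T hα).mul_const (t - s)).const_mul C
  have := tendsto_nhds_unique lim (squeeze_zero_norm
    (fun n => h.norm_sewSum_defect_le hα hC ha hb has hsu hut htb n) zero)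
  rw [sub_sub, sub_eq_zero] at this
  exact this

lemma sewSum_congr {Ξ' : ℝ → ℝ → E} {s t : ℝ} (hst : s ≤ t) (hT : 0 ≤ T)
    (h : ∀ x y, s ≤ x → x ≤ y → y ≤ t → Ξ x y = Ξ' x y) (n : ℕ) :
    sewSum T n Ξ s t = sewSum T n Ξ' s t :=
  Finset.sum_congr rfl fun _ _ => h _ _ (le_clamp _ _ _) (clamp_mono s t (grid_mono hT n _))
    (clamp_le hst _)

lemma sew_congr {Ξ' : ℝ → ℝ → E} {s t : ℝ} (hst : s ≤ t) (hT : 0 ≤ T)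
    (h : ∀ x y, s ≤ x → x ≤ y → y ≤ t → Ξ x y = Ξ' x y) : sew T Ξ s t = sew T Ξ' s t := by
  simp only [sew, sewSum_congr hst hT h]

lemma sewSum_sub (Ξ Ξ' : ℝ → ℝ → E) (n : ℕ) (s t : ℝ) :
    sewSum T n (fun x y => Ξ x y - Ξ' x y) s t = sewSum T n Ξ s t - sewSum T n Ξ' s t := by
  simp [sewSum, Finset.sum_sub_distrib]

lemma DefectBound.sew_sub [CompleteSpace E] {Ξ' : ℝ → ℝ → E} {C' α' : ℝ}
    (h : DefectBound Ξ a b C α) (hα : 1 < α) (hC : 0 ≤ C)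
    (h' : DefectBound Ξ' a b C' α') (hα' : 1 < α') (hC' : 0 ≤ C') (ha : 0 ≤ a) (hb : b ≤ T)
    {s t : ℝ} (has : a ≤ s) (hst : s ≤ t) (htb : t ≤ b) :
    sew T (fun x y => Ξ x y - Ξ' x y) s t = sew T Ξ s t - sew T Ξ' s t := by
  refine Tendsto.limUnder_eq ?_
  simp only [sewSum_sub]
  exact (h.tendsto_sewSum hα hC ha hb has hst htb).sub
    (h'.tendsto_sewSum hα' hC' ha hb has hst htb)

/-- Additivity of a two-parameter function on `[a,b]`. -/
def AdditiveOn (G : ℝ → ℝ → E) (a b : ℝ) : Prop :=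
  ∀ s u t, a ≤ s → s ≤ u → u ≤ t → t ≤ b → G s t = G s u + G u t

lemma AdditiveOn.diag {G : ℝ → ℝ → E} (h : AdditiveOn G a b) {s : ℝ} (has : a ≤ s)
    (hsb : s ≤ b) : G s s = 0 := by
  have := h s s s has le_rfl le_rfl hsb
  rwa [left_eq_add] at this

section Chain

variable {p : ℕ → ℝ} {n : ℕ}

lemma chain_le (hp : ∀ i < n, p i ≤ p (i + 1)) {i j : ℕ} (hij : i ≤ j) (hj : j ≤ n) :
    p i ≤ p j := by
  induction j, hij using Nat.le_induction with
  | base => exact le_rfl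
  | succ j _ ih => exact (ih (by omega)).trans (hp j (by omega))

lemma AdditiveOn.sum_range {G : ℝ → ℝ → E} (h : AdditiveOn G a b)
    (hp : ∀ i < n, p i ≤ p (i + 1)) (hap : a ≤ p 0) (hpb : p n ≤ b) :
    ∑ i ∈ Finset.range n, G (p i) (p (i + 1)) = G (p 0) (p n) := by
  suffices ∀ k ≤ n, ∑ i ∈ Finset.range k, G (p i) (p (i + 1)) = G (p 0) (p k) from this n le_rfl
  intro k
  induction k with
  | zero =>
    intro _
    rw [Finset.sum_range_zero, h.diag hap ((chain_le hp (Nat.zero_le n) le_rfl).trans hpb)]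
  | succ k ih =>
    intro hk
    rw [Finset.sum_range_succ, ih (by omega)]
    exact (h _ _ _ hap (chain_le hp (Nat.zero_le k) (by omega)) (hp k (by omega))
      ((chain_le hp hk le_rfl).trans hpb)).symm

end Chain

lemma DefectBound.additiveOn_sew [CompleteSpace E] (h : DefectBound Ξ a b C α) (hα : 1 < α)
    (hC : 0 ≤ C) (ha : 0 ≤ a) (hb : b ≤ T) : AdditiveOn (sew T Ξ) a b :=
  fun _ _ _ has hsu hut htb => h.sew_add hα hC ha hb has hsu hut htb

/-- Riemann sums of `Ξ` differ little from the sewing of `Ξ` if the mesh is small. -/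
lemma DefectBound.norm_sum_sub_sew_le [CompleteSpace E] (h : DefectBound Ξ a b C α) (hα : 1 < α)
    (hC : 0 ≤ C) (ha : 0 ≤ a) (hb : b ≤ T) {p : ℕ → ℝ} {n : ℕ} {δ : ℝ}
    (hp : ∀ i < n, p i ≤ p (i + 1)) (hδ : ∀ i < n, p (i + 1) - p i ≤ δ)
    (hap : a ≤ p 0) (hpb : p n ≤ b) :
    ‖∑ i ∈ Finset.range n, Ξ (p i) (p (i + 1)) - sew T Ξ (p 0) (p n)‖ ≤
      sewConst α * C * (δ ^ (α - 1) * (p n - p 0)) := by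
  -- The sewing is additive, so it splits along the same partition and each cell contributes one
  -- error of order `α`.
  rw [← (h.additiveOn_sew hα hC ha hb).sum_range hp hap hpb, ← Finset.sum_sub_distrib]
  refine (norm_sum_le _ _).trans (le_trans ?_ (mul_le_mul_of_nonneg_left (sum_rpow_le hα hp hδ)
    (mul_nonneg (sewConst_nonneg hα) hC)))
  rw [Finset.mul_sum]
  refine Finset.sum_le_sum fun i hi => ?_
  have hi := Finset.mem_range.1 hi
  rw [norm_sub_rev]
  exact h.norm_sew_sub_le hα hC ha hb (hap.trans (chain_le hp (Nat.zero_le i) hi.le)) (hp i hi)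
    ((chain_le hp hi le_rfl).trans hpb)

end Sewing

/-! ### Planar sewing: one direction after the other. -/

section PlanarSewing

variable {E : Type*} [NormedAddCommGroup E]

lemma DefectBound.sub {Ξ Ξ' : ℝ → ℝ → E} {a b C C' α : ℝ} (h : DefectBound Ξ a b C α)
    (h' : DefectBound Ξ' a b C' α) :
    DefectBound (fun x y => Ξ x y - Ξ' x y) a b (C + C') α := by
  intro s u t h1 h2 h3 h4
  have e : defect (fun x y => Ξ x y - Ξ' x y) s u t = defect Ξ s u t - defect Ξ' s u t := by
    simp only [defect]; abel
  rw [e, add_mul]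
  exact (norm_sub_le _ _).trans (add_le_add (h s u t h1 h2 h3 h4) (h' s u t h1 h2 h3 h4))

/-- Bounds for the defects of additivity of `Ξ s₁ t₁ s₂ t₂`, a function of the rectangles
`[s₁,t₁] × [s₂,t₂]` contained in `[a₁,b₁] × [a₂,b₂]`, in the two directions separately and
jointly. -/
structure PlanarDefectBound (Ξ : ℝ → ℝ → ℝ → ℝ → E)
    (a₁ b₁ a₂ b₂ C₁ C₂ C₁₂ γ₁ γ₂ α₁ α₂ : ℝ) : Prop where
  fst : ∀ s₁ u₁ t₁ s₂ t₂, a₁ ≤ s₁ → s₁ ≤ u₁ → u₁ ≤ t₁ → t₁ ≤ b₁ → a₂ ≤ s₂ → s₂ ≤ t₂ → t₂ ≤ b₂ →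
    ‖defect (fun x y => Ξ x y s₂ t₂) s₁ u₁ t₁‖ ≤ C₁ * (t₂ - s₂) ^ γ₂ * (t₁ - s₁) ^ α₁
  snd : ∀ s₁ t₁ s₂ u₂ t₂, a₁ ≤ s₁ → s₁ ≤ t₁ → t₁ ≤ b₁ → a₂ ≤ s₂ → s₂ ≤ u₂ → u₂ ≤ t₂ → t₂ ≤ b₂ →
    ‖defect (Ξ s₁ t₁) s₂ u₂ t₂‖ ≤ C₂ * (t₁ - s₁) ^ γ₁ * (t₂ - s₂) ^ α₂
  both : ∀ s₁ u₁ t₁ s₂ u₂ t₂, a₁ ≤ s₁ → s₁ ≤ u₁ → u₁ ≤ t₁ → t₁ ≤ b₁ → a₂ ≤ s₂ → s₂ ≤ u₂ →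
    u₂ ≤ t₂ → t₂ ≤ b₂ →
    ‖defect (fun x y => defect (Ξ x y) s₂ u₂ t₂) s₁ u₁ t₁‖ ≤
      C₁₂ * (t₂ - s₂) ^ α₂ * (t₁ - s₁) ^ α₁

/-- Sewing in the first direction. -/
noncomputable def sewFst (T : ℝ) (Ξ : ℝ → ℝ → ℝ → ℝ → E) (s₁ t₁ s₂ t₂ : ℝ) : E :=
  sew T (fun x y => Ξ x y s₂ t₂) s₁ t₁

/-- Sewing in both directions. -/
noncomputable def planarSew (T : ℝ) (Ξ : ℝ → ℝ → ℝ → ℝ → E) (s₁ t₁ s₂ t₂ : ℝ) : E :=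
  sew T (sewFst T Ξ s₁ t₁) s₂ t₂

namespace PlanarDefectBound

variable {Ξ Ξ' : ℝ → ℝ → ℝ → ℝ → E} {T a₁ b₁ a₂ b₂ C₁ C₂ C₁₂ C₁' C₂' C₁₂' γ₁ γ₂ α₁ α₂ : ℝ}

lemma defectBound_fst (h : PlanarDefectBound Ξ a₁ b₁ a₂ b₂ C₁ C₂ C₁₂ γ₁ γ₂ α₁ α₂) {s₂ t₂ : ℝ}
    (hs : a₂ ≤ s₂) (hst : s₂ ≤ t₂) (ht : t₂ ≤ b₂) :
    DefectBound (fun x y => Ξ x y s₂ t₂) a₁ b₁ (C₁ * (t₂ - s₂) ^ γ₂) α₁ :=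
  fun s u t h1 h2 h3 h4 => h.fst s u t s₂ t₂ h1 h2 h3 h4 hs hst ht

lemma defectBound_both (h : PlanarDefectBound Ξ a₁ b₁ a₂ b₂ C₁ C₂ C₁₂ γ₁ γ₂ α₁ α₂) {s₂ u₂ t₂ : ℝ}
    (hs : a₂ ≤ s₂) (hsu : s₂ ≤ u₂) (hut : u₂ ≤ t₂) (ht : t₂ ≤ b₂) :
    DefectBound (fun x y => defect (Ξ x y) s₂ u₂ t₂) a₁ b₁ (C₁₂ * (t₂ - s₂) ^ α₂) α₁ :=
  fun s u t h1 h2 h3 h4 => h.both s u t s₂ u₂ t₂ h1 h2 h3 h4 hs hsu hut ht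

variable [CompleteSpace E]

/-- Sewing is linear in the germ, so it commutes with taking defects in the other direction. -/
lemma defect_sewFst (h : PlanarDefectBound Ξ a₁ b₁ a₂ b₂ C₁ C₂ C₁₂ γ₁ γ₂ α₁ α₂) (hα₁ : 1 < α₁)
    (hC₁ : 0 ≤ C₁) (ha₁ : 0 ≤ a₁) (hb₁ : b₁ ≤ T) {s₁ t₁ s₂ u₂ t₂ : ℝ}
    (hs₁ : a₁ ≤ s₁) (hst₁ : s₁ ≤ t₁) (ht₁ : t₁ ≤ b₁)
    (hs : a₂ ≤ s₂) (hsu : s₂ ≤ u₂) (hut : u₂ ≤ t₂) (ht : t₂ ≤ b₂) :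
    defect (sewFst T Ξ s₁ t₁) s₂ u₂ t₂ =
      sew T (fun x y => defect (Ξ x y) s₂ u₂ t₂) s₁ t₁ := by
  have pos : ∀ {x y : ℝ}, x ≤ y → 0 ≤ C₁ * (y - x) ^ γ₂ := fun hxy =>
    mul_nonneg hC₁ (Real.rpow_nonneg (sub_nonneg.2 hxy) _)
  have h1 := h.defectBound_fst hs (hsu.trans hut) ht
  have h2 := h.defectBound_fst hs hsu (hut.trans ht)
  have h3 := h.defectBound_fst (hs.trans hsu) hut ht
  have e1 := h1.sew_sub hα₁ (pos (hsu.trans hut)) h2 hα₁ (pos hsu) ha₁ hb₁ hs₁ hst₁ ht₁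
  have e2 := (h1.sub h2).sew_sub hα₁ (add_nonneg (pos (hsu.trans hut)) (pos hsu)) h3 hα₁ (pos hut)
    ha₁ hb₁ hs₁ hst₁ ht₁
  rw [e1] at e2
  exact e2.symm

/-- The joint defect bound says that the second-direction defect is itself a sewable germ in the
first direction; the one-parameter lemma then compares its sewing with it. -/
lemma norm_defect_sewFst_sub_le (h : PlanarDefectBound Ξ a₁ b₁ a₂ b₂ C₁ C₂ C₁₂ γ₁ γ₂ α₁ α₂)
    (hα₁ : 1 < α₁) (hC₁ : 0 ≤ C₁) (hC₁₂ : 0 ≤ C₁₂) (ha₁ : 0 ≤ a₁) (hb₁ : b₁ ≤ T)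
    {s₁ t₁ s₂ u₂ t₂ : ℝ} (hs₁ : a₁ ≤ s₁) (hst₁ : s₁ ≤ t₁) (ht₁ : t₁ ≤ b₁)
    (hs : a₂ ≤ s₂) (hsu : s₂ ≤ u₂) (hut : u₂ ≤ t₂) (ht : t₂ ≤ b₂) :
    ‖defect (sewFst T Ξ s₁ t₁) s₂ u₂ t₂ - defect (Ξ s₁ t₁) s₂ u₂ t₂‖ ≤
      sewConst α₁ * C₁₂ * (t₁ - s₁) ^ α₁ * (t₂ - s₂) ^ α₂ := by
  rw [h.defect_sewFst hα₁ hC₁ ha₁ hb₁ hs₁ hst₁ ht₁ hs hsu hut ht]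
  have hst : s₂ ≤ t₂ := hsu.trans hut
  refine ((h.defectBound_both hs hsu hut ht).norm_sew_sub_le hα₁
    (mul_nonneg hC₁₂ (Real.rpow_nonneg (sub_nonneg.2 hst) _)) ha₁ hb₁ hs₁ hst₁ ht₁).trans
    (le_of_eq (by ring))

/-- This permits the second sewing. The two terms are the defect of the original germ and the change
of that defect caused by the first sewing. -/
lemma defectBound_sewFst (h : PlanarDefectBound Ξ a₁ b₁ a₂ b₂ C₁ C₂ C₁₂ γ₁ γ₂ α₁ α₂)
    (hα₁ : 1 < α₁) (hC₁ : 0 ≤ C₁) (hC₁₂ : 0 ≤ C₁₂) (ha₁ : 0 ≤ a₁) (hb₁ : b₁ ≤ T)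
    {s₁ t₁ : ℝ} (hs₁ : a₁ ≤ s₁) (hst₁ : s₁ ≤ t₁) (ht₁ : t₁ ≤ b₁) :
    DefectBound (sewFst T Ξ s₁ t₁) a₂ b₂
      (C₂ * (t₁ - s₁) ^ γ₁ + sewConst α₁ * C₁₂ * (t₁ - s₁) ^ α₁) α₂ := by
  intro s₂ u₂ t₂ hs hsu hut ht
  have h1 := h.norm_defect_sewFst_sub_le hα₁ hC₁ hC₁₂ ha₁ hb₁ hs₁ hst₁ ht₁ hs hsu hut ht
  have h2 := h.snd s₁ t₁ s₂ u₂ t₂ hs₁ hst₁ ht₁ hs hsu hut ht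
  rw [add_mul]
  exact (norm_le_norm_add_norm_sub' _ (defect (Ξ s₁ t₁) s₂ u₂ t₂)).trans (add_le_add h2 h1)

lemma sewFst_bound_nonneg (hα₁ : 1 < α₁) (hC₂ : 0 ≤ C₂) (hC₁₂ : 0 ≤ C₁₂)
    {s₁ t₁ : ℝ} (hst₁ : s₁ ≤ t₁) :
    0 ≤ C₂ * (t₁ - s₁) ^ γ₁ + sewConst α₁ * C₁₂ * (t₁ - s₁) ^ α₁ := by
  have := sewConst_nonneg hα₁
  have := sub_nonneg.2 hst₁
  positivity

/-- The planar sewing lemma: distance to the germ. -/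
lemma norm_planarSew_sub_le (h : PlanarDefectBound Ξ a₁ b₁ a₂ b₂ C₁ C₂ C₁₂ γ₁ γ₂ α₁ α₂)
    (hα₁ : 1 < α₁) (hα₂ : 1 < α₂) (hC₁ : 0 ≤ C₁) (hC₂ : 0 ≤ C₂) (hC₁₂ : 0 ≤ C₁₂)
    (ha₁ : 0 ≤ a₁) (hb₁ : b₁ ≤ T) (ha₂ : 0 ≤ a₂) (hb₂ : b₂ ≤ T)
    {s₁ t₁ s₂ t₂ : ℝ} (hs₁ : a₁ ≤ s₁) (hst₁ : s₁ ≤ t₁) (ht₁ : t₁ ≤ b₁)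
    (hs₂ : a₂ ≤ s₂) (hst₂ : s₂ ≤ t₂) (ht₂ : t₂ ≤ b₂) :
    ‖planarSew T Ξ s₁ t₁ s₂ t₂ - Ξ s₁ t₁ s₂ t₂‖ ≤
      sewConst α₁ * (C₁ * (t₂ - s₂) ^ γ₂) * (t₁ - s₁) ^ α₁ +
      sewConst α₂ * (C₂ * (t₁ - s₁) ^ γ₁ + sewConst α₁ * C₁₂ * (t₁ - s₁) ^ α₁) *
        (t₂ - s₂) ^ α₂ := by
  have h1 := (h.defectBound_fst hs₂ hst₂ ht₂).norm_sew_sub_le hα₁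
    (mul_nonneg hC₁ (Real.rpow_nonneg (sub_nonneg.2 hst₂) _)) ha₁ hb₁ hs₁ hst₁ ht₁
  have h2 := (h.defectBound_sewFst hα₁ hC₁ hC₁₂ ha₁ hb₁ hs₁ hst₁ ht₁).norm_sew_sub_le hα₂
    (sewFst_bound_nonneg hα₁ hC₂ hC₁₂ hst₁) ha₂ hb₂ hs₂ hst₂ ht₂
  rw [add_comm]
  exact (norm_sub_le_norm_sub_add_norm_sub _ _ _).trans (add_le_add h2 h1)

lemma additiveOn_snd (h : PlanarDefectBound Ξ a₁ b₁ a₂ b₂ C₁ C₂ C₁₂ γ₁ γ₂ α₁ α₂)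
    (hα₁ : 1 < α₁) (hα₂ : 1 < α₂) (hC₁ : 0 ≤ C₁) (hC₂ : 0 ≤ C₂) (hC₁₂ : 0 ≤ C₁₂)
    (ha₁ : 0 ≤ a₁) (hb₁ : b₁ ≤ T) (ha₂ : 0 ≤ a₂) (hb₂ : b₂ ≤ T)
    {s₁ t₁ : ℝ} (hs₁ : a₁ ≤ s₁) (hst₁ : s₁ ≤ t₁) (ht₁ : t₁ ≤ b₁) :
    AdditiveOn (planarSew T Ξ s₁ t₁) a₂ b₂ :=
  (h.defectBound_sewFst hα₁ hC₁ hC₁₂ ha₁ hb₁ hs₁ hst₁ ht₁).additiveOn_sew hα₂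
    (sewFst_bound_nonneg hα₁ hC₂ hC₁₂ hst₁) ha₂ hb₂

lemma additiveOn_sewFst (h : PlanarDefectBound Ξ a₁ b₁ a₂ b₂ C₁ C₂ C₁₂ γ₁ γ₂ α₁ α₂)
    (hα₁ : 1 < α₁) (hC₁ : 0 ≤ C₁) (ha₁ : 0 ≤ a₁) (hb₁ : b₁ ≤ T)
    {s₂ t₂ : ℝ} (hs₂ : a₂ ≤ s₂) (hst₂ : s₂ ≤ t₂) (ht₂ : t₂ ≤ b₂) :
    AdditiveOn (fun x y => sewFst T Ξ x y s₂ t₂) a₁ b₁ :=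
  (h.defectBound_fst hs₂ hst₂ ht₂).additiveOn_sew hα₁
    (mul_nonneg hC₁ (Real.rpow_nonneg (sub_nonneg.2 hst₂) _)) ha₁ hb₁

/-- The outer sewing acts on the second variables, so additivity in the first ones is that of
`sewFst` carried through by linearity of `sew`. -/
lemma additiveOn_fst (h : PlanarDefectBound Ξ a₁ b₁ a₂ b₂ C₁ C₂ C₁₂ γ₁ γ₂ α₁ α₂)
    (hα₁ : 1 < α₁) (hα₂ : 1 < α₂) (hC₁ : 0 ≤ C₁) (hC₂ : 0 ≤ C₂) (hC₁₂ : 0 ≤ C₁₂)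
    (ha₁ : 0 ≤ a₁) (hb₁ : b₁ ≤ T) (ha₂ : 0 ≤ a₂) (hb₂ : b₂ ≤ T)
    {s₂ t₂ : ℝ} (hs₂ : a₂ ≤ s₂) (hst₂ : s₂ ≤ t₂) (ht₂ : t₂ ≤ b₂) :
    AdditiveOn (fun x y => planarSew T Ξ x y s₂ t₂) a₁ b₁ := by
  intro s u t hs hsu hut ht
  have hT : 0 ≤ T := by linarith
  have key := (h.defectBound_sewFst hα₁ hC₁ hC₁₂ ha₁ hb₁ hs (hsu.trans hut) ht).sew_sub hα₂
    (sewFst_bound_nonneg hα₁ hC₂ hC₁₂ (hsu.trans hut))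
    (h.defectBound_sewFst hα₁ hC₁ hC₁₂ ha₁ hb₁ hs hsu (hut.trans ht)) hα₂
    (sewFst_bound_nonneg hα₁ hC₂ hC₁₂ hsu) ha₂ hb₂ hs₂ hst₂ ht₂
  have e : sew T (fun x y => sewFst T Ξ s t x y - sewFst T Ξ s u x y) s₂ t₂ =
      planarSew T Ξ u t s₂ t₂ := by
    refine sew_congr hst₂ hT fun x y hx hxy hy => ?_
    have := h.additiveOn_sewFst hα₁ hC₁ ha₁ hb₁ (hs₂.trans hx) hxy (hy.trans ht₂) s u t hs hsu hut ht
    simp only at this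
    rw [this, add_sub_cancel_left]
  rw [e] at key
  exact sub_eq_iff_eq_add'.1 key.symm

lemma planarSew_sub (h : PlanarDefectBound Ξ a₁ b₁ a₂ b₂ C₁ C₂ C₁₂ γ₁ γ₂ α₁ α₂)
    (h' : PlanarDefectBound Ξ' a₁ b₁ a₂ b₂ C₁' C₂' C₁₂' γ₁ γ₂ α₁ α₂)
    (hα₁ : 1 < α₁) (hα₂ : 1 < α₂) (hC₁ : 0 ≤ C₁) (hC₂ : 0 ≤ C₂) (hC₁₂ : 0 ≤ C₁₂)
    (hC₁' : 0 ≤ C₁') (hC₂' : 0 ≤ C₂') (hC₁₂' : 0 ≤ C₁₂')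
    (ha₁ : 0 ≤ a₁) (hb₁ : b₁ ≤ T) (ha₂ : 0 ≤ a₂) (hb₂ : b₂ ≤ T)
    {s₁ t₁ s₂ t₂ : ℝ} (hs₁ : a₁ ≤ s₁) (hst₁ : s₁ ≤ t₁) (ht₁ : t₁ ≤ b₁)
    (hs₂ : a₂ ≤ s₂) (hst₂ : s₂ ≤ t₂) (ht₂ : t₂ ≤ b₂) :
    planarSew T (fun s₁ t₁ s₂ t₂ => Ξ s₁ t₁ s₂ t₂ - Ξ' s₁ t₁ s₂ t₂) s₁ t₁ s₂ t₂ =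
      planarSew T Ξ s₁ t₁ s₂ t₂ - planarSew T Ξ' s₁ t₁ s₂ t₂ := by
  have hT : 0 ≤ T := by linarith
  rw [planarSew, planarSew, planarSew,
    ← (h.defectBound_sewFst hα₁ hC₁ hC₁₂ ha₁ hb₁ hs₁ hst₁ ht₁).sew_sub hα₂
      (sewFst_bound_nonneg hα₁ hC₂ hC₁₂ hst₁)
      (h'.defectBound_sewFst hα₁ hC₁' hC₁₂' ha₁ hb₁ hs₁ hst₁ ht₁) hα₂
      (sewFst_bound_nonneg hα₁ hC₂' hC₁₂' hst₁) ha₂ hb₂ hs₂ hst₂ ht₂]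
  refine sew_congr hst₂ hT fun x y hx hxy hy => ?_
  exact (h.defectBound_fst (hs₂.trans hx) hxy (hy.trans ht₂)).sew_sub hα₁
    (mul_nonneg hC₁ (Real.rpow_nonneg (sub_nonneg.2 hxy) _))
    (h'.defectBound_fst (hs₂.trans hx) hxy (hy.trans ht₂)) hα₁
    (mul_nonneg hC₁' (Real.rpow_nonneg (sub_nonneg.2 hxy) _)) ha₁ hb₁ hs₁ hst₁ ht₁

/-- The defect in the second direction of the error made by sewing in the first direction. -/
lemma defectBound_sub_sewFst (h : PlanarDefectBound Ξ a₁ b₁ a₂ b₂ C₁ C₂ C₁₂ γ₁ γ₂ α₁ α₂)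
    (hα₁ : 1 < α₁) (hC₁ : 0 ≤ C₁) (hC₁₂ : 0 ≤ C₁₂) (ha₁ : 0 ≤ a₁) (hb₁ : b₁ ≤ T)
    {s₁ t₁ : ℝ} (hs₁ : a₁ ≤ s₁) (hst₁ : s₁ ≤ t₁) (ht₁ : t₁ ≤ b₁) :
    DefectBound (fun x y => Ξ s₁ t₁ x y - sewFst T Ξ s₁ t₁ x y) a₂ b₂
      (sewConst α₁ * C₁₂ * (t₁ - s₁) ^ α₁) α₂ := by
  intro s₂ u₂ t₂ hs hsu hut ht
  have h1 := h.norm_defect_sewFst_sub_le hα₁ hC₁ hC₁₂ ha₁ hb₁ hs₁ hst₁ ht₁ hs hsu hut ht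
  rw [norm_sub_rev] at h1
  refine le_trans (le_of_eq ?_) h1
  congr 1
  simp only [defect]
  abel

/-- Riemann sums over a grid differ little from the planar sewing if the mesh is small. -/
lemma exists_norm_sum_sub_planarSew_le
    (h : PlanarDefectBound Ξ a₁ b₁ a₂ b₂ C₁ C₂ C₁₂ γ₁ γ₂ α₁ α₂)
    (hα₁ : 1 < α₁) (hα₂ : 1 < α₂) (hC₁ : 0 ≤ C₁) (hC₂ : 0 ≤ C₂) (hC₁₂ : 0 ≤ C₁₂)
    (ha₁ : 0 ≤ a₁) (hb₁ : b₁ ≤ T) (ha₂ : 0 ≤ a₂) (hb₂ : b₂ ≤ T)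
    {s₁ t₁ s₂ t₂ : ℝ} (hs₁ : a₁ ≤ s₁) (hst₁ : s₁ ≤ t₁) (ht₁ : t₁ ≤ b₁)
    (hs₂ : a₂ ≤ s₂) (hst₂ : s₂ ≤ t₂) (ht₂ : t₂ ≤ b₂) :
    ∃ M M' : ℝ, ∀ (p q : ℕ → ℝ) (n m : ℕ) (δ : ℝ), p 0 = s₁ → p n = t₁ → q 0 = s₂ → q m = t₂ →
      (∀ i < n, p i ≤ p (i + 1)) → (∀ i < n, p (i + 1) - p i ≤ δ) →
      (∀ j < m, q j ≤ q (j + 1)) → (∀ j < m, q (j + 1) - q j ≤ δ) →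
      ‖∑ i ∈ Finset.range n, ∑ j ∈ Finset.range m, Ξ (p i) (p (i + 1)) (q j) (q (j + 1)) -
        planarSew T Ξ s₁ t₁ s₂ t₂‖ ≤ M * δ ^ (α₁ - 1) + M' * δ ^ (α₂ - 1) := by
  set K₁ := sewConst α₁
  set K₂ := sewConst α₂
  have hK₁ : 0 ≤ K₁ := sewConst_nonneg hα₁
  have hK₂ : 0 ≤ K₂ := sewConst_nonneg hα₂
  have hr₂ : 0 ≤ t₂ - s₂ := sub_nonneg.2 hst₂
  set M₀ := K₁ * (C₁ * (t₂ - s₂) ^ γ₂) + K₂ * (K₁ * C₁₂) * (t₂ - s₂) ^ α₂ +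
    K₂ * (K₁ * C₁₂) * ((t₂ - s₂) ^ (α₂ - 1) * (t₂ - s₂)) with hM₀
  have hM₀nn : 0 ≤ M₀ := by positivity
  refine ⟨M₀ * (t₁ - s₁), K₂ * (C₂ * (t₁ - s₁) ^ γ₁ + K₁ * C₁₂ * (t₁ - s₁) ^ α₁) * (t₂ - s₂),
    fun p q n m δ hp0 hpn hq0 hqm hp hpδ hq hqδ => ?_⟩
  have main : ‖∑ j ∈ Finset.range m, sewFst T Ξ s₁ t₁ (q j) (q (j + 1)) -
      planarSew T Ξ s₁ t₁ s₂ t₂‖ ≤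
      K₂ * (C₂ * (t₁ - s₁) ^ γ₁ + K₁ * C₁₂ * (t₁ - s₁) ^ α₁) * (δ ^ (α₂ - 1) * (t₂ - s₂)) := by
    have := (h.defectBound_sewFst hα₁ hC₁ hC₁₂ ha₁ hb₁ hs₁ hst₁ ht₁).norm_sum_sub_sew_le hα₂
      (sewFst_bound_nonneg hα₁ hC₂ hC₁₂ hst₁) ha₂ hb₂ hq hqδ (by rwa [hq0]) (by rwa [hqm])
    rwa [hq0, hqm] at this
  have hsum : ∑ j ∈ Finset.range m, sewFst T Ξ s₁ t₁ (q j) (q (j + 1)) =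
      ∑ i ∈ Finset.range n, ∑ j ∈ Finset.range m,
        sewFst T Ξ (p i) (p (i + 1)) (q j) (q (j + 1)) := by
    rw [Finset.sum_comm]
    refine Finset.sum_congr rfl fun j hj => ?_
    have hj := Finset.mem_range.1 hj
    have := (h.additiveOn_sewFst hα₁ hC₁ ha₁ hb₁ (s₂ := q j) (t₂ := q (j + 1))
      (by rw [← hq0] at hs₂; exact hs₂.trans (chain_le hq (Nat.zero_le j) hj.le)) (hq j hj)
      (by rw [← hqm] at ht₂; exact (chain_le hq hj le_rfl).trans ht₂)).sum_range hp
      (by rwa [hp0]) (by rwa [hpn])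
    rw [hp0, hpn] at this
    exact this.symm
  -- Bounding the cells of a strip one by one would leave a sum of `(q (j + 1) - q j) ^ γ₂`, which
  -- need not stay bounded when `γ₂ < 1`. The error of the first sewing is instead almost additive
  -- in the second direction, so its sum over the strip is compared with its own sewing.
  have cell : ∀ i ∈ Finset.range n,
      ‖∑ j ∈ Finset.range m, (Ξ (p i) (p (i + 1)) (q j) (q (j + 1)) -
        sewFst T Ξ (p i) (p (i + 1)) (q j) (q (j + 1)))‖ ≤ M₀ * (p (i + 1) - p i) ^ α₁ := by
    intro i hi
    have hi := Finset.mem_range.1 hi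
    have c1 : a₁ ≤ p i := by
      rw [← hp0] at hs₁; exact hs₁.trans (chain_le hp (Nat.zero_le i) hi.le)
    have c2 := hp i hi
    have c3 : p (i + 1) ≤ b₁ := by rw [← hpn] at ht₁; exact (chain_le hp hi le_rfl).trans ht₁
    have hr₁ : 0 ≤ p (i + 1) - p i := sub_nonneg.2 c2
    have hD := h.defectBound_sub_sewFst hα₁ hC₁ hC₁₂ ha₁ hb₁ c1 c2 c3
    have hDpos : 0 ≤ sewConst α₁ * C₁₂ * (p (i + 1) - p i) ^ α₁ := by positivity
    -- The trivial mesh `t₂ - s₂` suffices: smallness comes from the power `α₁` of the strip width,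
    -- summed over the strips.
    have b1 := hD.norm_sum_sub_sew_le hα₂ hDpos ha₂ hb₂ hq (δ := t₂ - s₂)
      (fun j hj => by
        have := chain_le hq (Nat.zero_le j) hj.le
        have := chain_le hq hj le_rfl
        rw [hq0] at *; rw [hqm] at *; linarith) (by rwa [hq0]) (by rwa [hqm])
    rw [hq0, hqm] at b1
    have b2 := hD.norm_sew_sub_le hα₂ hDpos ha₂ hb₂ hs₂ hst₂ ht₂
    have b3 := (h.defectBound_fst hs₂ hst₂ ht₂).norm_sew_sub_le hα₁
      (mul_nonneg hC₁ (Real.rpow_nonneg hr₂ _)) ha₁ hb₁ c1 c2 c3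
    rw [norm_sub_rev] at b3
    refine (norm_le_norm_add_norm_sub' _ _).trans (add_le_add
      ((norm_le_norm_add_norm_sub' _ _).trans (add_le_add b3 b2)) b1) |>.trans (le_of_eq ?_)
    rw [hM₀]
    ring
  have err : ‖∑ i ∈ Finset.range n, ∑ j ∈ Finset.range m, Ξ (p i) (p (i + 1)) (q j) (q (j + 1)) -
      ∑ i ∈ Finset.range n, ∑ j ∈ Finset.range m,
        sewFst T Ξ (p i) (p (i + 1)) (q j) (q (j + 1))‖ ≤ M₀ * (δ ^ (α₁ - 1) * (t₁ - s₁)) := by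
    simp only [← Finset.sum_sub_distrib]
    refine (norm_sum_le_of_le _ cell).trans ?_
    rw [← Finset.mul_sum, ← hp0, ← hpn]
    exact mul_le_mul_of_nonneg_left (sum_rpow_le hα₁ hp hpδ) hM₀nn
  rw [hsum] at main
  refine (norm_sub_le_norm_sub_add_norm_sub _ _ _).trans ((add_le_add err main).trans (le_of_eq ?_))
  ring

end PlanarDefectBound

end PlanarSewing

/-! ### Four-point estimates for maps in `C_b^{2+η}`. -/

section FourPoint

variable {E F : Type*} [NormedAddCommGroup E] [NormedSpace ℝ E] [NormedAddCommGroup F]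
  [NormedSpace ℝ F]

lemma hasDerivAt_comp_line {g : E → F} (hg : Differentiable ℝ g) (x v : E) (l : ℝ) :
    HasDerivAt (fun l : ℝ => g (x + l • v)) (fderiv ℝ g (x + l • v) v) l := by
  have h1 : HasDerivAt (fun l : ℝ => x + l • v) v l := by
    simpa using ((hasDerivAt_id l).smul_const v).const_add x
  exact (hg (x + l • v)).hasFDerivAt.comp_hasDerivAt l h1

lemma norm_add_smul_sub_le {a b : E} {ε l : ℝ} (ha : ‖a‖ ≤ ε) (hb : ‖b‖ ≤ ε) (h0 : 0 ≤ l)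
    (h1 : l ≤ 1) : ‖a + l • (b - a)‖ ≤ ε := by
  have e : a + l • (b - a) = (1 - l) • a + l • b := by module
  rw [e]
  refine (norm_add_le _ _).trans ?_
  rw [norm_smul, norm_smul, Real.norm_of_nonneg h0, Real.norm_of_nonneg (sub_nonneg.2 h1)]
  nlinarith [sub_nonneg.2 h1]

/-- Four-point estimate for a differentiable map whose derivative varies by at most `κ` on
distances at most `ε`. -/
lemma norm_four_point_le {g : E → F} (hg : Differentiable ℝ g) {K κ ε d e : ℝ}
    (hK : ∀ x, ‖fderiv ℝ g x‖ ≤ K)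
    (hκ : ∀ x y, ‖x - y‖ ≤ ε → ‖fderiv ℝ g x - fderiv ℝ g y‖ ≤ κ)
    {x₁₁ x₁₀ x₀₁ x₀₀ : E} (h₀ : ‖x₁₀ - x₀₀‖ ≤ ε) (h₁ : ‖x₁₁ - x₀₁‖ ≤ ε)
    (hd : ‖x₁₁ - x₁₀‖ ≤ d) (he : ‖x₁₁ - x₁₀ - x₀₁ + x₀₀‖ ≤ e) :
    ‖g x₁₁ - g x₁₀ - g x₀₁ + g x₀₀‖ ≤ κ * d + K * e := by
  have hK0 : 0 ≤ K := (norm_nonneg _).trans (hK 0)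
  have hκ0 : 0 ≤ κ := (norm_nonneg _).trans (hκ 0 0 (by simpa using (norm_nonneg _).trans h₀))
  -- Mean value inequality along the edges from `x₁₀` to `x₁₁` and from `x₀₀` to `x₀₁`, traversed
  -- simultaneously.
  have key := norm_image_sub_le_of_norm_deriv_le_segment_01'
    (f := fun l : ℝ => g (x₁₀ + l • (x₁₁ - x₁₀)) - g (x₀₀ + l • (x₀₁ - x₀₀))) (C := κ * d + K * e)
    (fun l _ => ((hasDerivAt_comp_line hg x₁₀ (x₁₁ - x₁₀) l).sub
      (hasDerivAt_comp_line hg x₀₀ (x₀₁ - x₀₀) l)).hasDerivWithinAt) ?_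
  · have e1 : g x₁₁ - g x₁₀ - g x₀₁ + g x₀₀ =
        (g (x₁₀ + (1 : ℝ) • (x₁₁ - x₁₀)) - g (x₀₀ + (1 : ℝ) • (x₀₁ - x₀₀))) -
        (g (x₁₀ + (0 : ℝ) • (x₁₁ - x₁₀)) - g (x₀₀ + (0 : ℝ) • (x₀₁ - x₀₀))) := by
      simp only [one_smul, zero_smul, add_zero, add_sub_cancel]
      abel
    rw [e1]
    exact key
  · intro l hl
    set p := x₁₀ + l • (x₁₁ - x₁₀)
    set q := x₀₀ + l • (x₀₁ - x₀₀)
    have hpq : ‖p - q‖ ≤ ε := by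
      have : p - q = (x₁₀ - x₀₀) + l • ((x₁₁ - x₀₁) - (x₁₀ - x₀₀)) := by
        simp only [p, q]; module
      rw [this]
      exact norm_add_smul_sub_le h₀ h₁ hl.1 hl.2.le
    -- Change of base point in a fixed direction, then change of direction at a fixed base point.
    have e2 : fderiv ℝ g p (x₁₁ - x₁₀) - fderiv ℝ g q (x₀₁ - x₀₀) =
        (fderiv ℝ g p - fderiv ℝ g q) (x₁₁ - x₁₀) +
          fderiv ℝ g q (x₁₁ - x₁₀ - x₀₁ + x₀₀) := by
      simp only [sub_apply, map_sub, map_add]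
      abel
    rw [e2]
    refine (norm_add_le _ _).trans (add_le_add ?_ ?_)
    · exact (ContinuousLinearMap.le_of_opNorm_le_of_le _ (hκ p q hpq) hd)
    · exact (ContinuousLinearMap.le_of_opNorm_le_of_le _ (hK q) he)

/-- Bounds for the increments of the values at the four corners of a rectangle. -/
structure QuadBound (x₁₁ x₁₀ x₀₁ x₀₀ : E) (ε₁ ε₂ e : ℝ) : Prop where
  fst₀ : ‖x₁₀ - x₀₀‖ ≤ ε₁
  fst₁ : ‖x₁₁ - x₀₁‖ ≤ ε₁
  snd₀ : ‖x₀₁ - x₀₀‖ ≤ ε₂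
  snd₁ : ‖x₁₁ - x₁₀‖ ≤ ε₂
  both : ‖x₁₁ - x₁₀ - x₀₁ + x₀₀‖ ≤ e

/-- All five conditions bound norms of linear expressions in the corners, hence are convex. This
serves to interpolate between two paths. -/
lemma QuadBound.segment {x₁₁ x₁₀ x₀₁ x₀₀ y₁₁ y₁₀ y₀₁ y₀₀ : E} {ε₁ ε₂ e l : ℝ}
    (hx : QuadBound x₁₁ x₁₀ x₀₁ x₀₀ ε₁ ε₂ e) (hy : QuadBound y₁₁ y₁₀ y₀₁ y₀₀ ε₁ ε₂ e)
    (h0 : 0 ≤ l) (h1 : l ≤ 1) :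
    QuadBound (x₁₁ + l • (y₁₁ - x₁₁)) (x₁₀ + l • (y₁₀ - x₁₀)) (x₀₁ + l • (y₀₁ - x₀₁))
      (x₀₀ + l • (y₀₀ - x₀₀)) ε₁ ε₂ e where
  fst₀ := by
    convert norm_add_smul_sub_le hx.fst₀ hy.fst₀ h0 h1 using 2; module
  fst₁ := by
    convert norm_add_smul_sub_le hx.fst₁ hy.fst₁ h0 h1 using 2; module
  snd₀ := by
    convert norm_add_smul_sub_le hx.snd₀ hy.snd₀ h0 h1 using 2; module
  snd₁ := by
    convert norm_add_smul_sub_le hx.snd₁ hy.snd₁ h0 h1 using 2; module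
  both := by
    convert norm_add_smul_sub_le hx.both hy.both h0 h1 using 2; module

namespace HolderTwoNormLE

variable {η K : ℝ} {f : E → E}

lemma nonneg (h : HolderTwoNormLE η f K) : 0 ≤ K := (norm_nonneg _).trans (h.bound_zero 0)

lemma differentiable (h : HolderTwoNormLE η f K) : Differentiable ℝ f :=
  h.contDiff.differentiable two_ne_zero

lemma differentiable_fderiv (h : HolderTwoNormLE η f K) : Differentiable ℝ (fderiv ℝ f) :=
  (h.contDiff.fderiv_right (m := 1) (by norm_num)).differentiable one_ne_zero

lemma norm_sub_le (h : HolderTwoNormLE η f K) (x y : E) : ‖f x - f y‖ ≤ K * ‖x - y‖ :=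
  Convex.norm_image_sub_le_of_norm_fderiv_le (fun z _ => h.differentiable z)
    (fun z _ => h.bound_one z) convex_univ (Set.mem_univ y) (Set.mem_univ x)

lemma norm_fderiv_sub_le (h : HolderTwoNormLE η f K) (x y : E) :
    ‖fderiv ℝ f x - fderiv ℝ f y‖ ≤ K * ‖x - y‖ :=
  Convex.norm_image_sub_le_of_norm_fderiv_le (fun z _ => h.differentiable_fderiv z)
    (fun z _ => h.bound_two z) convex_univ (Set.mem_univ y) (Set.mem_univ x)

lemma norm_four_point_le (h : HolderTwoNormLE η f K) {ε d e : ℝ} {x₁₁ x₁₀ x₀₁ x₀₀ : E}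
    (h₀ : ‖x₁₀ - x₀₀‖ ≤ ε) (h₁ : ‖x₁₁ - x₀₁‖ ≤ ε) (hd : ‖x₁₁ - x₁₀‖ ≤ d)
    (he : ‖x₁₁ - x₁₀ - x₀₁ + x₀₀‖ ≤ e) :
    ‖f x₁₁ - f x₁₀ - f x₀₁ + f x₀₀‖ ≤ K * ε * d + K * e :=
  NLY.norm_four_point_le h.differentiable h.bound_one
    (fun x y hxy => (h.norm_fderiv_sub_le x y).trans (mul_le_mul_of_nonneg_left hxy h.nonneg))
    h₀ h₁ hd he

/-- The exponent `η` enters here, as the modulus of continuity of `D²f`. Since `εᵢ ≤ 1`, the better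
term `ε₁ * ε₂` is absorbed into the Hölder one. -/
lemma norm_fderiv_four_point_le (h : HolderTwoNormLE η f K) (hη : η ∈ Set.Ioo (0 : ℝ) 1)
    {ε₁ ε₂ : ℝ} (hε₁ : ε₁ ≤ 1) (hε₂ : ε₂ ≤ 1) {x₁₁ x₁₀ x₀₁ x₀₀ : E}
    (hx : QuadBound x₁₁ x₁₀ x₀₁ x₀₀ ε₁ ε₂ (ε₁ * ε₂)) :
    ‖fderiv ℝ f x₁₁ - fderiv ℝ f x₁₀ - fderiv ℝ f x₀₁ + fderiv ℝ f x₀₀‖ ≤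
      2 * K * (ε₁ ^ η * ε₂ ^ η) := by
  have hK := h.nonneg
  have h1 : 0 ≤ ε₁ := (norm_nonneg _).trans hx.fst₀
  have h2 : 0 ≤ ε₂ := (norm_nonneg _).trans hx.snd₀
  have le1 : ε₁ ≤ ε₁ ^ η := Real.self_le_rpow_of_le_one h1 hε₁ hη.2.le
  have le2 : ε₂ ≤ ε₂ ^ η := Real.self_le_rpow_of_le_one h2 hε₂ hη.2.le
  have := NLY.norm_four_point_le h.differentiable_fderiv h.bound_two
    (fun x y hxy => (h.holder_two x y).trans (mul_le_mul_of_nonneg_left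
      (Real.rpow_le_rpow (norm_nonneg _) hxy hη.1.le) hK)) hx.fst₀ hx.fst₁ hx.snd₁ hx.both
  calc _ ≤ K * ε₁ ^ η * ε₂ + K * (ε₁ * ε₂) := this
    _ ≤ K * ε₁ ^ η * ε₂ ^ η + K * (ε₁ ^ η * ε₂ ^ η) := by gcongr
    _ = _ := by ring

/-- Comparison of the rectangular increments of `f` along two quadruples of points. -/
lemma norm_four_point_sub_le (h : HolderTwoNormLE η f K) (hη : η ∈ Set.Ioo (0 : ℝ) 1)
    {ε₁ ε₂ D : ℝ} (hε₁ : ε₁ ≤ 1) (hε₂ : ε₂ ≤ 1)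
    {x₁₁ x₁₀ x₀₁ x₀₀ y₁₁ y₁₀ y₀₁ y₀₀ : E}
    (hx : QuadBound x₁₁ x₁₀ x₀₁ x₀₀ ε₁ ε₂ (ε₁ * ε₂))
    (hy : QuadBound y₁₁ y₁₀ y₀₁ y₀₀ ε₁ ε₂ (ε₁ * ε₂))
    (hxy : QuadBound (y₁₁ - x₁₁) (y₁₀ - x₁₀) (y₀₁ - x₀₁) (y₀₀ - x₀₀) (D * ε₁) (D * ε₂)
      (D * (ε₁ * ε₂))) (hD : ‖y₁₁ - x₁₁‖ ≤ D) :
    ‖(f y₁₁ - f x₁₁) - (f y₁₀ - f x₁₀) - (f y₀₁ - f x₀₁) + (f y₀₀ - f x₀₀)‖ ≤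
      5 * K * D * (ε₁ ^ η * ε₂ ^ η) := by
  have hK := h.nonneg
  have hD0 : 0 ≤ D := (norm_nonneg _).trans hD
  have h1 : 0 ≤ ε₁ := (norm_nonneg _).trans hx.fst₀
  have h2 : 0 ≤ ε₂ := (norm_nonneg _).trans hx.snd₀
  have le1 : ε₁ ≤ ε₁ ^ η := Real.self_le_rpow_of_le_one h1 hε₁ hη.2.le
  have le2 : ε₂ ≤ ε₂ ^ η := Real.self_le_rpow_of_le_one h2 hε₂ hη.2.le
  have le12 : ε₁ * ε₂ ≤ ε₁ ^ η * ε₂ ^ η := by gcongr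
  have line := fun x y l => hasDerivAt_comp_line h.differentiable x (y - x) l
  have key := norm_image_sub_le_of_norm_deriv_le_segment_01'
    (f := fun l : ℝ => f (x₁₁ + l • (y₁₁ - x₁₁)) - f (x₁₀ + l • (y₁₀ - x₁₀)) -
      f (x₀₁ + l • (y₀₁ - x₀₁)) + f (x₀₀ + l • (y₀₀ - x₀₀)))
    (C := 5 * K * D * (ε₁ ^ η * ε₂ ^ η))
    (fun l _ => ((((line x₁₁ y₁₁ l).sub (line x₁₀ y₁₀ l)).sub (line x₀₁ y₀₁ l)).add
      (line x₀₀ y₀₀ l)).hasDerivWithinAt) ?_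
  · have e1 : (f y₁₁ - f x₁₁) - (f y₁₀ - f x₁₀) - (f y₀₁ - f x₀₁) + (f y₀₀ - f x₀₀) =
        (f (x₁₁ + (1 : ℝ) • (y₁₁ - x₁₁)) - f (x₁₀ + (1 : ℝ) • (y₁₀ - x₁₀)) -
          f (x₀₁ + (1 : ℝ) • (y₀₁ - x₀₁)) + f (x₀₀ + (1 : ℝ) • (y₀₀ - x₀₀))) -
        (f (x₁₁ + (0 : ℝ) • (y₁₁ - x₁₁)) - f (x₁₀ + (0 : ℝ) • (y₁₀ - x₁₀)) -
          f (x₀₁ + (0 : ℝ) • (y₀₁ - x₀₁)) + f (x₀₀ + (0 : ℝ) • (y₀₀ - x₀₀))) := by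
      simp only [one_smul, zero_smul, add_zero, add_sub_cancel]
      abel
    rw [e1]
    exact key
  · intro l hl
    have hp := hx.segment hy hl.1 hl.2.le
    set p₁₁ := x₁₁ + l • (y₁₁ - x₁₁)
    set p₁₀ := x₁₀ + l • (y₁₀ - x₁₀)
    set p₀₁ := x₀₁ + l • (y₀₁ - x₀₁)
    set p₀₀ := x₀₀ + l • (y₀₀ - x₀₀)
    set g := fderiv ℝ f
    set Δ₁₁ := y₁₁ - x₁₁
    set Δ₁₀ := y₁₀ - x₁₀
    set Δ₀₁ := y₀₁ - x₀₁
    set Δ₀₀ := y₀₀ - x₀₀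
    -- Discrete product rule for the derivative of the interpolation. Every term carries a factor
    -- `D`, and the four terms give the constant `5 = 2 + 1 + 1 + 1`.
    have e2 : g p₁₁ Δ₁₁ - g p₁₀ Δ₁₀ - g p₀₁ Δ₀₁ + g p₀₀ Δ₀₀ =
        (g p₁₁ - g p₁₀ - g p₀₁ + g p₀₀) Δ₁₁ + (g p₁₀ - g p₀₀) (Δ₁₁ - Δ₁₀) +
        (g p₀₁ - g p₀₀) (Δ₁₁ - Δ₀₁) + g p₀₀ (Δ₁₁ - Δ₁₀ - Δ₀₁ + Δ₀₀) := by
      simp only [sub_apply, add_apply, map_sub, map_add]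
      abel
    rw [e2]
    have b1 := ContinuousLinearMap.le_of_opNorm_le_of_le _
      (h.norm_fderiv_four_point_le hη hε₁ hε₂ hp) hD
    have b2 := ContinuousLinearMap.le_of_opNorm_le_of_le _
      ((h.norm_fderiv_sub_le p₁₀ p₀₀).trans (mul_le_mul_of_nonneg_left hp.fst₀ hK)) hxy.snd₁
    have b3 := ContinuousLinearMap.le_of_opNorm_le_of_le _
      ((h.norm_fderiv_sub_le p₀₁ p₀₀).trans (mul_le_mul_of_nonneg_left hp.snd₀ hK)) hxy.fst₁
    have b4 := ContinuousLinearMap.le_of_opNorm_le_of_le _ (h.bound_one p₀₀) hxy.both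
    refine (norm_add_le_of_le (norm_add_le_of_le (norm_add_le_of_le b1 b2) b3) b4).trans ?_
    calc _ = K * D * (2 * (ε₁ ^ η * ε₂ ^ η) + 3 * (ε₁ * ε₂)) := by ring
      _ ≤ K * D * (2 * (ε₁ ^ η * ε₂ ^ η) + 3 * (ε₁ ^ η * ε₂ ^ η)) := by gcongr
      _ = _ := by ring

end HolderTwoNormLE

end FourPoint

/-! ### Defects of the Young germ and estimates of the integral on a box. -/

section Germ

variable {E : Type*} [NormedAddCommGroup E]

/-- The germ `□_{s,t}A(θ_s)` of the nonlinear Young integral. -/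
def germ (A : ℝ × ℝ → E → E) (θ : ℝ × ℝ → E) (s₁ t₁ s₂ t₂ : ℝ) : E :=
  rectInc A (s₁, s₂) (t₁, t₂) (θ (s₁, s₂))

/-- The increments of `A` are additive in the rectangle, so only the shift of the evaluation point
survives. -/
lemma defect_germ_fst (A : ℝ × ℝ → E → E) (θ : ℝ × ℝ → E) (s₁ u₁ t₁ s₂ t₂ : ℝ) :
    defect (fun x y => germ A θ x y s₂ t₂) s₁ u₁ t₁ =
      rectInc A (u₁, s₂) (t₁, t₂) (θ (s₁, s₂)) - rectInc A (u₁, s₂) (t₁, t₂) (θ (u₁, s₂)) := by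
  simp only [defect, germ, rectInc, Pi.add_apply, Pi.sub_apply]
  abel

lemma defect_germ_snd (A : ℝ × ℝ → E → E) (θ : ℝ × ℝ → E) (s₁ t₁ s₂ u₂ t₂ : ℝ) :
    defect (germ A θ s₁ t₁) s₂ u₂ t₂ =
      rectInc A (s₁, u₂) (t₁, t₂) (θ (s₁, s₂)) - rectInc A (s₁, u₂) (t₁, t₂) (θ (s₁, u₂)) := by
  simp only [defect, germ, rectInc, Pi.add_apply, Pi.sub_apply]
  abel

/-- The joint defect is a rectangular increment, along `θ`, of one fixed map: this is what the
four-point estimates control. -/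
lemma defect_germ_both (A : ℝ × ℝ → E → E) (θ : ℝ × ℝ → E) (s₁ u₁ t₁ s₂ u₂ t₂ : ℝ) :
    defect (fun x y => defect (germ A θ x y) s₂ u₂ t₂) s₁ u₁ t₁ =
      rectInc A (u₁, u₂) (t₁, t₂) (θ (u₁, u₂)) - rectInc A (u₁, u₂) (t₁, t₂) (θ (u₁, s₂)) -
      rectInc A (u₁, u₂) (t₁, t₂) (θ (s₁, u₂)) + rectInc A (u₁, u₂) (t₁, t₂) (θ (s₁, s₂)) := by
  simp only [defect, germ, rectInc, Pi.add_apply, Pi.sub_apply]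
  abel

/-- Joint Hölder bounds on the rectangle `[a₁,b₁] × [a₂,b₂]`. -/
structure HolderBox (γ₁ γ₂ k₁ k₂ k₁₂ a₁ b₁ a₂ b₂ : ℝ) (θ : ℝ × ℝ → E) : Prop where
  fst : ∀ s₁ t₁ x₂, a₁ ≤ s₁ → s₁ ≤ t₁ → t₁ ≤ b₁ → a₂ ≤ x₂ → x₂ ≤ b₂ →
    ‖θ (t₁, x₂) - θ (s₁, x₂)‖ ≤ k₁ * (t₁ - s₁) ^ γ₁
  snd : ∀ x₁ s₂ t₂, a₁ ≤ x₁ → x₁ ≤ b₁ → a₂ ≤ s₂ → s₂ ≤ t₂ → t₂ ≤ b₂ →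
    ‖θ (x₁, t₂) - θ (x₁, s₂)‖ ≤ k₂ * (t₂ - s₂) ^ γ₂
  both : ∀ s₁ t₁ s₂ t₂, a₁ ≤ s₁ → s₁ ≤ t₁ → t₁ ≤ b₁ → a₂ ≤ s₂ → s₂ ≤ t₂ → t₂ ≤ b₂ →
    ‖rectInc θ (s₁, s₂) (t₁, t₂)‖ ≤ k₁₂ * ((t₁ - s₁) ^ γ₁ * (t₂ - s₂) ^ γ₂)

variable {θ θ' : ℝ × ℝ → E}
  {η T γ₁ γ₂ L D k₁ k₂ k₁₂ a₁ b₁ a₂ b₂ : ℝ}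

lemma HolderBox.mono {a₁' b₁' a₂' b₂' : ℝ} (h : HolderBox γ₁ γ₂ k₁ k₂ k₁₂ a₁ b₁ a₂ b₂ θ)
    (ha₁ : a₁ ≤ a₁') (hb₁ : b₁' ≤ b₁) (ha₂ : a₂ ≤ a₂') (hb₂ : b₂' ≤ b₂) :
    HolderBox γ₁ γ₂ k₁ k₂ k₁₂ a₁' b₁' a₂' b₂' θ where
  fst s t x h1 h2 h3 h4 h5 := h.fst s t x (ha₁.trans h1) h2 (h3.trans hb₁) (ha₂.trans h4)
    (h5.trans hb₂)
  snd x s t h1 h2 h3 h4 h5 := h.snd x s t (ha₁.trans h1) (h2.trans hb₁) (ha₂.trans h3) h4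
    (h5.trans hb₂)
  both s₁ t₁ s₂ t₂ h1 h2 h3 h4 h5 h6 := h.both s₁ t₁ s₂ t₂ (ha₁.trans h1) h2 (h3.trans hb₁)
    (ha₂.trans h4) h5 (h6.trans hb₂)

lemma HolderBox.quadBound (h : HolderBox γ₁ γ₂ k₁ k₂ k₁₂ a₁ b₁ a₂ b₂ θ) (hγ₁ : 0 ≤ γ₁)
    (hγ₂ : 0 ≤ γ₂) (hk₁ : 0 ≤ k₁) (hk₂ : 0 ≤ k₂) (hk₁₂ : 0 ≤ k₁₂) {s₁ u₁ t₁ s₂ u₂ t₂ : ℝ}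
    (hs₁ : a₁ ≤ s₁) (hsu₁ : s₁ ≤ u₁) (hut₁ : u₁ ≤ t₁) (ht₁ : t₁ ≤ b₁)
    (hs₂ : a₂ ≤ s₂) (hsu₂ : s₂ ≤ u₂) (hut₂ : u₂ ≤ t₂) (ht₂ : t₂ ≤ b₂) :
    QuadBound (θ (u₁, u₂)) (θ (u₁, s₂)) (θ (s₁, u₂)) (θ (s₁, s₂)) (k₁ * (t₁ - s₁) ^ γ₁)
      (k₂ * (t₂ - s₂) ^ γ₂) (k₁₂ * ((t₁ - s₁) ^ γ₁ * (t₂ - s₂) ^ γ₂)) := by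
  have p1 : 0 ≤ u₁ - s₁ := sub_nonneg.2 hsu₁
  have p2 : 0 ≤ u₂ - s₂ := sub_nonneg.2 hsu₂
  have m1 : (u₁ - s₁) ^ γ₁ ≤ (t₁ - s₁) ^ γ₁ := Real.rpow_le_rpow p1 (by linarith) hγ₁
  have m2 : (u₂ - s₂) ^ γ₂ ≤ (t₂ - s₂) ^ γ₂ := Real.rpow_le_rpow p2 (by linarith) hγ₂
  have hub₁ := hut₁.trans ht₁
  have hub₂ := hut₂.trans ht₂
  have r1 := Real.rpow_nonneg (p1.trans (sub_le_sub_right hut₁ s₁)) γ₁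
  have r2 := Real.rpow_nonneg p2 γ₂
  have n1 := mul_le_mul_of_nonneg_left m1 hk₁
  have n2 := mul_le_mul_of_nonneg_left m2 hk₂
  refine ⟨(h.fst s₁ u₁ s₂ hs₁ hsu₁ hub₁ hs₂ (hsu₂.trans hub₂)).trans n1,
    (h.fst s₁ u₁ u₂ hs₁ hsu₁ hub₁ (hs₂.trans hsu₂) hub₂).trans n1,
    (h.snd s₁ s₂ u₂ hs₁ (hsu₁.trans hub₁) hs₂ hsu₂ hub₂).trans n2,
    (h.snd u₁ s₂ u₂ (hs₁.trans hsu₁) hub₁ hs₂ hsu₂ hub₂).trans n2,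
    (h.both s₁ u₁ s₂ u₂ hs₁ hsu₁ hub₁ hs₂ hsu₂ hub₂).trans ?_⟩
  gcongr

variable [NormedSpace ℝ E] {A : ℝ × ℝ → E → E}

/-- The rectangular increments of the field `A` over `[0,T]²` are of order `(γ₁,γ₂)` in
`C_b^{2+η}`. -/
def FieldBound (η T γ₁ γ₂ L : ℝ) (A : ℝ × ℝ → E → E) : Prop :=
  ∀ s₁ t₁ s₂ t₂, 0 ≤ s₁ → s₁ ≤ t₁ → t₁ ≤ T → 0 ≤ s₂ → s₂ ≤ t₂ → t₂ ≤ T →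
    HolderTwoNormLE η (rectInc A (s₁, s₂) (t₁, t₂)) (L * ((t₁ - s₁) ^ γ₁ * (t₂ - s₂) ^ γ₂))

lemma FieldBound.mono_rect (hA : FieldBound η T γ₁ γ₂ L A) (hL : 0 ≤ L) (hγ₁ : 0 ≤ γ₁)
    (hγ₂ : 0 ≤ γ₂) {s₁ u₁ t₁ s₂ u₂ t₂ : ℝ} (hs₁ : 0 ≤ s₁) (hsu₁ : s₁ ≤ u₁) (hut₁ : u₁ ≤ t₁)
    (ht₁ : t₁ ≤ T) (hs₂ : 0 ≤ s₂) (hsu₂ : s₂ ≤ u₂) (hut₂ : u₂ ≤ t₂) (ht₂ : t₂ ≤ T) :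
    HolderTwoNormLE η (rectInc A (u₁, u₂) (t₁, t₂))
      (L * ((t₁ - s₁) ^ γ₁ * (t₂ - s₂) ^ γ₂)) := by
  have h := hA u₁ t₁ u₂ t₂ (hs₁.trans hsu₁) hut₁ ht₁ (hs₂.trans hsu₂) hut₂ ht₂
  have p1 : 0 ≤ t₁ - u₁ := sub_nonneg.2 hut₁
  have p2 : 0 ≤ t₂ - u₂ := sub_nonneg.2 hut₂
  have m1 : (t₁ - u₁) ^ γ₁ ≤ (t₁ - s₁) ^ γ₁ := Real.rpow_le_rpow p1 (by linarith) hγ₁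
  have m2 : (t₂ - u₂) ^ γ₂ ≤ (t₂ - s₂) ^ γ₂ := Real.rpow_le_rpow p2 (by linarith) hγ₂
  have m : L * ((t₁ - u₁) ^ γ₁ * (t₂ - u₂) ^ γ₂) ≤ L * ((t₁ - s₁) ^ γ₁ * (t₂ - s₂) ^ γ₂) := by
    have := Real.rpow_nonneg p2 γ₂
    have := (Real.rpow_nonneg p1 γ₁).trans m1
    gcongr
  exact ⟨h.contDiff, fun x => (h.bound_zero x).trans m, fun x => (h.bound_one x).trans m,
    fun x => (h.bound_two x).trans m, fun x y => (h.holder_two x y).trans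
      (mul_le_mul_of_nonneg_right m (Real.rpow_nonneg (norm_nonneg _) _))⟩

lemma rpow_two_mul {r γ : ℝ} (hr : 0 ≤ r) (hγ : 0 ≤ γ) : r ^ (2 * γ) = r ^ γ * r ^ γ := by
  rw [two_mul, Real.rpow_add_of_nonneg hr hγ hγ]

lemma rpow_one_add_mul {r γ η : ℝ} (hr : 0 ≤ r) (hγ : 0 ≤ γ) (hη : 0 ≤ η) :
    r ^ ((1 + η) * γ) = r ^ γ * (r ^ γ) ^ η := by
  rw [add_mul, one_mul, Real.rpow_add_of_nonneg hr hγ (mul_nonneg hη hγ), mul_comm η,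
    Real.rpow_mul hr]

/-- The germ of the integral along a jointly Hölder path can be sewn. -/
lemma HolderBox.planarDefectBound (hθ : HolderBox γ₁ γ₂ k₁ k₂ (k₁ * k₂) a₁ b₁ a₂ b₂ θ)
    (hA : FieldBound η T γ₁ γ₂ L A) (hL : 0 ≤ L) (hγ₁ : 0 ≤ γ₁) (hγ₂ : 0 ≤ γ₂)
    (hk₁ : 0 ≤ k₁) (hk₂ : 0 ≤ k₂) (ha₁ : 0 ≤ a₁) (hb₁ : b₁ ≤ T) (ha₂ : 0 ≤ a₂) (hb₂ : b₂ ≤ T) :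
    PlanarDefectBound (germ A θ) a₁ b₁ a₂ b₂ (L * k₁) (L * k₂) (2 * L * (k₁ * k₂)) γ₁ γ₂
      (2 * γ₁) (2 * γ₂) where
  fst s₁ u₁ t₁ s₂ t₂ h1 h2 h3 h4 h5 h6 h7 := by
    have p1 : 0 ≤ t₁ - s₁ := by linarith
    have hF := hA.mono_rect hL hγ₁ hγ₂ (ha₁.trans h1) h2 h3 (h4.trans hb₁) (ha₂.trans h5)
      (le_refl s₂) h6 (h7.trans hb₂)
    have hQ := hθ.quadBound hγ₁ hγ₂ hk₁ hk₂ (mul_nonneg hk₁ hk₂) h1 h2 h3 h4 h5 le_rfl h6 h7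
    -- Of the two powers `γ₁`, one is supplied by the field and one by the path.
    rw [defect_germ_fst, rpow_two_mul p1 hγ₁, norm_sub_rev]
    refine ((hF.norm_sub_le _ _).trans (mul_le_mul_of_nonneg_left hQ.fst₀ hF.nonneg)).trans
      (le_of_eq (by ring))
  snd s₁ t₁ s₂ u₂ t₂ h1 h2 h3 h4 h5 h6 h7 := by
    have p2 : 0 ≤ t₂ - s₂ := by linarith
    have hF := hA.mono_rect hL hγ₁ hγ₂ (ha₁.trans h1) (le_refl s₁) h2 (h3.trans hb₁)
      (ha₂.trans h4) h5 h6 (h7.trans hb₂)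
    have hQ := hθ.quadBound hγ₁ hγ₂ hk₁ hk₂ (mul_nonneg hk₁ hk₂) h1 le_rfl h2 h3 h4 h5 h6 h7
    rw [defect_germ_snd, rpow_two_mul p2 hγ₂, norm_sub_rev]
    refine ((hF.norm_sub_le _ _).trans (mul_le_mul_of_nonneg_left hQ.snd₀ hF.nonneg)).trans
      (le_of_eq (by ring))
  both s₁ u₁ t₁ s₂ u₂ t₂ h1 h2 h3 h4 h5 h6 h7 h8 := by
    have p1 : 0 ≤ t₁ - s₁ := by linarith
    have p2 : 0 ≤ t₂ - s₂ := by linarith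
    have hF := hA.mono_rect hL hγ₁ hγ₂ (ha₁.trans h1) h2 h3 (h4.trans hb₁)
      (ha₂.trans h5) h6 h7 (h8.trans hb₂)
    have hQ := hθ.quadBound hγ₁ hγ₂ hk₁ hk₂ (mul_nonneg hk₁ hk₂) h1 h2 h3 h4 h5 h6 h7 h8
    rw [defect_germ_both, rpow_two_mul p1 hγ₁, rpow_two_mul p2 hγ₂]
    exact (hF.norm_four_point_le hQ.fst₀ hQ.fst₁ hQ.snd₁ hQ.both).trans (le_of_eq (by ring))

/-- The germs of the integrals along two paths: defect bounds of their difference. -/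
lemma HolderBox.planarDefectBound_sub (hη : η ∈ Set.Ioo (0 : ℝ) 1)
    (hθ : HolderBox γ₁ γ₂ k₁ k₂ (k₁ * k₂) a₁ b₁ a₂ b₂ θ)
    (hθ' : HolderBox γ₁ γ₂ k₁ k₂ (k₁ * k₂) a₁ b₁ a₂ b₂ θ')
    (hΔ : HolderBox γ₁ γ₂ (D * k₁) (D * k₂) (D * (k₁ * k₂)) a₁ b₁ a₂ b₂ (fun t => θ' t - θ t))
    (hD : ∀ t₁ t₂, a₁ ≤ t₁ → t₁ ≤ b₁ → a₂ ≤ t₂ → t₂ ≤ b₂ → ‖θ' (t₁, t₂) - θ (t₁, t₂)‖ ≤ D)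
    (hD0 : 0 ≤ D) (hA : FieldBound η T γ₁ γ₂ L A) (hL : 0 ≤ L) (hγ₁ : 0 ≤ γ₁) (hγ₂ : 0 ≤ γ₂)
    (hk₁ : 0 ≤ k₁) (hk₂ : 0 ≤ k₂) (hkb₁ : k₁ * (b₁ - a₁) ^ γ₁ ≤ 1)
    (hkb₂ : k₂ * (b₂ - a₂) ^ γ₂ ≤ 1)
    (ha₁ : 0 ≤ a₁) (hb₁ : b₁ ≤ T) (ha₂ : 0 ≤ a₂) (hb₂ : b₂ ≤ T) :
    PlanarDefectBound (fun s₁ t₁ s₂ t₂ => germ A θ' s₁ t₁ s₂ t₂ - germ A θ s₁ t₁ s₂ t₂)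
      a₁ b₁ a₂ b₂ (2 * L * D * k₁ ^ η) (2 * L * D * k₂ ^ η) (5 * L * D * (k₁ ^ η * k₂ ^ η)) γ₁ γ₂
      ((1 + η) * γ₁) ((1 + η) * γ₂) := by
  have hDk₁ : 0 ≤ D * k₁ := mul_nonneg hD0 hk₁
  have hDk₂ : 0 ≤ D * k₂ := mul_nonneg hD0 hk₂
  have hk₁₂ : 0 ≤ k₁ * k₂ := mul_nonneg hk₁ hk₂
  have hDk₁₂ : 0 ≤ D * (k₁ * k₂) := mul_nonneg hD0 hk₁₂
  have small₁ : ∀ s t, a₁ ≤ s → s ≤ t → t ≤ b₁ → k₁ * (t - s) ^ γ₁ ≤ 1 := fun s t h1 h2 h3 =>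
    (mul_le_mul_of_nonneg_left
      (Real.rpow_le_rpow (by linarith) (by linarith) hγ₁) hk₁).trans hkb₁
  have small₂ : ∀ s t, a₂ ≤ s → s ≤ t → t ≤ b₂ → k₂ * (t - s) ^ γ₂ ≤ 1 := fun s t h1 h2 h3 =>
    (mul_le_mul_of_nonneg_left
      (Real.rpow_le_rpow (by linarith) (by linarith) hγ₂) hk₂).trans hkb₂
  -- The four-point inequality in which one of the two directions is the passage from `θ` to `θ'`;
  -- this direction produces the factor `D`.
  have two_point : ∀ {f : E → E} {K ε : ℝ} {x₁ x₀ y₁ y₀ : E}, HolderTwoNormLE η f K →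
      ε ≤ 1 → ‖x₁ - x₀‖ ≤ ε → ‖y₁ - y₀‖ ≤ ε → ‖(y₁ - x₁) - (y₀ - x₀)‖ ≤ D * ε →
      ‖y₁ - x₁‖ ≤ D → ‖(f y₀ - f y₁) - (f x₀ - f x₁)‖ ≤ 2 * K * D * ε ^ η := by
    intro f K ε x₁ x₀ y₁ y₀ hf hε hx hy hxy hd
    have := hf.norm_four_point_le (x₁₁ := y₁) (x₁₀ := x₁) (x₀₁ := y₀) (x₀₀ := x₀) hx hy hd
      (e := D * ε) (by convert hxy using 2; abel)
    have hε0 : 0 ≤ ε := (norm_nonneg _).trans hx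
    have hK := hf.nonneg
    have le1 : ε ≤ ε ^ η := Real.self_le_rpow_of_le_one hε0 hε hη.2.le
    rw [← norm_neg]
    calc _ = ‖f y₁ - f x₁ - f y₀ + f x₀‖ := by congr 1; abel
      _ ≤ K * ε * D + K * (D * ε) := this
      _ = 2 * K * D * ε := by ring
      _ ≤ _ := by gcongr
  constructor
  · intro s₁ u₁ t₁ s₂ t₂ h1 h2 h3 h4 h5 h6 h7
    have p1 : 0 ≤ t₁ - s₁ := by linarith
    have hF := hA.mono_rect hL hγ₁ hγ₂ (ha₁.trans h1) h2 h3 (h4.trans hb₁) (ha₂.trans h5)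
      (le_refl s₂) h6 (h7.trans hb₂)
    have hQ := hθ.quadBound hγ₁ hγ₂ hk₁ hk₂ hk₁₂ h1 h2 h3 h4 h5 le_rfl h6 h7
    have hQ' := hθ'.quadBound hγ₁ hγ₂ hk₁ hk₂ hk₁₂ h1 h2 h3 h4 h5 le_rfl h6 h7
    have hQΔ := hΔ.quadBound hγ₁ hγ₂ hDk₁ hDk₂ hDk₁₂ h1 h2 h3 h4 h5 le_rfl h6 h7
    have e : defect (fun x y => germ A θ' x y s₂ t₂ - germ A θ x y s₂ t₂) s₁ u₁ t₁ =
        defect (fun x y => germ A θ' x y s₂ t₂) s₁ u₁ t₁ -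
          defect (fun x y => germ A θ x y s₂ t₂) s₁ u₁ t₁ := by
      simp only [defect]; abel
    rw [e, defect_germ_fst, defect_germ_fst, rpow_one_add_mul p1 hγ₁ hη.1.le]
    refine (two_point hF (small₁ s₁ t₁ h1 (h2.trans h3) h4) hQ.fst₀ hQ'.fst₀
      (by rw [← mul_assoc]; exact hQΔ.fst₀)
      (hD _ _ (h1.trans h2) (h3.trans h4) h5 (h6.trans h7))).trans (le_of_eq ?_)
    rw [Real.mul_rpow hk₁ (Real.rpow_nonneg p1 _)]
    ring
  · intro s₁ t₁ s₂ u₂ t₂ h1 h2 h3 h4 h5 h6 h7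
    have p2 : 0 ≤ t₂ - s₂ := by linarith
    have hF := hA.mono_rect hL hγ₁ hγ₂ (ha₁.trans h1) (le_refl s₁) h2 (h3.trans hb₁)
      (ha₂.trans h4) h5 h6 (h7.trans hb₂)
    have hQ := hθ.quadBound hγ₁ hγ₂ hk₁ hk₂ hk₁₂ h1 le_rfl h2 h3 h4 h5 h6 h7
    have hQ' := hθ'.quadBound hγ₁ hγ₂ hk₁ hk₂ hk₁₂ h1 le_rfl h2 h3 h4 h5 h6 h7
    have hQΔ := hΔ.quadBound hγ₁ hγ₂ hDk₁ hDk₂ hDk₁₂ h1 le_rfl h2 h3 h4 h5 h6 h7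
    have e : defect (fun x y => germ A θ' s₁ t₁ x y - germ A θ s₁ t₁ x y) s₂ u₂ t₂ =
        defect (germ A θ' s₁ t₁) s₂ u₂ t₂ - defect (germ A θ s₁ t₁) s₂ u₂ t₂ := by
      simp only [defect]; abel
    rw [e, defect_germ_snd, defect_germ_snd, rpow_one_add_mul p2 hγ₂ hη.1.le]
    refine (two_point hF (small₂ s₂ t₂ h4 (h5.trans h6) h7) hQ.snd₀ hQ'.snd₀
      (by rw [← mul_assoc]; exact hQΔ.snd₀)
      (hD _ _ h1 (h2.trans h3) (h4.trans h5) (h6.trans h7))).trans (le_of_eq ?_)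
    rw [Real.mul_rpow hk₂ (Real.rpow_nonneg p2 _)]
    ring
  · intro s₁ u₁ t₁ s₂ u₂ t₂ h1 h2 h3 h4 h5 h6 h7 h8
    have p1 : 0 ≤ t₁ - s₁ := by linarith
    have p2 : 0 ≤ t₂ - s₂ := by linarith
    have hF := hA.mono_rect hL hγ₁ hγ₂ (ha₁.trans h1) h2 h3 (h4.trans hb₁)
      (ha₂.trans h5) h6 h7 (h8.trans hb₂)
    have hQ := hθ.quadBound hγ₁ hγ₂ hk₁ hk₂ hk₁₂ h1 h2 h3 h4 h5 h6 h7 h8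
    have hQ' := hθ'.quadBound hγ₁ hγ₂ hk₁ hk₂ hk₁₂ h1 h2 h3 h4 h5 h6 h7 h8
    have hQΔ := hΔ.quadBound hγ₁ hγ₂ hDk₁ hDk₂ hDk₁₂ h1 h2 h3 h4 h5 h6 h7 h8
    have e : defect (fun x y => defect (fun x₂ y₂ => germ A θ' x y x₂ y₂ - germ A θ x y x₂ y₂)
          s₂ u₂ t₂) s₁ u₁ t₁ =
        defect (fun x y => defect (germ A θ' x y) s₂ u₂ t₂) s₁ u₁ t₁ -
          defect (fun x y => defect (germ A θ x y) s₂ u₂ t₂) s₁ u₁ t₁ := by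
      simp only [defect]; abel
    rw [e, defect_germ_both, defect_germ_both, rpow_one_add_mul p1 hγ₁ hη.1.le,
      rpow_one_add_mul p2 hγ₂ hη.1.le]
    have e12 : ∀ c : ℝ, c * (k₁ * k₂) * ((t₁ - s₁) ^ γ₁ * (t₂ - s₂) ^ γ₂) =
        c * ((k₁ * (t₁ - s₁) ^ γ₁) * (k₂ * (t₂ - s₂) ^ γ₂)) := fun c => by ring
    -- Regrouped so that the joint bound reads `ε₁ * ε₂` with `εᵢ = kᵢ * (tᵢ - sᵢ) ^ γᵢ`. For this
    -- the joint Hölder constant was taken to be the product `k₁ * k₂`.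
    rw [← one_mul (k₁ * k₂), e12, one_mul] at hQ hQ'
    rw [e12, mul_assoc D, mul_assoc D] at hQΔ
    have := hF.norm_four_point_sub_le hη (small₁ s₁ t₁ h1 (h2.trans h3) h4)
      (small₂ s₂ t₂ h5 (h6.trans h7) h8) hQ hQ' hQΔ
      (hD _ _ (h1.trans h2) (h3.trans h4) (h5.trans h6) (h7.trans h8))
    rw [Real.mul_rpow hk₁ (Real.rpow_nonneg p1 _), Real.mul_rpow hk₂ (Real.rpow_nonneg p2 _)]
      at this
    refine le_trans (le_of_eq ?_) (this.trans (le_of_eq ?_))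
    · congr 1; abel
    · ring

variable [CompleteSpace E]

/-- Size of the integral over a rectangle on which the path oscillates by at most one. -/
lemma HolderBox.norm_planarSew_le (hθ : HolderBox γ₁ γ₂ k₁ k₂ (k₁ * k₂) a₁ b₁ a₂ b₂ θ)
    (hA : FieldBound η T γ₁ γ₂ L A) (hL : 0 ≤ L) (hγ₁ : 1 / 2 < γ₁) (hγ₂ : 1 / 2 < γ₂)
    (hk₁ : 0 ≤ k₁) (hk₂ : 0 ≤ k₂) (hkb₁ : k₁ * (b₁ - a₁) ^ γ₁ ≤ 1)
    (hkb₂ : k₂ * (b₂ - a₂) ^ γ₂ ≤ 1) (hab₁ : a₁ ≤ b₁) (hab₂ : a₂ ≤ b₂)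
    (ha₁ : 0 ≤ a₁) (hb₁ : b₁ ≤ T) (ha₂ : 0 ≤ a₂) (hb₂ : b₂ ≤ T) :
    ‖planarSew T (germ A θ) a₁ b₁ a₂ b₂‖ ≤
      (1 + sewConst (2 * γ₁) + sewConst (2 * γ₂) * (1 + 2 * sewConst (2 * γ₁))) *
        (L * ((b₁ - a₁) ^ γ₁ * (b₂ - a₂) ^ γ₂)) := by
  have p1 : 0 ≤ b₁ - a₁ := sub_nonneg.2 hab₁
  have p2 : 0 ≤ b₂ - a₂ := sub_nonneg.2 hab₂
  have hγ₁' : 0 ≤ γ₁ := by linarith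
  have hγ₂' : 0 ≤ γ₂ := by linarith
  have h := hθ.planarDefectBound hA hL hγ₁' hγ₂' hk₁ hk₂ ha₁ hb₁ ha₂ hb₂
  have key := h.norm_planarSew_sub_le (by linarith) (by linarith) (by positivity) (by positivity)
    (by positivity) ha₁ hb₁ ha₂ hb₂ le_rfl hab₁ le_rfl le_rfl hab₂ le_rfl
  have hF := (hA a₁ b₁ a₂ b₂ ha₁ hab₁ hb₁ ha₂ hab₂ hb₂).bound_zero (θ (a₁, a₂))
  have hK₁ := sewConst_nonneg (α := 2 * γ₁) (by linarith)
  have hK₂ := sewConst_nonneg (α := 2 * γ₂) (by linarith)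
  rw [rpow_two_mul p1 hγ₁', rpow_two_mul p2 hγ₂'] at key
  have hR₁ := Real.rpow_nonneg p1 γ₁
  have hR₂ := Real.rpow_nonneg p2 γ₂
  set R₁ := (b₁ - a₁) ^ γ₁
  set R₂ := (b₂ - a₂) ^ γ₂
  set K₁ := sewConst (2 * γ₁)
  set K₂ := sewConst (2 * γ₂)
  have hLR : 0 ≤ L * (R₁ * R₂) := by positivity
  refine (norm_le_norm_add_norm_sub' _ _).trans ((add_le_add hF key).trans ?_)
  -- Hölder constants of the path occur only in products `kᵢ * Rᵢ ≤ 1`, so they disappear from the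
  -- bound.
  calc _ = L * (R₁ * R₂) * (1 + K₁ * (k₁ * R₁) + K₂ * ((k₂ * R₂) +
        2 * K₁ * ((k₁ * R₁) * (k₂ * R₂)))) := by ring
    _ ≤ L * (R₁ * R₂) * (1 + K₁ * 1 + K₂ * (1 + 2 * K₁ * (1 * 1))) := by gcongr
    _ = _ := by ring

/-- Lipschitz dependence of the integral on the path. -/
lemma HolderBox.norm_planarSew_sub_le (hη : η ∈ Set.Ioo (0 : ℝ) 1)
    (hθ : HolderBox γ₁ γ₂ k₁ k₂ (k₁ * k₂) a₁ b₁ a₂ b₂ θ)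
    (hθ' : HolderBox γ₁ γ₂ k₁ k₂ (k₁ * k₂) a₁ b₁ a₂ b₂ θ')
    (hΔ : HolderBox γ₁ γ₂ (D * k₁) (D * k₂) (D * (k₁ * k₂)) a₁ b₁ a₂ b₂ (fun t => θ' t - θ t))
    (hD : ∀ t₁ t₂, a₁ ≤ t₁ → t₁ ≤ b₁ → a₂ ≤ t₂ → t₂ ≤ b₂ → ‖θ' (t₁, t₂) - θ (t₁, t₂)‖ ≤ D)
    (hD0 : 0 ≤ D) (hA : FieldBound η T γ₁ γ₂ L A) (hL : 0 ≤ L)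
    (hγ₁ : 1 / 2 < γ₁) (hγ₂ : 1 / 2 < γ₂) (hηγ₁ : 1 < (1 + η) * γ₁) (hηγ₂ : 1 < (1 + η) * γ₂)
    (hk₁ : 0 ≤ k₁) (hk₂ : 0 ≤ k₂) (hkb₁ : k₁ * (b₁ - a₁) ^ γ₁ ≤ 1)
    (hkb₂ : k₂ * (b₂ - a₂) ^ γ₂ ≤ 1) (hab₁ : a₁ ≤ b₁) (hab₂ : a₂ ≤ b₂)
    (ha₁ : 0 ≤ a₁) (hb₁ : b₁ ≤ T) (ha₂ : 0 ≤ a₂) (hb₂ : b₂ ≤ T) :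
    ‖planarSew T (germ A θ') a₁ b₁ a₂ b₂ - planarSew T (germ A θ) a₁ b₁ a₂ b₂‖ ≤
      (1 + 2 * sewConst ((1 + η) * γ₁) +
        sewConst ((1 + η) * γ₂) * (2 + 5 * sewConst ((1 + η) * γ₁))) *
        (L * D * ((b₁ - a₁) ^ γ₁ * (b₂ - a₂) ^ γ₂)) := by
  have p1 : 0 ≤ b₁ - a₁ := sub_nonneg.2 hab₁
  have p2 : 0 ≤ b₂ - a₂ := sub_nonneg.2 hab₂
  have hγ₁' : 0 ≤ γ₁ := by linarith
  have hγ₂' : 0 ≤ γ₂ := by linarith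
  have hg := hθ.planarDefectBound hA hL hγ₁' hγ₂' hk₁ hk₂ ha₁ hb₁ ha₂ hb₂
  have hg' := hθ'.planarDefectBound hA hL hγ₁' hγ₂' hk₁ hk₂ ha₁ hb₁ ha₂ hb₂
  -- Each germ separately has defects of order `2 * γᵢ`, enough to subtract the sewings. The weaker
  -- order `(1 + η) * γᵢ` is needed only to extract the factor `D`.
  rw [← hg'.planarSew_sub hg (by linarith) (by linarith) (by positivity) (by positivity)
    (by positivity) (by positivity) (by positivity) (by positivity) ha₁ hb₁ ha₂ hb₂ le_rfl hab₁
    le_rfl le_rfl hab₂ le_rfl]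
  have h := HolderBox.planarDefectBound_sub hη hθ hθ' hΔ hD hD0 hA hL hγ₁' hγ₂' hk₁ hk₂ hkb₁ hkb₂
    ha₁ hb₁ ha₂ hb₂
  have key := h.norm_planarSew_sub_le hηγ₁ hηγ₂ (by positivity) (by positivity)
    (by positivity) ha₁ hb₁ ha₂ hb₂ le_rfl hab₁ le_rfl le_rfl hab₂ le_rfl
  have hF := hA a₁ b₁ a₂ b₂ ha₁ hab₁ hb₁ ha₂ hab₂ hb₂
  have hΞ : ‖germ A θ' a₁ b₁ a₂ b₂ - germ A θ a₁ b₁ a₂ b₂‖ ≤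
      L * ((b₁ - a₁) ^ γ₁ * (b₂ - a₂) ^ γ₂) * D :=
    (hF.norm_sub_le _ _).trans
      (mul_le_mul_of_nonneg_left (hD _ _ le_rfl hab₁ le_rfl hab₂) hF.nonneg)
  have hK₁ := sewConst_nonneg hηγ₁
  have hK₂ := sewConst_nonneg hηγ₂
  rw [rpow_one_add_mul p1 hγ₁' hη.1.le, rpow_one_add_mul p2 hγ₂' hη.1.le] at key
  have hR₁ := Real.rpow_nonneg p1 γ₁
  have hR₂ := Real.rpow_nonneg p2 γ₂
  set R₁ := (b₁ - a₁) ^ γ₁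
  set R₂ := (b₂ - a₂) ^ γ₂
  set K₁ := sewConst ((1 + η) * γ₁)
  set K₂ := sewConst ((1 + η) * γ₂)
  have e₁ : k₁ ^ η * R₁ ^ η ≤ 1 := by
    rw [← Real.mul_rpow hk₁ hR₁]
    exact Real.rpow_le_one (by positivity) hkb₁ hη.1.le
  have e₂ : k₂ ^ η * R₂ ^ η ≤ 1 := by
    rw [← Real.mul_rpow hk₂ hR₂]
    exact Real.rpow_le_one (by positivity) hkb₂ hη.1.le
  have hLR : 0 ≤ L * D * (R₁ * R₂) := by positivity
  refine (norm_le_norm_add_norm_sub' _ _).trans ((add_le_add hΞ key).trans ?_)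
  calc _ = L * D * (R₁ * R₂) * (1 + 2 * K₁ * (k₁ ^ η * R₁ ^ η) + K₂ * (2 * (k₂ ^ η * R₂ ^ η) +
        5 * K₁ * ((k₁ ^ η * R₁ ^ η) * (k₂ ^ η * R₂ ^ η)))) := by ring
    _ ≤ L * D * (R₁ * R₂) * (1 + 2 * K₁ * 1 + K₂ * (2 * 1 + 5 * K₁ * (1 * 1))) := by gcongr
    _ = _ := by ring

end Germ

/-! ### Chaining bounds at scale `h` along an interval. -/

section Chain

variable {E : Type*} [NormedAddCommGroup E] {G : ℝ → ℝ → E} {T h : ℝ}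

lemma AdditiveOn.norm_le_nat_mul (hG : AdditiveOn G 0 T) {c : ℝ} (hh : 0 ≤ h)
    (hc : ∀ s t, 0 ≤ s → s ≤ t → t ≤ T → t - s ≤ h → ‖G s t‖ ≤ c) (N : ℕ) {s t : ℝ}
    (hs : 0 ≤ s) (hst : s ≤ t) (ht : t ≤ T) (hN : t - s ≤ N * h) : ‖G s t‖ ≤ N * c := by
  induction N generalizing t with
  | zero =>
    obtain rfl : s = t := le_antisymm hst (by simpa using hN)
    simp [hG.diag hs ht]
  | succ N ih =>
    push_cast at hN ⊢
    have hc0 : 0 ≤ c := (norm_nonneg _).trans (hc s s hs le_rfl (hst.trans ht) (by simpa using hh))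
    rcases le_total (t - s) h with hle | hge
    · have := hc s t hs hst ht hle
      nlinarith [mul_nonneg (Nat.cast_nonneg (α := ℝ) N) hc0]
    · rw [hG s (t - h) t hs (by linarith) (by linarith) ht]
      have h1 := ih (t := t - h) (by linarith) (by linarith) (by linarith)
      have h2 := hc (t - h) t (by linarith) (by linarith) ht (by linarith)
      exact (norm_add_le_of_le h1 h2).trans (le_of_eq (by ring))

/-- A Hölder bound on short intervals implies one on all intervals. -/
lemma AdditiveOn.holder_of_local (hG : AdditiveOn G 0 T) {K γ : ℝ} (hh : 0 ≤ h) (hK : 0 ≤ K)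
    (hγ : 0 ≤ γ) (hc : ∀ s t, 0 ≤ s → s ≤ t → t ≤ T → t - s ≤ h → ‖G s t‖ ≤ K * (t - s) ^ γ)
    {N : ℕ} (hN1 : 1 ≤ N) (hN : T ≤ N * h) {s t : ℝ} (hs : 0 ≤ s) (hst : s ≤ t) (ht : t ≤ T) :
    ‖G s t‖ ≤ N * K * (t - s) ^ γ := by
  have hN1' : (1 : ℝ) ≤ N := by exact_mod_cast hN1
  have p : 0 ≤ t - s := sub_nonneg.2 hst
  rcases le_total (t - s) h with hle | hge
  · refine (hc s t hs hst ht hle).trans ?_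
    rw [mul_assoc]
    exact le_mul_of_one_le_left (by positivity) hN1'
  · have := hG.norm_le_nat_mul (c := K * h ^ γ) hh (fun s' t' h1 h2 h3 h4 =>
      (hc s' t' h1 h2 h3 h4).trans (mul_le_mul_of_nonneg_left
        (Real.rpow_le_rpow (sub_nonneg.2 h2) h4 hγ) hK)) N hs hst ht (by linarith)
    refine this.trans ?_
    rw [← mul_assoc]
    gcongr

lemma two_rpow_sub_div {t : ℝ} (hh : 0 < h) : (2 : ℝ) ^ ((t - h) / h) = 2 ^ (t / h) / 2 := by
  rw [sub_div, div_self hh.ne', Real.rpow_sub two_pos, Real.rpow_one]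

/-- An exponentially weighted bound on short intervals implies one on all intervals. -/
lemma AdditiveOn.norm_le_weighted (hG : AdditiveOn G 0 T) {c : ℝ} (hh : 0 < h) (hc0 : 0 ≤ c)
    (hc : ∀ s t, 0 ≤ s → s ≤ t → t ≤ T → t - s ≤ h → ‖G s t‖ ≤ c * 2 ^ (t / h)) {s t : ℝ}
    (hs : 0 ≤ s) (hst : s ≤ t) (ht : t ≤ T) : ‖G s t‖ ≤ 2 * c * 2 ^ (t / h) := by
  obtain ⟨N, hN⟩ := exists_nat_ge ((t - s) / h)
  rw [div_le_iff₀ hh] at hN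
  induction N generalizing t with
  | zero =>
    obtain rfl : s = t := le_antisymm hst (by simpa using hN)
    rw [hG.diag hs ht, norm_zero]
    positivity
  | succ N ih =>
    push_cast at hN
    have hw : (0 : ℝ) < 2 ^ (t / h) := by positivity
    rcases le_total (t - s) h with hle | hge
    · have := hc s t hs hst ht hle
      nlinarith [mul_nonneg hc0 hw.le]
    · rw [hG s (t - h) t hs (by linarith) (by linarith) ht]
      have h1 := ih (t := t - h) (by linarith) (by linarith) (by linarith)
      have h2 := hc (t - h) t (by linarith) (by linarith) ht (by linarith)
      -- Stepping back by `h` halves the weight: the earlier part costs `2 * c / 2` and the last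
      -- piece `c`, so the constant `2 * c` persists for any number of steps.
      rw [two_rpow_sub_div hh] at h1
      exact (norm_add_le_of_le h1 h2).trans (le_of_eq (by ring))

end Chain

/-! ### Algebra of rectangular increments. -/

section RectInc

variable {E : Type*} [AddCommGroup E]

lemma rectInc_add_fst (f : ℝ × ℝ → E) (s₁ u₁ t₁ s₂ t₂ : ℝ) :
    rectInc f (s₁, s₂) (t₁, t₂) = rectInc f (s₁, s₂) (u₁, t₂) + rectInc f (u₁, s₂) (t₁, t₂) := by
  simp only [rectInc]; abel

lemma rectInc_add_snd (f : ℝ × ℝ → E) (s₁ t₁ s₂ u₂ t₂ : ℝ) :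
    rectInc f (s₁, s₂) (t₁, t₂) = rectInc f (s₁, s₂) (t₁, u₂) + rectInc f (s₁, u₂) (t₁, t₂) := by
  simp only [rectInc]; abel

lemma rectInc_sub (f g : ℝ × ℝ → E) (s t : ℝ × ℝ) :
    rectInc (fun x => f x - g x) s t = rectInc f s t - rectInc g s t := by
  simp only [rectInc]; abel

end RectInc

/-! ### Hölder classes at scale `h` and exponentially weighted bounds. -/

section LocalHolder

variable {E : Type*} [NormedAddCommGroup E]

lemma additiveOn_rectInc_fst (f : ℝ × ℝ → E) (s₂ t₂ a b : ℝ) :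
    AdditiveOn (fun x y => rectInc f (x, s₂) (y, t₂)) a b :=
  fun _ _ _ _ _ _ _ => rectInc_add_fst f _ _ _ _ _

lemma additiveOn_rectInc_snd (f : ℝ × ℝ → E) (s₁ t₁ a b : ℝ) :
    AdditiveOn (fun x y => rectInc f (s₁, x) (t₁, y)) a b :=
  fun _ _ _ _ _ _ _ => rectInc_add_snd f _ _ _ _ _

/-- On every subrectangle of `[0,T]²` of side at most `h`, the path has joint Hölder constants for
which its oscillation is at most one. -/
def LocalHolder (γ₁ γ₂ T h : ℝ) (θ : ℝ × ℝ → E) : Prop :=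
  ∀ a₁ b₁ a₂ b₂, 0 ≤ a₁ → a₁ ≤ b₁ → b₁ ≤ T → b₁ - a₁ ≤ h → 0 ≤ a₂ → a₂ ≤ b₂ → b₂ ≤ T →
    b₂ - a₂ ≤ h →
    HolderBox γ₁ γ₂ (h ^ γ₁)⁻¹ (h ^ γ₂)⁻¹ ((h ^ γ₁)⁻¹ * (h ^ γ₂)⁻¹) a₁ b₁ a₂ b₂ θ

lemma inv_rpow_mul_le_one {h r γ : ℝ} (hh : 0 < h) (hr : 0 ≤ r) (hrh : r ≤ h) (hγ : 0 ≤ γ) :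
    (h ^ γ)⁻¹ * r ^ γ ≤ 1 := by
  rw [inv_mul_le_one₀ (by positivity)]
  exact Real.rpow_le_rpow hr hrh hγ

variable {γ₁ γ₂ T h k₁ k₂ k₁₂ : ℝ} {θ θ' : ℝ × ℝ → E}

lemma HolderBox.mono_const {a₁ b₁ a₂ b₂ k₁' k₂' k₁₂' : ℝ}
    (hθ : HolderBox γ₁ γ₂ k₁ k₂ k₁₂ a₁ b₁ a₂ b₂ θ) (h1 : k₁ ≤ k₁') (h2 : k₂ ≤ k₂')
    (h12 : k₁₂ ≤ k₁₂') : HolderBox γ₁ γ₂ k₁' k₂' k₁₂' a₁ b₁ a₂ b₂ θ where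
  fst s t x g1 g2 g3 g4 g5 := (hθ.fst s t x g1 g2 g3 g4 g5).trans
    (mul_le_mul_of_nonneg_right h1 (Real.rpow_nonneg (sub_nonneg.2 g2) _))
  snd x s t g1 g2 g3 g4 g5 := (hθ.snd x s t g1 g2 g3 g4 g5).trans
    (mul_le_mul_of_nonneg_right h2 (Real.rpow_nonneg (sub_nonneg.2 g4) _))
  both s₁ t₁ s₂ t₂ g1 g2 g3 g4 g5 g6 := (hθ.both s₁ t₁ s₂ t₂ g1 g2 g3 g4 g5 g6).trans
    (mul_le_mul_of_nonneg_right h12 (mul_nonneg (Real.rpow_nonneg (sub_nonneg.2 g2) _)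
      (Real.rpow_nonneg (sub_nonneg.2 g5) _)))

/-- A jointly Hölder path is locally Hölder at every small scale. -/
lemma HolderBox.localHolder {K : ℝ} (hθ : HolderBox γ₁ γ₂ K K K 0 T 0 T θ) (hK : 1 ≤ K)
    (hh : 0 < h) (h1 : K * h ^ γ₁ ≤ 1) (h2 : K * h ^ γ₂ ≤ 1) : LocalHolder γ₁ γ₂ T h θ := by
  have l1 : K ≤ (h ^ γ₁)⁻¹ := by rwa [← one_div, le_div_iff₀ (by positivity)]
  have l2 : K ≤ (h ^ γ₂)⁻¹ := by rwa [← one_div, le_div_iff₀ (by positivity)]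
  intro a₁ b₁ a₂ b₂ ha₁ _ hb₁ _ ha₂ _ hb₂ _
  refine (hθ.mono ha₁ hb₁ ha₂ hb₂).mono_const l1 l2 ?_
  -- `1 ≤ K` lets the joint constant be dominated by a product of two constants.
  calc K = K * 1 := (mul_one K).symm
    _ ≤ K * K := by gcongr
    _ ≤ _ := by gcongr

/-- Chaining costs a factor `N` per direction. Rectangular increments are chained in both, so the
joint constant keeps the product form required by the germ estimates. -/
lemma LocalHolder.holderBox (hθ : LocalHolder γ₁ γ₂ T h θ) (hγ₁ : 0 ≤ γ₁) (hγ₂ : 0 ≤ γ₂)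
    (hh : 0 < h) {N : ℕ} (hN1 : 1 ≤ N) (hN : T ≤ N * h) :
    HolderBox γ₁ γ₂ (N * (h ^ γ₁)⁻¹) (N * (h ^ γ₂)⁻¹) ((N * (h ^ γ₁)⁻¹) * (N * (h ^ γ₂)⁻¹))
      0 T 0 T θ where
  fst s t x g1 g2 g3 g4 g5 := by
    refine AdditiveOn.holder_of_local (G := fun s t => θ (t, x) - θ (s, x)) (T := T) (h := h)
      (fun _ _ _ _ _ _ _ => (sub_add_sub_cancel' _ _ _).symm) hh.le (by positivity) hγ₁ ?_ hN1 hN g1 g2 g3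
    intro s t hs hst ht hle
    exact (hθ s t x x hs hst ht hle g4 le_rfl g5 (by simpa using hh.le)).fst s t x
      le_rfl hst le_rfl le_rfl le_rfl
  snd x s t g1 g2 g3 g4 g5 := by
    refine AdditiveOn.holder_of_local (G := fun s t => θ (x, t) - θ (x, s)) (T := T) (h := h)
      (fun _ _ _ _ _ _ _ => (sub_add_sub_cancel' _ _ _).symm) hh.le (by positivity) hγ₂ ?_ hN1 hN g3 g4 g5
    intro s t hs hst ht hle
    exact (hθ x x s t g1 le_rfl g2 (by simpa using hh.le) hs hst ht hle).snd x s t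
      le_rfl le_rfl le_rfl hst le_rfl
  both s₁ t₁ s₂ t₂ g1 g2 g3 g4 g5 g6 := by
    have p1 : 0 ≤ t₁ - s₁ := sub_nonneg.2 g2
    have p2 : 0 ≤ t₂ - s₂ := sub_nonneg.2 g5
    have key : ∀ x y, 0 ≤ x → x ≤ y → y ≤ T → y - x ≤ h → ‖rectInc θ (x, s₂) (y, t₂)‖ ≤
        N * ((h ^ γ₁)⁻¹ * (h ^ γ₂)⁻¹ * (y - x) ^ γ₁) * (t₂ - s₂) ^ γ₂ := by
      intro x y hx hxy hy hle
      have q : 0 ≤ y - x := sub_nonneg.2 hxy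
      refine (additiveOn_rectInc_snd θ x y 0 T).holder_of_local hh.le (by positivity) hγ₂ ?_ hN1
        hN g4 g5 g6
      intro s t hs hst ht hle'
      exact ((hθ x y s t hx hxy hy hle hs hst ht hle').both x y s t le_rfl hxy le_rfl le_rfl hst
        le_rfl).trans (le_of_eq (by ring))
    refine ((additiveOn_rectInc_fst θ s₂ t₂ 0 T).holder_of_local
      (K := N * ((h ^ γ₁)⁻¹ * (h ^ γ₂)⁻¹) * (t₂ - s₂) ^ γ₂) hh.le
      (by positivity) hγ₁ (fun x y hx hxy hy hle => (key x y hx hxy hy hle).trans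
        (le_of_eq (by ring))) hN1 hN g1 g2 g3).trans (le_of_eq (by ring))

/-- Exponentially weighted joint Hölder bound at scale `h` for a path vanishing on the axes. -/
structure WeightedBound (γ₁ γ₂ T h ρ : ℝ) (Δ : ℝ × ℝ → E) : Prop where
  zero_fst : ∀ x, 0 ≤ x → x ≤ T → Δ (0, x) = 0
  zero_snd : ∀ x, 0 ≤ x → x ≤ T → Δ (x, 0) = 0
  both : ∀ s₁ t₁ s₂ t₂, 0 ≤ s₁ → s₁ ≤ t₁ → t₁ ≤ T → t₁ - s₁ ≤ h → 0 ≤ s₂ → s₂ ≤ t₂ → t₂ ≤ T →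
    t₂ - s₂ ≤ h → ‖rectInc Δ (s₁, s₂) (t₁, t₂)‖ ≤
      ρ * (2 ^ (t₁ / h) * 2 ^ (t₂ / h)) *
        (((h ^ γ₁)⁻¹ * (t₁ - s₁) ^ γ₁) * ((h ^ γ₂)⁻¹ * (t₂ - s₂) ^ γ₂))

namespace WeightedBound

variable {ρ : ℝ} {Δ Δ' : ℝ × ℝ → E}

lemma congr (hΔ : WeightedBound γ₁ γ₂ T h ρ Δ) (heq : ∀ t ∈ square T, Δ t = Δ' t) :
    WeightedBound γ₁ γ₂ T h ρ Δ' where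
  zero_fst x h0 hx := by
    rw [← heq (0, x) ⟨⟨le_rfl, h0.trans hx⟩, h0, hx⟩]; exact hΔ.zero_fst x h0 hx
  zero_snd x h0 hx := by
    rw [← heq (x, 0) ⟨⟨h0, hx⟩, le_rfl, h0.trans hx⟩]; exact hΔ.zero_snd x h0 hx
  both s₁ t₁ s₂ t₂ g1 g2 g3 g4 g5 g6 g7 g8 := by
    have m : ∀ x y, 0 ≤ x → x ≤ T → 0 ≤ y → y ≤ T → (x, y) ∈ square T :=
      fun x y a b c d => ⟨⟨a, b⟩, c, d⟩
    have e : rectInc Δ' (s₁, s₂) (t₁, t₂) = rectInc Δ (s₁, s₂) (t₁, t₂) := by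
      simp only [rectInc]
      rw [heq _ (m t₁ t₂ (g1.trans g2) g3 (g5.trans g6) g7),
        heq _ (m t₁ s₂ (g1.trans g2) g3 g5 (g6.trans g7)),
        heq _ (m s₁ t₂ g1 (g2.trans g3) (g5.trans g6) g7),
        heq _ (m s₁ s₂ g1 (g2.trans g3) g5 (g6.trans g7))]
    rw [e]
    exact hΔ.both s₁ t₁ s₂ t₂ g1 g2 g3 g4 g5 g6 g7 g8

/-- As `Δ` vanishes on the axis, this increment is the rectangular one over `[s₁,t₁] × [0,x]`;
weighted chaining in the second direction costs a factor 2. -/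
lemma norm_fst_le (hΔ : WeightedBound γ₁ γ₂ T h ρ Δ) (hh : 0 < h) (hρ : 0 ≤ ρ) (hγ₂ : 0 ≤ γ₂)
    {s₁ t₁ x : ℝ} (hs : 0 ≤ s₁) (hst : s₁ ≤ t₁) (ht : t₁ ≤ T) (hle : t₁ - s₁ ≤ h) (hx : 0 ≤ x)
    (hxT : x ≤ T) :
    ‖Δ (t₁, x) - Δ (s₁, x)‖ ≤
      2 * ρ * (2 ^ (t₁ / h) * 2 ^ (x / h)) * ((h ^ γ₁)⁻¹ * (t₁ - s₁) ^ γ₁) := by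
  have p1 : 0 ≤ t₁ - s₁ := sub_nonneg.2 hst
  have := (additiveOn_rectInc_snd Δ s₁ t₁ 0 T).norm_le_weighted
    (c := ρ * 2 ^ (t₁ / h) * ((h ^ γ₁)⁻¹ * (t₁ - s₁) ^ γ₁)) hh (by positivity)
    (fun s t h1 h2 h3 h4 => by
      refine (hΔ.both s₁ t₁ s t hs hst ht hle h1 h2 h3 h4).trans ?_
      have le1 := inv_rpow_mul_le_one hh (sub_nonneg.2 h2) h4 hγ₂
      calc _ ≤ ρ * (2 ^ (t₁ / h) * 2 ^ (t / h)) * (((h ^ γ₁)⁻¹ * (t₁ - s₁) ^ γ₁) * 1) := by gcongr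
        _ = _ := by ring) (le_refl (0 : ℝ)) hx hxT
  simp only [rectInc, hΔ.zero_snd t₁ (hs.trans hst) ht, hΔ.zero_snd s₁ hs (hst.trans ht), sub_zero,
    add_zero] at this
  exact this.trans (le_of_eq (by ring))

lemma norm_snd_le (hΔ : WeightedBound γ₁ γ₂ T h ρ Δ) (hh : 0 < h) (hρ : 0 ≤ ρ) (hγ₁ : 0 ≤ γ₁)
    {s₂ t₂ x : ℝ} (hs : 0 ≤ s₂) (hst : s₂ ≤ t₂) (ht : t₂ ≤ T) (hle : t₂ - s₂ ≤ h) (hx : 0 ≤ x)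
    (hxT : x ≤ T) :
    ‖Δ (x, t₂) - Δ (x, s₂)‖ ≤
      2 * ρ * (2 ^ (x / h) * 2 ^ (t₂ / h)) * ((h ^ γ₂)⁻¹ * (t₂ - s₂) ^ γ₂) := by
  have p2 : 0 ≤ t₂ - s₂ := sub_nonneg.2 hst
  have := (additiveOn_rectInc_fst Δ s₂ t₂ 0 T).norm_le_weighted
    (c := ρ * 2 ^ (t₂ / h) * ((h ^ γ₂)⁻¹ * (t₂ - s₂) ^ γ₂)) hh (by positivity)
    (fun s t h1 h2 h3 h4 => by
      refine (hΔ.both s t s₂ t₂ h1 h2 h3 h4 hs hst ht hle).trans ?_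
      have le1 := inv_rpow_mul_le_one hh (sub_nonneg.2 h2) h4 hγ₁
      calc _ ≤ ρ * (2 ^ (t / h) * 2 ^ (t₂ / h)) * (1 * ((h ^ γ₂)⁻¹ * (t₂ - s₂) ^ γ₂)) := by gcongr
        _ = _ := by ring) (le_refl (0 : ℝ)) hx hxT
  simp only [rectInc, hΔ.zero_fst t₂ (hs.trans hst) ht, hΔ.zero_fst s₂ hs (hst.trans ht), sub_zero,
    add_zero] at this
  exact this.trans (le_of_eq (by ring))

/-- A second chaining back to the other axis: two factors 2 give the 4, independent of `N`. -/
lemma norm_le (hΔ : WeightedBound γ₁ γ₂ T h ρ Δ) (hh : 0 < h) (hρ : 0 ≤ ρ) (hγ₁ : 0 ≤ γ₁)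
    (hγ₂ : 0 ≤ γ₂) {t₁ t₂ : ℝ} (h1 : 0 ≤ t₁) (h1T : t₁ ≤ T) (h2 : 0 ≤ t₂) (h2T : t₂ ≤ T) :
    ‖Δ (t₁, t₂)‖ ≤ 4 * ρ * (2 ^ (t₁ / h) * 2 ^ (t₂ / h)) := by
  have := AdditiveOn.norm_le_weighted (G := fun s t => Δ (t, t₂) - Δ (s, t₂)) (T := T)
    (c := 2 * ρ * 2 ^ (t₂ / h)) (fun _ _ _ _ _ _ _ => (sub_add_sub_cancel' _ _ _).symm) hh (by positivity)
    (fun s t hs hst ht hle => by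
      refine (hΔ.norm_fst_le hh hρ hγ₂ hs hst ht hle h2 h2T).trans ?_
      have le1 := inv_rpow_mul_le_one hh (sub_nonneg.2 hst) hle hγ₁
      calc _ ≤ 2 * ρ * (2 ^ (t / h) * 2 ^ (t₂ / h)) * 1 := by gcongr
        _ = _ := by ring) (le_refl (0 : ℝ)) h1 h1T
  rw [hΔ.zero_fst t₂ h2 h2T, sub_zero] at this
  exact this.trans (le_of_eq (by ring))

/-- On a small rectangle a weighted bound is a joint Hölder bound. -/
lemma holderBox (hΔ : WeightedBound γ₁ γ₂ T h ρ Δ) (hh : 0 < h) (hρ : 0 ≤ ρ) (hγ₁ : 0 ≤ γ₁)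
    (hγ₂ : 0 ≤ γ₂) {a₁ b₁ a₂ b₂ : ℝ} (ha₁ : 0 ≤ a₁) (hb₁ : b₁ ≤ T) (hle₁ : b₁ - a₁ ≤ h)
    (ha₂ : 0 ≤ a₂) (hb₂ : b₂ ≤ T) (hle₂ : b₂ - a₂ ≤ h) :
    HolderBox γ₁ γ₂ (4 * ρ * (2 ^ (b₁ / h) * 2 ^ (b₂ / h)) * (h ^ γ₁)⁻¹)
      (4 * ρ * (2 ^ (b₁ / h) * 2 ^ (b₂ / h)) * (h ^ γ₂)⁻¹)
      (4 * ρ * (2 ^ (b₁ / h) * 2 ^ (b₂ / h)) * ((h ^ γ₁)⁻¹ * (h ^ γ₂)⁻¹)) a₁ b₁ a₂ b₂ Δ where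
  fst s t x g1 g2 g3 g4 g5 := by
    have p : 0 ≤ t - s := sub_nonneg.2 g2
    refine (hΔ.norm_fst_le hh hρ hγ₂ (ha₁.trans g1) g2 (g3.trans hb₁) (by linarith)
      (ha₂.trans g4) (g5.trans hb₂)).trans ?_
    rw [mul_assoc _ (h ^ γ₁)⁻¹]
    gcongr
    · norm_num
    · norm_num
    · norm_num
  snd x s t g1 g2 g3 g4 g5 := by
    have p : 0 ≤ t - s := sub_nonneg.2 g4
    refine (hΔ.norm_snd_le hh hρ hγ₁ (ha₂.trans g3) g4 (g5.trans hb₂) (by linarith)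
      (ha₁.trans g1) (g2.trans hb₁)).trans ?_
    rw [mul_assoc _ (h ^ γ₂)⁻¹]
    gcongr
    · norm_num
    · norm_num
    · norm_num
  both s₁ t₁ s₂ t₂ g1 g2 g3 g4 g5 g6 := by
    have p1 : 0 ≤ t₁ - s₁ := sub_nonneg.2 g2
    have p2 : 0 ≤ t₂ - s₂ := sub_nonneg.2 g5
    refine (hΔ.both s₁ t₁ s₂ t₂ (ha₁.trans g1) g2 (g3.trans hb₁) (by linarith)
      (ha₂.trans g4) g5 (g6.trans hb₂) (by linarith)).trans ?_
    calc _ ≤ 4 * ρ * (2 ^ (b₁ / h) * 2 ^ (b₂ / h)) *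
          (((h ^ γ₁)⁻¹ * (t₁ - s₁) ^ γ₁) * ((h ^ γ₂)⁻¹ * (t₂ - s₂) ^ γ₂)) := by
          gcongr
          · linarith
          · norm_num
          · norm_num
      _ = _ := by ring

end WeightedBound

/-- Two locally Hölder paths which agree on the axes differ by a weighted bound. -/
lemma LocalHolder.weightedBound_sub (hθ : LocalHolder γ₁ γ₂ T h θ)
    (hθ' : LocalHolder γ₁ γ₂ T h θ') (hh : 0 < h)
    (h₁ : ∀ x, 0 ≤ x → x ≤ T → θ' (0, x) = θ (0, x))
    (h₂ : ∀ x, 0 ≤ x → x ≤ T → θ' (x, 0) = θ (x, 0)) :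
    WeightedBound γ₁ γ₂ T h 2 (fun t => θ' t - θ t) where
  zero_fst x h0 hx := by rw [h₁ x h0 hx, sub_self]
  zero_snd x h0 hx := by rw [h₂ x h0 hx, sub_self]
  both s₁ t₁ s₂ t₂ g1 g2 g3 g4 g5 g6 g7 g8 := by
    have p1 : 0 ≤ t₁ - s₁ := sub_nonneg.2 g2
    have p2 : 0 ≤ t₂ - s₂ := sub_nonneg.2 g6
    have b := (hθ s₁ t₁ s₂ t₂ g1 g2 g3 g4 g5 g6 g7 g8).both s₁ t₁ s₂ t₂ le_rfl g2 le_rfl le_rfl g6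
      le_rfl
    have b' := (hθ' s₁ t₁ s₂ t₂ g1 g2 g3 g4 g5 g6 g7 g8).both s₁ t₁ s₂ t₂ le_rfl g2 le_rfl le_rfl
      g6 le_rfl
    have w1 : (1 : ℝ) ≤ 2 ^ (t₁ / h) :=
      Real.one_le_rpow one_le_two (div_nonneg (g1.trans g2) hh.le)
    have w2 : (1 : ℝ) ≤ 2 ^ (t₂ / h) :=
      Real.one_le_rpow one_le_two (div_nonneg (g5.trans g6) hh.le)
    rw [rectInc_sub]
    refine (norm_sub_le_of_le b' b).trans ?_
    calc _ = 2 * (1 * 1) * (((h ^ γ₁)⁻¹ * (t₁ - s₁) ^ γ₁) * ((h ^ γ₂)⁻¹ * (t₂ - s₂) ^ γ₂)) := by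
          ring
      _ ≤ _ := by gcongr

end LocalHolder

/-! ### The solution map: invariance, contraction, fixed point. -/

section SolutionMap

variable {E : Type*} [NormedAddCommGroup E]

/-- The map `θ ↦ ξ + ∫_0^· A(ds, θ_s)` whose fixed points are the solutions. -/
noncomputable def solMap (T : ℝ) (A : ℝ × ℝ → E → E) (ξ θ : ℝ × ℝ → E) (t : ℝ × ℝ) : E :=
  ξ t + planarSew T (germ A θ) 0 t.1 0 t.2

/-- Constant in the bound of the integral by the field. -/
noncomputable def sizeConst (γ₁ γ₂ : ℝ) : ℝ :=
  1 + sewConst (2 * γ₁) + sewConst (2 * γ₂) * (1 + 2 * sewConst (2 * γ₁))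

/-- Constant in the Lipschitz bound of the integral with respect to the path. -/
noncomputable def lipConst (η γ₁ γ₂ : ℝ) : ℝ :=
  1 + 2 * sewConst ((1 + η) * γ₁) +
    sewConst ((1 + η) * γ₂) * (2 + 5 * sewConst ((1 + η) * γ₁))

variable {γ₁ γ₂ T h : ℝ} {θ : ℝ × ℝ → E}

lemma localHolder_of_tendsto {u : ℕ → ℝ × ℝ → E} (hu : ∀ n, LocalHolder γ₁ γ₂ T h (u n))
    (hlim : ∀ t ∈ square T, Tendsto (fun n => u n t) atTop (𝓝 (θ t))) :
    LocalHolder γ₁ γ₂ T h θ := by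
  intro a₁ b₁ a₂ b₂ ha₁ hab₁ hb₁ hle₁ ha₂ hab₂ hb₂ hle₂
  have hb := fun n => hu n a₁ b₁ a₂ b₂ ha₁ hab₁ hb₁ hle₁ ha₂ hab₂ hb₂ hle₂
  have hm : ∀ {x y}, a₁ ≤ x → x ≤ b₁ → a₂ ≤ y → y ≤ b₂ →
      Tendsto (fun n => u n (x, y)) atTop (𝓝 (θ (x, y))) := fun l1 l2 l3 l4 =>
    hlim _ ⟨⟨ha₁.trans l1, l2.trans hb₁⟩, ha₂.trans l3, l4.trans hb₂⟩
  refine ⟨fun s t x g1 g2 g3 g4 g5 => ?_, fun x s t g1 g2 g3 g4 g5 => ?_,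
    fun s₁ t₁ s₂ t₂ g1 g2 g3 g4 g5 g6 => ?_⟩
  · exact le_of_tendsto' ((hm (g1.trans g2) g3 g4 g5).sub (hm g1 (g2.trans g3) g4 g5)).norm
      fun n => (hb n).fst s t x g1 g2 g3 g4 g5
  · exact le_of_tendsto' ((hm g1 g2 (g3.trans g4) g5).sub (hm g1 g2 g3 (g4.trans g5))).norm
      fun n => (hb n).snd x s t g1 g2 g3 g4 g5
  · exact le_of_tendsto' ((((hm (g1.trans g2) g3 (g4.trans g5) g6).sub
      (hm (g1.trans g2) g3 g4 (g5.trans g6))).sub (hm g1 (g2.trans g3) (g4.trans g5) g6)).add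
      (hm g1 (g2.trans g3) g4 (g5.trans g6))).norm
      fun n => (hb n).both s₁ t₁ s₂ t₂ g1 g2 g3 g4 g5 g6

/-- On the axes the sequence is constant; elsewhere the geometric series of steps is summed for each
rectangular increment. -/
lemma weightedBound_of_tendsto {u : ℕ → ℝ × ℝ → E} {C : ℝ}
    (hu : ∀ n, WeightedBound γ₁ γ₂ T h (C / 2 / 2 ^ n) (fun t => u (n + 1) t - u n t))
    (hlim : ∀ t ∈ square T, Tendsto (fun n => u n t) atTop (𝓝 (θ t))) (n : ℕ) :
    WeightedBound γ₁ γ₂ T h (C / 2 ^ n) (fun t => θ t - u n t) where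
  zero_fst x h0 hx := by
    have const : ∀ m, u m (0, x) = u 0 (0, x) := fun m => by
      induction m with
      | zero => rfl
      | succ m ih => rw [← ih]; exact sub_eq_zero.1 ((hu m).zero_fst x h0 hx)
    have := hlim (0, x) ⟨⟨le_rfl, h0.trans hx⟩, h0, hx⟩
    simp only [const] at this
    rw [const n, tendsto_nhds_unique this tendsto_const_nhds, sub_self]
  zero_snd x h0 hx := by
    have const : ∀ m, u m (x, 0) = u 0 (x, 0) := fun m => by
      induction m with
      | zero => rfl
      | succ m ih => rw [← ih]; exact sub_eq_zero.1 ((hu m).zero_snd x h0 hx)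
    have := hlim (x, 0) ⟨⟨h0, hx⟩, le_rfl, h0.trans hx⟩
    simp only [const] at this
    rw [const n, tendsto_nhds_unique this tendsto_const_nhds, sub_self]
  both s₁ t₁ s₂ t₂ g1 g2 g3 g4 g5 g6 g7 g8 := by
    have hm : ∀ {x y}, 0 ≤ x → x ≤ T → 0 ≤ y → y ≤ T →
        Tendsto (fun n => u n (x, y)) atTop (𝓝 (θ (x, y))) := fun l1 l2 l3 l4 =>
      hlim _ ⟨⟨l1, l2⟩, l3, l4⟩
    have lim : Tendsto (fun n => rectInc (u n) (s₁, s₂) (t₁, t₂)) atTop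
        (𝓝 (rectInc θ (s₁, s₂) (t₁, t₂))) :=
      (((hm (g1.trans g2) g3 (g5.trans g6) g7).sub (hm (g1.trans g2) g3 g5 (g6.trans g7))).sub
        (hm g1 (g2.trans g3) (g5.trans g6) g7)).add (hm g1 (g2.trans g3) g5 (g6.trans g7))
    set W : ℝ := (2 ^ (t₁ / h) * 2 ^ (t₂ / h)) *
        (((h ^ γ₁)⁻¹ * (t₁ - s₁) ^ γ₁) * ((h ^ γ₂)⁻¹ * (t₂ - s₂) ^ γ₂)) with hW
    have key := dist_le_of_le_geometric_two_of_tendsto (C := C * W) (fun m => by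
      rw [dist_comm, dist_eq_norm, ← rectInc_sub]
      exact ((hu m).both s₁ t₁ s₂ t₂ g1 g2 g3 g4 g5 g6 g7 g8).trans (le_of_eq (by rw [hW]; ring)))
      lim n
    rw [rectInc_sub, ← dist_eq_norm, dist_comm]
    exact key.trans (le_of_eq (by rw [hW]; ring))

variable [NormedSpace ℝ E]

/-- The data of the equation together with a scale `h = T / N` so small that the solution map
preserves the locally Hölder paths and contracts weighted bounds. -/
structure YoungSetting (η T γ₁ γ₂ L K h : ℝ) (N : ℕ) (A : ℝ × ℝ → E → E) (ξ : ℝ × ℝ → E) :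
    Prop where
  hη : η ∈ Set.Ioo (0 : ℝ) 1
  hγ₁ : 1 / 2 < γ₁
  hγ₂ : 1 / 2 < γ₂
  hηγ₁ : 1 < (1 + η) * γ₁
  hηγ₂ : 1 < (1 + η) * γ₂
  field : FieldBound η T γ₁ γ₂ L A
  hL : 0 ≤ L
  hh : 0 < h
  hN : 1 ≤ N
  hT : T = N * h
  holder_init : HolderBox γ₁ γ₂ K K K 0 T 0 T ξ
  rectInc_init : ∀ s₁ t₁ s₂ t₂, 0 ≤ s₁ → s₁ ≤ t₁ → t₁ ≤ T → 0 ≤ s₂ → s₂ ≤ t₂ → t₂ ≤ T →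
    rectInc ξ (s₁, s₂) (t₁, t₂) = 0
  init_small₁ : K * h ^ γ₁ ≤ 1 / 2
  init_small₂ : K * h ^ γ₂ ≤ 1 / 2
  field_small : (sizeConst γ₁ γ₂ + 4 * lipConst η γ₁ γ₂) * (N * (L * (h ^ γ₁ * h ^ γ₂))) ≤ 1 / 2

namespace YoungSetting

variable {η L K : ℝ} {N : ℕ} {A : ℝ × ℝ → E → E} {ξ θ' : ℝ × ℝ → E}

section Basic

variable (S : YoungSetting η T γ₁ γ₂ L K h N A ξ)

include S

lemma T_nonneg : 0 ≤ T := by rw [S.hT]; exact mul_nonneg (Nat.cast_nonneg N) S.hh.le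

lemma γ₁_nonneg : 0 ≤ γ₁ := by linarith [S.hγ₁]

lemma γ₂_nonneg : 0 ≤ γ₂ := by linarith [S.hγ₂]

lemma sizeConst_nonneg : 0 ≤ sizeConst γ₁ γ₂ := by
  have h1 := sewConst_nonneg (α := 2 * γ₁) (by linarith [S.hγ₁])
  have h2 := sewConst_nonneg (α := 2 * γ₂) (by linarith [S.hγ₂])
  unfold sizeConst
  positivity

lemma lipConst_nonneg : 0 ≤ lipConst η γ₁ γ₂ := by
  have h1 := sewConst_nonneg S.hηγ₁
  have h2 := sewConst_nonneg S.hηγ₂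
  unfold lipConst
  positivity

lemma one_le_N : (1 : ℝ) ≤ N := by exact_mod_cast S.hN

lemma base_nonneg : 0 ≤ L * (h ^ γ₁ * h ^ γ₂) := by
  have := S.hL
  have := S.hh
  positivity

lemma size_small : sizeConst γ₁ γ₂ * (N * (L * (h ^ γ₁ * h ^ γ₂))) ≤ 1 / 2 := by
  have h1 := mul_nonneg S.lipConst_nonneg (mul_nonneg (Nat.cast_nonneg (α := ℝ) N) S.base_nonneg)
  linarith [S.field_small]

/-- Multiplied by the 4 of `WeightedBound.norm_le`, this is the contraction factor `1 / 2`. -/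
lemma lip_small : lipConst η γ₁ γ₂ * (L * (h ^ γ₁ * h ^ γ₂)) ≤ 1 / 8 := by
  have h0 := mul_le_mul_of_nonneg_left (le_mul_of_one_le_left S.base_nonneg S.one_le_N)
    S.lipConst_nonneg
  have h1 := mul_nonneg S.sizeConst_nonneg
    (mul_nonneg (Nat.cast_nonneg (α := ℝ) N) S.base_nonneg)
  linarith [S.field_small]

lemma planarDefectBound (hθ : LocalHolder γ₁ γ₂ T h θ) :
    PlanarDefectBound (germ A θ) 0 T 0 T (L * (N * (h ^ γ₁)⁻¹)) (L * (N * (h ^ γ₂)⁻¹))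
      (2 * L * ((N * (h ^ γ₁)⁻¹) * (N * (h ^ γ₂)⁻¹))) γ₁ γ₂ (2 * γ₁) (2 * γ₂) := by
  have := S.hh
  exact (hθ.holderBox S.γ₁_nonneg S.γ₂_nonneg S.hh S.hN S.hT.le).planarDefectBound S.field S.hL
    S.γ₁_nonneg S.γ₂_nonneg (by positivity) (by positivity) le_rfl le_rfl le_rfl le_rfl

lemma localHolder_init : LocalHolder γ₁ γ₂ T h ξ := by
  have hh := S.hh
  have l1 : K ≤ (h ^ γ₁)⁻¹ := by
    rw [← one_div, le_div_iff₀ (by positivity)]; linarith [S.init_small₁]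
  have l2 : K ≤ (h ^ γ₂)⁻¹ := by
    rw [← one_div, le_div_iff₀ (by positivity)]; linarith [S.init_small₂]
  intro a₁ b₁ a₂ b₂ ha₁ hab₁ hb₁ _ ha₂ hab₂ hb₂ _
  have hξ := (S.holder_init.mono ha₁ hb₁ ha₂ hb₂).mono_const l1 l2 le_rfl
  refine ⟨hξ.fst, hξ.snd, fun s₁ t₁ s₂ t₂ g1 g2 g3 g4 g5 g6 => ?_⟩
  rw [S.rectInc_init s₁ t₁ s₂ t₂ (ha₁.trans g1) g2 (g3.trans hb₁) (ha₂.trans g4) g5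
    (g6.trans hb₂), norm_zero]
  have := sub_nonneg.2 g2
  have := sub_nonneg.2 g5
  positivity

variable [CompleteSpace E]

lemma additiveOn_fst (hθ : LocalHolder γ₁ γ₂ T h θ) {s₂ t₂ : ℝ} (hs : 0 ≤ s₂) (hst : s₂ ≤ t₂)
    (ht : t₂ ≤ T) : AdditiveOn (fun x y => planarSew T (germ A θ) x y s₂ t₂) 0 T := by
  have := S.hh
  have := S.hL
  exact (S.planarDefectBound hθ).additiveOn_fst (by linarith [S.hγ₁]) (by linarith [S.hγ₂])
    (by positivity) (by positivity) (by positivity) le_rfl le_rfl le_rfl le_rfl hs hst ht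

lemma additiveOn_snd (hθ : LocalHolder γ₁ γ₂ T h θ) {s₁ t₁ : ℝ} (hs : 0 ≤ s₁) (hst : s₁ ≤ t₁)
    (ht : t₁ ≤ T) : AdditiveOn (planarSew T (germ A θ) s₁ t₁) 0 T := by
  have := S.hh
  have := S.hL
  exact (S.planarDefectBound hθ).additiveOn_snd (by linarith [S.hγ₁]) (by linarith [S.hγ₂])
    (by positivity) (by positivity) (by positivity) le_rfl le_rfl le_rfl le_rfl hs hst ht

lemma solMap_zero_fst (hθ : LocalHolder γ₁ γ₂ T h θ) {x : ℝ} (h0 : 0 ≤ x) (hx : x ≤ T) :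
    solMap T A ξ θ (0, x) = ξ (0, x) := by
  have := (S.additiveOn_fst hθ le_rfl h0 hx).diag le_rfl S.T_nonneg
  simp only [solMap, this, add_zero]

lemma solMap_zero_snd (hθ : LocalHolder γ₁ γ₂ T h θ) {x : ℝ} (h0 : 0 ≤ x) (hx : x ≤ T) :
    solMap T A ξ θ (x, 0) = ξ (x, 0) := by
  have := (S.additiveOn_snd hθ le_rfl h0 hx).diag le_rfl S.T_nonneg
  simp only [solMap, this, add_zero]

lemma solMap_sub_fst (hθ : LocalHolder γ₁ γ₂ T h θ) {s t x : ℝ} (hs : 0 ≤ s) (hst : s ≤ t)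
    (ht : t ≤ T) (hx : 0 ≤ x) (hxT : x ≤ T) :
    solMap T A ξ θ (t, x) - solMap T A ξ θ (s, x) =
      (ξ (t, x) - ξ (s, x)) + planarSew T (germ A θ) s t 0 x := by
  have := S.additiveOn_fst hθ le_rfl hx hxT 0 s t le_rfl hs hst ht
  simp only at this
  simp only [solMap, this]
  abel

lemma solMap_sub_snd (hθ : LocalHolder γ₁ γ₂ T h θ) {s t x : ℝ} (hs : 0 ≤ s) (hst : s ≤ t)
    (ht : t ≤ T) (hx : 0 ≤ x) (hxT : x ≤ T) :
    solMap T A ξ θ (x, t) - solMap T A ξ θ (x, s) =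
      (ξ (x, t) - ξ (x, s)) + planarSew T (germ A θ) 0 x s t := by
  have := S.additiveOn_snd hθ le_rfl hx hxT 0 s t le_rfl hs hst ht
  simp only [solMap, this]
  abel

/-- The vanishing of `□ξ` leaves only the integral, and its additivity in both directions localises
it to the rectangle. -/
lemma rectInc_solMap (hθ : LocalHolder γ₁ γ₂ T h θ) {s₁ t₁ s₂ t₂ : ℝ} (hs₁ : 0 ≤ s₁)
    (hst₁ : s₁ ≤ t₁) (ht₁ : t₁ ≤ T) (hs₂ : 0 ≤ s₂) (hst₂ : s₂ ≤ t₂) (ht₂ : t₂ ≤ T) :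
    rectInc (solMap T A ξ θ) (s₁, s₂) (t₁, t₂) = planarSew T (germ A θ) s₁ t₁ s₂ t₂ := by
  have h0 := S.rectInc_init s₁ t₁ s₂ t₂ hs₁ hst₁ ht₁ hs₂ hst₂ ht₂
  have e1 := S.solMap_sub_fst hθ hs₁ hst₁ ht₁ (hs₂.trans hst₂) ht₂
  have e2 := S.solMap_sub_fst hθ hs₁ hst₁ ht₁ hs₂ (hst₂.trans ht₂)
  have e3 := S.additiveOn_snd hθ hs₁ hst₁ ht₁ 0 s₂ t₂ le_rfl hs₂ hst₂ ht₂
  simp only [rectInc] at h0 ⊢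
  calc _ = (solMap T A ξ θ (t₁, t₂) - solMap T A ξ θ (s₁, t₂)) -
        (solMap T A ξ θ (t₁, s₂) - solMap T A ξ θ (s₁, s₂)) := by abel
    _ = (ξ (t₁, t₂) - ξ (t₁, s₂) - ξ (s₁, t₂) + ξ (s₁, s₂)) +
        planarSew T (germ A θ) s₁ t₁ s₂ t₂ := by rw [e1, e2, e3]; abel
    _ = _ := by rw [h0, zero_add]

lemma norm_planarSew_le (hθ : LocalHolder γ₁ γ₂ T h θ) {s₁ t₁ s₂ t₂ : ℝ} (hs₁ : 0 ≤ s₁)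
    (hst₁ : s₁ ≤ t₁) (ht₁ : t₁ ≤ T) (hle₁ : t₁ - s₁ ≤ h) (hs₂ : 0 ≤ s₂) (hst₂ : s₂ ≤ t₂)
    (ht₂ : t₂ ≤ T) (hle₂ : t₂ - s₂ ≤ h) :
    ‖planarSew T (germ A θ) s₁ t₁ s₂ t₂‖ ≤
      sizeConst γ₁ γ₂ * (L * ((t₁ - s₁) ^ γ₁ * (t₂ - s₂) ^ γ₂)) := by
  have := S.hh
  exact (hθ s₁ t₁ s₂ t₂ hs₁ hst₁ ht₁ hle₁ hs₂ hst₂ ht₂ hle₂).norm_planarSew_le S.field S.hL S.hγ₁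
    S.hγ₂ (by positivity) (by positivity)
    (inv_rpow_mul_le_one S.hh (sub_nonneg.2 hst₁) hle₁ S.γ₁_nonneg)
    (inv_rpow_mul_le_one S.hh (sub_nonneg.2 hst₂) hle₂ S.γ₂_nonneg) hst₁ hst₂ hs₁ ht₁ hs₂ ht₂

/-- The solution map preserves the locally Hölder paths. -/
lemma localHolder_solMap (hθ : LocalHolder γ₁ γ₂ T h θ) :
    LocalHolder γ₁ γ₂ T h (solMap T A ξ θ) := by
  have hh := S.hh
  have hL := S.hL
  have hH₁ : 0 < h ^ γ₁ := by positivity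
  have hH₂ : 0 < h ^ γ₂ := by positivity
  have hc := S.sizeConst_nonneg
  have hsm := S.size_small
  intro a₁ b₁ a₂ b₂ ha₁ hab₁ hb₁ hle₁ ha₂ hab₂ hb₂ hle₂
  refine ⟨fun s t x g1 g2 g3 g4 g5 => ?_, fun x s t g1 g2 g3 g4 g5 => ?_,
    fun s₁ t₁ s₂ t₂ g1 g2 g3 g4 g5 g6 => ?_⟩
  · have hs := ha₁.trans g1
    have ht := g3.trans hb₁
    have hx := ha₂.trans g4
    have hxT := g5.trans hb₂
    have hR : 0 ≤ (t - s) ^ γ₁ := Real.rpow_nonneg (sub_nonneg.2 g2) _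
    -- The increment of the integral is taken over the strip `[s,t] × [0,x]`, cut into at most `N`
    -- boxes of height at most `h`; `size_small` absorbs the factor `N`.
    have hI := (S.additiveOn_snd hθ hs g2 ht).norm_le_nat_mul
      (c := sizeConst γ₁ γ₂ * (L * ((t - s) ^ γ₁ * h ^ γ₂))) hh.le (fun s' t' h1 h2 h3 h4 => by
        refine (S.norm_planarSew_le hθ hs g2 ht (by linarith) h1 h2 h3 h4).trans ?_
        have := Real.rpow_le_rpow (sub_nonneg.2 h2) h4 S.γ₂_nonneg
        gcongr) N le_rfl hx hxT (by rw [← S.hT, sub_zero]; exact hxT)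
    rw [S.solMap_sub_fst hθ hs g2 ht hx hxT]
    refine (norm_add_le_of_le (S.holder_init.fst s t x hs g2 ht hx hxT) hI).trans ?_
    rw [inv_mul_eq_div, le_div_iff₀ hH₁]
    calc _ = (K * h ^ γ₁ + sizeConst γ₁ γ₂ * (N * (L * (h ^ γ₁ * h ^ γ₂)))) * (t - s) ^ γ₁ := by
          ring
      _ ≤ 1 * (t - s) ^ γ₁ := by
          gcongr
          linarith [S.init_small₁]
      _ = _ := one_mul _
  · have hs := ha₂.trans g3
    have ht := g5.trans hb₂
    have hx := ha₁.trans g1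
    have hxT := g2.trans hb₁
    have hR : 0 ≤ (t - s) ^ γ₂ := Real.rpow_nonneg (sub_nonneg.2 g4) _
    have hI := (S.additiveOn_fst hθ hs g4 ht).norm_le_nat_mul
      (c := sizeConst γ₁ γ₂ * (L * (h ^ γ₁ * (t - s) ^ γ₂))) hh.le (fun s' t' h1 h2 h3 h4 => by
        refine (S.norm_planarSew_le hθ h1 h2 h3 h4 hs g4 ht (by linarith)).trans ?_
        have := Real.rpow_le_rpow (sub_nonneg.2 h2) h4 S.γ₁_nonneg
        gcongr) N le_rfl hx hxT (by rw [← S.hT, sub_zero]; exact hxT)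
    rw [S.solMap_sub_snd hθ hs g4 ht hx hxT]
    refine (norm_add_le_of_le (S.holder_init.snd x s t hx hxT hs g4 ht) hI).trans ?_
    rw [inv_mul_eq_div, le_div_iff₀ hH₂]
    calc _ = (K * h ^ γ₂ + sizeConst γ₁ γ₂ * (N * (L * (h ^ γ₁ * h ^ γ₂)))) * (t - s) ^ γ₂ := by
          ring
      _ ≤ 1 * (t - s) ^ γ₂ := by
          gcongr
          linarith [S.init_small₂]
      _ = _ := one_mul _
  · have hs₁ := ha₁.trans g1
    have ht₁ := g3.trans hb₁
    have hs₂ := ha₂.trans g4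
    have ht₂ := g6.trans hb₂
    have hR₁ : 0 ≤ (t₁ - s₁) ^ γ₁ := Real.rpow_nonneg (sub_nonneg.2 g2) _
    have hR₂ : 0 ≤ (t₂ - s₂) ^ γ₂ := Real.rpow_nonneg (sub_nonneg.2 g5) _
    rw [S.rectInc_solMap hθ hs₁ g2 ht₁ hs₂ g5 ht₂]
    refine (S.norm_planarSew_le hθ hs₁ g2 ht₁ (by linarith) hs₂ g5 ht₂ (by linarith)).trans ?_
    have h1 : sizeConst γ₁ γ₂ * (L * (h ^ γ₁ * h ^ γ₂)) ≤ 1 := by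
      have := mul_le_mul_of_nonneg_left (le_mul_of_one_le_left S.base_nonneg S.one_le_N) hc
      linarith
    rw [← mul_assoc]
    refine mul_le_mul_of_nonneg_right ?_ (mul_nonneg hR₁ hR₂)
    rw [← mul_inv, ← one_div, le_div_iff₀ (by positivity)]
    linarith

/-- The solution map contracts weighted bounds. -/
lemma weightedBound_solMap_sub {ρ : ℝ} (hρ : 0 ≤ ρ) (hθ : LocalHolder γ₁ γ₂ T h θ)
    (hθ' : LocalHolder γ₁ γ₂ T h θ') (hΔ : WeightedBound γ₁ γ₂ T h ρ (fun t => θ' t - θ t)) :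
    WeightedBound γ₁ γ₂ T h (ρ / 2) (fun t => solMap T A ξ θ' t - solMap T A ξ θ t) where
  zero_fst x h0 hx := by rw [S.solMap_zero_fst hθ h0 hx, S.solMap_zero_fst hθ' h0 hx, sub_self]
  zero_snd x h0 hx := by rw [S.solMap_zero_snd hθ h0 hx, S.solMap_zero_snd hθ' h0 hx, sub_self]
  both s₁ t₁ s₂ t₂ g1 g2 g3 g4 g5 g6 g7 g8 := by
    have hh := S.hh
    have hH₁ : 0 < h ^ γ₁ := by positivity
    have hH₂ : 0 < h ^ γ₂ := by positivity
    have hR₁ : 0 ≤ (t₁ - s₁) ^ γ₁ := Real.rpow_nonneg (sub_nonneg.2 g2) _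
    have hR₂ : 0 ≤ (t₂ - s₂) ^ γ₂ := Real.rpow_nonneg (sub_nonneg.2 g6) _
    have hW : (0 : ℝ) ≤ 2 ^ (t₁ / h) * 2 ^ (t₂ / h) := by positivity
    rw [rectInc_sub, S.rectInc_solMap hθ g1 g2 g3 g5 g6 g7, S.rectInc_solMap hθ' g1 g2 g3 g5 g6 g7]
    -- Here `D` is `4 * ρ` times the weight at the upper right corner, where the weight is largest
    -- on the box.
    have key := HolderBox.norm_planarSew_sub_le S.hη (hθ s₁ t₁ s₂ t₂ g1 g2 g3 g4 g5 g6 g7 g8)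
      (hθ' s₁ t₁ s₂ t₂ g1 g2 g3 g4 g5 g6 g7 g8)
      (hΔ.holderBox hh hρ S.γ₁_nonneg S.γ₂_nonneg g1 g3 g4 g5 g7 g8)
      (fun x₁ x₂ l1 l2 l3 l4 => by
        refine (hΔ.norm_le hh hρ S.γ₁_nonneg S.γ₂_nonneg (g1.trans l1) (l2.trans g3) (g5.trans l3)
          (l4.trans g7)).trans ?_
        gcongr
        · norm_num
        · norm_num)
      (by positivity) S.field S.hL S.hγ₁ S.hγ₂ S.hηγ₁ S.hηγ₂ (by positivity) (by positivity)
      (inv_rpow_mul_le_one hh (sub_nonneg.2 g2) g4 S.γ₁_nonneg)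
      (inv_rpow_mul_le_one hh (sub_nonneg.2 g6) g8 S.γ₂_nonneg) g2 g6 g1 g3 g5 g7
    refine key.trans ?_
    change lipConst η γ₁ γ₂ * _ ≤ _
    have h1 := S.lip_small
    set H₁ := h ^ γ₁
    set H₂ := h ^ γ₂
    set W : ℝ := 2 ^ (t₁ / h) * 2 ^ (t₂ / h)
    set R₁ := (t₁ - s₁) ^ γ₁
    set R₂ := (t₂ - s₂) ^ γ₂
    have h2 : 0 ≤ 4 * ρ * W * ((H₁⁻¹ * R₁) * (H₂⁻¹ * R₂)) := by positivity
    calc _ = (lipConst η γ₁ γ₂ * (L * (H₁ * H₂))) * (4 * ρ * W * ((H₁⁻¹ * R₁) * (H₂⁻¹ * R₂))) := by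
          field_simp
      _ ≤ 1 / 8 * (4 * ρ * W * ((H₁⁻¹ * R₁) * (H₂⁻¹ * R₂))) := by gcongr
      _ = _ := by ring

/-- Fixed points of the solution map are unique among the locally Hölder paths. -/
lemma eq_of_fixed (hθ : LocalHolder γ₁ γ₂ T h θ) (hθ' : LocalHolder γ₁ γ₂ T h θ')
    (hfix : ∀ t ∈ square T, θ t = solMap T A ξ θ t)
    (hfix' : ∀ t ∈ square T, θ' t = solMap T A ξ θ' t) : ∀ t ∈ square T, θ' t = θ t := by
  have hT := S.T_nonneg
  -- The solution map fixes both paths on the square while halving the bound on their difference.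
  -- Initially the bound is 2, since both paths equal `ξ` on the axes.
  have bound : ∀ n : ℕ, WeightedBound γ₁ γ₂ T h (2 / 2 ^ n) (fun t => θ' t - θ t) := by
    intro n
    induction n with
    | zero =>
      rw [pow_zero, div_one]
      refine hθ.weightedBound_sub hθ' S.hh (fun x h0 hx => ?_) (fun x h0 hx => ?_)
      · have hm : (0, x) ∈ square T := ⟨⟨le_rfl, hT⟩, h0, hx⟩
        rw [hfix _ hm, hfix' _ hm, S.solMap_zero_fst hθ h0 hx, S.solMap_zero_fst hθ' h0 hx]
      · have hm : (x, 0) ∈ square T := ⟨⟨h0, hx⟩, le_rfl, hT⟩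
        rw [hfix _ hm, hfix' _ hm, S.solMap_zero_snd hθ h0 hx, S.solMap_zero_snd hθ' h0 hx]
    | succ n ih =>
      rw [pow_succ, ← div_div]
      exact (S.weightedBound_solMap_sub (by positivity) hθ hθ' ih).congr
        fun t ht => by rw [← hfix t ht, ← hfix' t ht]
  rintro ⟨t₁, t₂⟩ ⟨⟨h1, h1T⟩, h2, h2T⟩
  rw [← sub_eq_zero, ← norm_le_zero_iff]
  have lim : Tendsto (fun n : ℕ => 4 * (2 / 2 ^ n) * ((2 : ℝ) ^ (t₁ / h) * 2 ^ (t₂ / h))) atTop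
      (𝓝 0) := by
    have : Tendsto (fun n : ℕ => (2 : ℝ) / 2 ^ n) atTop (𝓝 0) :=
      tendsto_const_nhds.div_atTop (tendsto_pow_atTop_atTop_of_one_lt one_lt_two)
    simpa using (this.const_mul 4).mul_const ((2 : ℝ) ^ (t₁ / h) * 2 ^ (t₂ / h))
  exact ge_of_tendsto' lim fun n =>
    (bound n).norm_le S.hh (by positivity) S.γ₁_nonneg S.γ₂_nonneg h1 h1T h2 h2T

lemma localHolder_iterate (n : ℕ) : LocalHolder γ₁ γ₂ T h ((solMap T A ξ)^[n] ξ) := by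
  induction n with
  | zero => exact S.localHolder_init
  | succ n ih =>
    rw [Function.iterate_succ_apply']
    exact S.localHolder_solMap ih

lemma weightedBound_iterate (n : ℕ) : WeightedBound γ₁ γ₂ T h (2 / 2 ^ n)
    (fun t => (solMap T A ξ)^[n + 1] ξ t - (solMap T A ξ)^[n] ξ t) := by
  induction n with
  | zero =>
    rw [pow_zero, div_one]
    exact S.localHolder_init.weightedBound_sub (S.localHolder_solMap S.localHolder_init) S.hh
      (fun x h0 hx => S.solMap_zero_fst S.localHolder_init h0 hx)
      (fun x h0 hx => S.solMap_zero_snd S.localHolder_init h0 hx)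
  | succ n ih =>
    rw [pow_succ, ← div_div, Function.iterate_succ_apply' _ (n + 1),
      Function.iterate_succ_apply' _ n]
    have := S.weightedBound_solMap_sub (by positivity) (S.localHolder_iterate n)
      (S.localHolder_iterate (n + 1)) ih
    rwa [Function.iterate_succ_apply' _ n] at this

end Basic

/-- Existence of a locally Hölder fixed point of the solution map. -/
lemma exists_fixed [CompleteSpace E] (S : YoungSetting η T γ₁ γ₂ L K h N A ξ) :
    ∃ θ, LocalHolder γ₁ γ₂ T h θ ∧ ∀ t ∈ square T, θ t = solMap T A ξ θ t := by
  set u : ℕ → ℝ × ℝ → E := fun n => (solMap T A ξ)^[n] ξ with hu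
  have step : ∀ n, solMap T A ξ (u n) = u (n + 1) := fun n =>
    (Function.iterate_succ_apply' _ n ξ).symm
  have conv : ∀ t ∈ square T, Tendsto (fun n => u n t) atTop
      (𝓝 (limUnder atTop fun n => u n t)) := by
    rintro ⟨t₁, t₂⟩ ⟨⟨h1, h1T⟩, h2, h2T⟩
    -- The criterion requires steps at most `C / 2 / 2 ^ n`; the steps are bounded by `4 * (2 / 2 ^
    -- n)` times the weight, whence 16.
    refine (cauchySeq_of_le_geometric_two (C := 16 * (2 ^ (t₁ / h) * 2 ^ (t₂ / h)))
      fun n => ?_).tendsto_limUnder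
    rw [dist_comm, dist_eq_norm]
    exact ((S.weightedBound_iterate n).norm_le S.hh (by positivity) S.γ₁_nonneg S.γ₂_nonneg
      h1 h1T h2 h2T).trans (le_of_eq (by ring))
  set θ : ℝ × ℝ → E := fun t => limUnder atTop fun n => u n t
  have hθ : LocalHolder γ₁ γ₂ T h θ := localHolder_of_tendsto S.localHolder_iterate conv
  refine ⟨θ, hθ, ?_⟩
  have close := weightedBound_of_tendsto (C := 4) (u := u) (θ := θ) (fun n => by
    have := S.weightedBound_iterate n
    norm_num at this ⊢
    exact this) conv
  rintro ⟨t₁, t₂⟩ ht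
  have lim0 : Tendsto (fun n : ℕ => 4 * (4 / 2 ^ n / 2) * ((2 : ℝ) ^ (t₁ / h) * 2 ^ (t₂ / h))) atTop
      (𝓝 0) := by
    have : Tendsto (fun n : ℕ => (4 : ℝ) / 2 ^ n) atTop (𝓝 0) :=
      tendsto_const_nhds.div_atTop (tendsto_pow_atTop_atTop_of_one_lt one_lt_two)
    simpa using ((this.div_const 2).const_mul 4).mul_const ((2 : ℝ) ^ (t₁ / h) * 2 ^ (t₂ / h))
  -- Contraction also gives continuity of the solution map along the iterates, which identifies the
  -- limit as a fixed point.
  have lim1 : Tendsto (fun n => solMap T A ξ θ (t₁, t₂) - u (n + 1) (t₁, t₂)) atTop (𝓝 0) := by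
    refine squeeze_zero_norm (fun n => ?_) lim0
    have := S.weightedBound_solMap_sub (by positivity) (S.localHolder_iterate n) hθ (close n)
    rw [← step n]
    exact this.norm_le S.hh (by positivity) S.γ₁_nonneg S.γ₂_nonneg ht.1.1 ht.1.2 ht.2.1 ht.2.2
  have lim2 := (conv (t₁, t₂) ht).comp (tendsto_add_atTop_nat 1)
  have lim3 := lim1.add lim2
  simp only [Function.comp_def, sub_add_cancel, zero_add] at lim3
  exact (tendsto_nhds_unique lim3 tendsto_const_nhds)

end YoungSetting

end SolutionMap

/-! ### Identification of the planar sewing with the Young integral. -/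

section Integral

variable {E : Type*} [NormedAddCommGroup E]

/-- Needed for the limit to determine the integral. For `b = 0`, strict monotonicity admits only
partitions with `n = 0`. -/
lemma IntervalPartition.exists_meshLT {b δ : ℝ} (hb : 0 ≤ b) (hδ : 0 < δ) :
    ∃ P : IntervalPartition 0 b, P.MeshLT δ := by
  rcases hb.eq_or_lt with rfl | hb
  · exact ⟨⟨0, fun _ => 0, rfl, rfl, fun i hi => absurd hi (Nat.not_lt_zero i)⟩,
      fun i hi => absurd hi (Nat.not_lt_zero i)⟩
  · obtain ⟨n, hn⟩ := exists_nat_gt (b / δ)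
    have hn0 : (0 : ℝ) < n := (div_pos hb hδ).trans hn
    have hstep : ∀ i : ℕ, ((i + 1 : ℕ) : ℝ) * (b / n) - i * (b / n) = b / n := fun i => by
      push_cast; ring
    refine ⟨⟨n, fun i => i * (b / n), by simp, by field_simp, fun i _ => ?_⟩, fun i _ => ?_⟩
    · have := hstep i
      have := div_pos hb hn0
      linarith
    · change ((i + 1 : ℕ) : ℝ) * (b / n) - i * (b / n) < δ
      rw [hstep, div_lt_iff₀ hn0, mul_comm]
      rwa [div_lt_iff₀ hδ] at hn

lemma IsYoungIntegral.unique {A : ℝ × ℝ → E → E} {y : ℝ × ℝ → E} {t : ℝ × ℝ} {I I' : E}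
    (h : IsYoungIntegral A y t I) (h' : IsYoungIntegral A y t I') (h1 : 0 ≤ t.1) (h2 : 0 ≤ t.2) :
    I = I' := by
  refine eq_of_forall_dist_le fun ε hε => ?_
  obtain ⟨δ, hδ, H⟩ := h (ε / 2) (half_pos hε)
  obtain ⟨δ', hδ', H'⟩ := h' (ε / 2) (half_pos hε)
  obtain ⟨P, hP⟩ := IntervalPartition.exists_meshLT h1 (lt_min hδ hδ')
  obtain ⟨Q, hQ⟩ := IntervalPartition.exists_meshLT h2 (lt_min hδ hδ')
  have b := H P Q (fun i hi => (hP i hi).trans_le (min_le_left _ _))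
    (fun i hi => (hQ i hi).trans_le (min_le_left _ _))
  have b' := H' P Q (fun i hi => (hP i hi).trans_le (min_le_right _ _))
    (fun i hi => (hQ i hi).trans_le (min_le_right _ _))
  rw [dist_eq_norm]
  rw [norm_sub_rev] at b
  have := norm_sub_le_norm_sub_add_norm_sub I (riemannSum A y P Q) I'
  linarith

/-- The planar sewing of the germ is the nonlinear Young integral. -/
lemma PlanarDefectBound.isYoungIntegral [CompleteSpace E] {A : ℝ × ℝ → E → E} {θ : ℝ × ℝ → E}
    {T C₁ C₂ C₁₂ γ₁ γ₂ α₁ α₂ : ℝ}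
    (h : PlanarDefectBound (germ A θ) 0 T 0 T C₁ C₂ C₁₂ γ₁ γ₂ α₁ α₂)
    (hα₁ : 1 < α₁) (hα₂ : 1 < α₂) (hC₁ : 0 ≤ C₁) (hC₂ : 0 ≤ C₂) (hC₁₂ : 0 ≤ C₁₂)
    {t : ℝ × ℝ} (ht : t ∈ square T) :
    IsYoungIntegral A θ t (planarSew T (germ A θ) 0 t.1 0 t.2) := by
  obtain ⟨⟨h1, h1T⟩, h2, h2T⟩ := ht
  obtain ⟨M, M', H⟩ := h.exists_norm_sum_sub_planarSew_le hα₁ hα₂ hC₁ hC₂ hC₁₂ le_rfl le_rfl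
    le_rfl le_rfl le_rfl h1 h1T le_rfl h2 h2T
  intro ε hε
  have pow_lim : ∀ α : ℝ, 1 < α → Tendsto (fun δ : ℝ => δ ^ (α - 1)) (𝓝[>] 0) (𝓝 0) := by
    intro α hα
    have := (Real.continuousAt_rpow_const 0 (α - 1) (Or.inr (by linarith))).tendsto
    rw [Real.zero_rpow (by linarith)] at this
    exact this.mono_left nhdsWithin_le_nhds
  have lim : Tendsto (fun δ : ℝ => M * δ ^ (α₁ - 1) + M' * δ ^ (α₂ - 1)) (𝓝[>] 0) (𝓝 0) := by
    simpa using ((pow_lim α₁ hα₁).const_mul M).add ((pow_lim α₂ hα₂).const_mul M')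
  obtain ⟨δ, hδε, hδ⟩ := ((lim.eventually (gt_mem_nhds hε)).and self_mem_nhdsWithin).exists
  refine ⟨δ, hδ, fun P Q hP hQ => lt_of_le_of_lt ?_ hδε⟩
  exact H P.pt Q.pt P.n Q.n δ P.pt_zero P.pt_last Q.pt_zero Q.pt_last
    (fun i hi => (P.pt_lt i hi).le) (fun i hi => (hP i hi).le)
    (fun i hi => (Q.pt_lt i hi).le) (fun i hi => (hQ i hi).le)

end Integral

/-! ### From the function spaces to box bounds, and the choice of scale. -/

section Conversion

variable {E : Type*} [NormedAddCommGroup E]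

lemma rectInc_swap_fst (f : ℝ × ℝ → E) (s₁ t₁ s₂ t₂ : ℝ) :
    rectInc f (s₁, s₂) (t₁, t₂) = -rectInc f (t₁, s₂) (s₁, t₂) := by
  simp only [rectInc]; abel

lemma rectInc_swap_snd (f : ℝ × ℝ → E) (s₁ t₁ s₂ t₂ : ℝ) :
    rectInc f (s₁, s₂) (t₁, t₂) = -rectInc f (s₁, t₂) (t₁, s₂) := by
  simp only [rectInc]; abel

lemma HolderBox.memHolderTime {T k₁ k₂ k₁₂ : ℝ} {γ : ℝ × ℝ} {θ : ℝ × ℝ → E}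
    (h : HolderBox γ.1 γ.2 k₁ k₂ k₁₂ 0 T 0 T θ) (hk₁ : 0 ≤ k₁) : MemHolderTime T γ θ := by
  set K := max k₁ (max k₂ k₁₂)
  have hK := h.mono_const (le_max_left k₁ (max k₂ k₁₂))
    ((le_max_left k₂ k₁₂).trans (le_max_right k₁ _))
    ((le_max_right k₂ k₁₂).trans (le_max_right k₁ _))
  refine ⟨fun t _ => ⟨_, le_rfl⟩, K, hk₁.trans (le_max_left _ _), ?_⟩
  rintro ⟨s₁, s₂⟩ ⟨⟨a1, a2⟩, a3, a4⟩ ⟨t₁, t₂⟩ ⟨⟨b1, b2⟩, b3, b4⟩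
  simp only at a1 a2 a3 a4 b1 b2 b3 b4 ⊢
  refine ⟨?_, ?_, ?_⟩
  · rcases le_total s₁ t₁ with hst | hst
    · rw [abs_of_nonneg (sub_nonneg.2 hst)]
      exact hK.fst s₁ t₁ s₂ a1 hst b2 a3 a4
    · rw [norm_sub_rev, abs_sub_comm, abs_of_nonneg (sub_nonneg.2 hst)]
      exact hK.fst t₁ s₁ s₂ b1 hst a2 a3 a4
  · rcases le_total s₂ t₂ with hst | hst
    · rw [abs_of_nonneg (sub_nonneg.2 hst)]
      exact hK.snd s₁ s₂ t₂ a1 a2 a3 hst b4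
    · rw [norm_sub_rev, abs_sub_comm, abs_of_nonneg (sub_nonneg.2 hst)]
      exact hK.snd s₁ t₂ s₂ a1 a2 b3 hst a4
  · rcases le_total s₁ t₁ with h1 | h1 <;> rcases le_total s₂ t₂ with h2 | h2
    · rw [abs_of_nonneg (sub_nonneg.2 h1), abs_of_nonneg (sub_nonneg.2 h2)]
      exact hK.both s₁ t₁ s₂ t₂ a1 h1 b2 a3 h2 b4
    · rw [abs_of_nonneg (sub_nonneg.2 h1), abs_sub_comm t₂, abs_of_nonneg (sub_nonneg.2 h2),
        rectInc_swap_snd, norm_neg]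
      exact hK.both s₁ t₁ t₂ s₂ a1 h1 b2 b3 h2 a4
    · rw [abs_sub_comm t₁, abs_of_nonneg (sub_nonneg.2 h1), abs_of_nonneg (sub_nonneg.2 h2),
        rectInc_swap_fst, norm_neg]
      exact hK.both t₁ s₁ s₂ t₂ b1 h1 a2 a3 h2 b4
    · rw [abs_sub_comm t₁, abs_sub_comm t₂, abs_of_nonneg (sub_nonneg.2 h1),
        abs_of_nonneg (sub_nonneg.2 h2), rectInc_swap_fst, rectInc_swap_snd, neg_neg]
      exact hK.both t₁ s₁ t₂ s₂ b1 h1 a2 b3 h2 a4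

/-- Every larger constant is admitted so that several paths can share one. -/
lemma MemHolderTime.exists_holderBox {T : ℝ} {γ : ℝ × ℝ} {θ : ℝ × ℝ → E}
    (h : MemHolderTime T γ θ) :
    ∃ K, 1 ≤ K ∧ ∀ K', K ≤ K' → HolderBox γ.1 γ.2 K' K' K' 0 T 0 T θ := by
  obtain ⟨-, K, -, H⟩ := h
  refine ⟨max 1 K, le_max_left _ _, fun K' hK' => ?_⟩
  have hle : K ≤ K' := (le_max_right _ _).trans hK'
  refine HolderBox.mono_const (k₁ := K) (k₂ := K) (k₁₂ := K)
    ⟨fun s t x g1 g2 g3 g4 g5 => ?_, fun x s t g1 g2 g3 g4 g5 => ?_,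
      fun s₁ t₁ s₂ t₂ g1 g2 g3 g4 g5 g6 => ?_⟩ hle hle hle
  · have := (H (s, x) ⟨⟨g1, g2.trans g3⟩, g4, g5⟩ (t, x) ⟨⟨g1.trans g2, g3⟩, g4, g5⟩).1
    rwa [abs_of_nonneg (sub_nonneg.2 g2)] at this
  · have := (H (x, s) ⟨⟨g1, g2⟩, g3, g4.trans g5⟩ (x, t) ⟨⟨g1, g2⟩, g3.trans g4, g5⟩).2.1
    rwa [abs_of_nonneg (sub_nonneg.2 g4)] at this
  · have := (H (s₁, s₂) ⟨⟨g1, g2.trans g3⟩, g4, g5.trans g6⟩ (t₁, t₂)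
      ⟨⟨g1.trans g2, g3⟩, g4.trans g5, g6⟩).2.2
    rwa [abs_of_nonneg (sub_nonneg.2 g2), abs_of_nonneg (sub_nonneg.2 g5)] at this

lemma MemHolderTimeSpace.exists_fieldBound [NormedSpace ℝ E] {T η : ℝ} {γ : ℝ × ℝ}
    {A : ℝ × ℝ → E → E} (h : MemHolderTimeSpace T γ η A) :
    ∃ L, 0 ≤ L ∧ FieldBound η T γ.1 γ.2 L A := by
  obtain ⟨-, L, hL, H⟩ := h
  refine ⟨L, hL, fun s₁ t₁ s₂ t₂ g1 g2 g3 g4 g5 g6 => ?_⟩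
  have := (H (s₁, s₂) ⟨⟨g1, g2.trans g3⟩, g4, g5.trans g6⟩ (t₁, t₂)
    ⟨⟨g1.trans g2, g3⟩, g4.trans g5, g6⟩).2.2
  rwa [abs_of_nonneg (sub_nonneg.2 g2), abs_of_nonneg (sub_nonneg.2 g5)] at this

/-- A scale `T / N` at which the given quantities are small. -/
lemma exists_small_scale {T γ₁ γ₂ : ℝ} (hT : 0 < T) (hγ₁ : 1 / 2 < γ₁) (hγ₂ : 1 / 2 < γ₂)
    (K L M : ℝ) :
    ∃ N : ℕ, 1 ≤ N ∧ K * (T / N) ^ γ₁ ≤ 1 / 2 ∧ K * (T / N) ^ γ₂ ≤ 1 / 2 ∧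
      M * (N * (L * ((T / N) ^ γ₁ * (T / N) ^ γ₂))) ≤ 1 / 2 := by
  have base : ∀ p : ℝ, 0 < p → Tendsto (fun N : ℕ => (T / N) ^ p) atTop (𝓝 0) := by
    intro p hp
    have := (tendsto_const_div_atTop_nhds_zero_nat T).rpow_const (p := p) (Or.inr hp.le)
    rwa [Real.zero_rpow hp.ne'] at this
  have half : (0 : ℝ) < 1 / 2 := by norm_num
  have l1 : Tendsto (fun N : ℕ => K * (T / N) ^ γ₁) atTop (𝓝 0) := by
    simpa using (base γ₁ (by linarith)).const_mul K
  have l2 : Tendsto (fun N : ℕ => K * (T / N) ^ γ₂) atTop (𝓝 0) := by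
    simpa using (base γ₂ (by linarith)).const_mul K
  -- With `h = T / N`, the product `N * h ^ γ₁ * h ^ γ₂` equals `T * h ^ (γ₁ + γ₂ - 1)`, which tends
  -- to zero because `γ₁ + γ₂ > 1`.
  have l3 : Tendsto (fun N : ℕ => M * L * T * (T / N) ^ (γ₁ + γ₂ - 1)) atTop (𝓝 0) := by
    simpa using (base (γ₁ + γ₂ - 1) (by linarith)).const_mul (M * L * T)
  obtain ⟨N, ⟨⟨h1, h2⟩, h3⟩, hN⟩ := (((l1.eventually (gt_mem_nhds half)).and
    (l2.eventually (gt_mem_nhds half))).and (l3.eventually (gt_mem_nhds half))).and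
    (eventually_ge_atTop 1) |>.exists
  refine ⟨N, hN, h1.le, h2.le, le_trans (le_of_eq ?_) h3.le⟩
  have hN0 : (0 : ℝ) < N := by exact_mod_cast hN
  have hh : 0 < T / N := div_pos hT hN0
  rw [Real.rpow_sub hh, Real.rpow_add hh, Real.rpow_one]
  field_simp

end Conversion

/-! ### Solutions as fixed points, and the main theorem. -/

section Main

variable {E : Type*} [NormedAddCommGroup E] [NormedSpace ℝ E] {η T γ₁ γ₂ L K h : ℝ} {N : ℕ}
  {A : ℝ × ℝ → E → E} {ξ θ : ℝ × ℝ → E}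

/-- For locally Hölder paths, solutions are the fixed points of the solution map. -/
lemma YoungSetting.isYoungSolution_iff [CompleteSpace E]
    (S : YoungSetting η T γ₁ γ₂ L K h N A ξ) (hθ : LocalHolder γ₁ γ₂ T h θ) :
    IsYoungSolution T A ξ θ ↔ ∀ t ∈ square T, θ t = solMap T A ξ θ t := by
  have hh := S.hh
  have hL := S.hL
  have hI : ∀ t ∈ square T, IsYoungIntegral A θ t (planarSew T (germ A θ) 0 t.1 0 t.2) :=
    fun t ht => (S.planarDefectBound hθ).isYoungIntegral (by linarith [S.hγ₁])
      (by linarith [S.hγ₂]) (by positivity) (by positivity) (by positivity) ht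
  constructor
  · intro H t ht
    obtain ⟨I, h1, h2⟩ := H t ht
    rw [h2, h1.unique (hI t ht) ht.1.1 ht.2.1]
    rfl
  · exact fun H t ht => ⟨_, hI t ht, H t ht⟩

lemma exists_youngSetting (hT : 0 < T) (hη : η ∈ Set.Ioo (0 : ℝ) 1) (hγ₁ : 1 / 2 < γ₁)
    (hγ₂ : 1 / 2 < γ₂) (hηγ₁ : 1 < (1 + η) * γ₁) (hηγ₂ : 1 < (1 + η) * γ₂) (hL : 0 ≤ L)
    (hA : FieldBound η T γ₁ γ₂ L A) (hξ : HolderBox γ₁ γ₂ K K K 0 T 0 T ξ)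
    (hξ₀ : ∀ s ∈ square T, ∀ t ∈ square T, s.1 < t.1 → s.2 < t.2 → rectInc ξ s t = 0) :
    ∃ (N : ℕ) (h : ℝ), YoungSetting η T γ₁ γ₂ L K h N A ξ := by
  obtain ⟨N, hN, h1, h2, h3⟩ := exists_small_scale hT hγ₁ hγ₂ K L
    (sizeConst γ₁ γ₂ + 4 * lipConst η γ₁ γ₂)
  have hN0 : (0 : ℝ) < N := by exact_mod_cast hN
  refine ⟨N, T / N, hη, hγ₁, hγ₂, hηγ₁, hηγ₂, hA, hL, div_pos hT hN0, hN, by field_simp, hξ, ?_,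
    h1, h2, h3⟩
  intro s₁ t₁ s₂ t₂ g1 g2 g3 g4 g5 g6
  -- Degenerate rectangles are not covered by `hξ₀`, but their increments cancel identically.
  rcases g2.eq_or_lt with rfl | g2
  · simp only [rectInc]; abel
  rcases g5.eq_or_lt with rfl | g5
  · simp only [rectInc]; abel
  exact hξ₀ _ ⟨⟨g1, g2.le.trans g3⟩, g4, g5.le.trans g6⟩ _
    ⟨⟨g1.trans g2.le, g3⟩, g4.trans g5.le, g6⟩ g2 g5

end Main

end NLY

theorem theorem3p3 (d : ℕ) (T : ℝ) (hT : 0 < T) (γ : ℝ × ℝ) (η : ℝ)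
    (hγ₁ : γ.1 ∈ Set.Ioc (1 / 2 : ℝ) 1) (hγ₂ : γ.2 ∈ Set.Ioc (1 / 2 : ℝ) 1)
    (hη : η ∈ Set.Ioo (0 : ℝ) 1)
    (hηγ₁ : 1 < (1 + η) * γ.1) (hηγ₂ : 1 < (1 + η) * γ.2)
    (A : ℝ × ℝ → EuclideanSpace ℝ (Fin d) → EuclideanSpace ℝ (Fin d))
    (hA : NLY.MemHolderTimeSpace T γ η A)
    (ξ : ℝ × ℝ → EuclideanSpace ℝ (Fin d)) (hξ : NLY.MemHolderTime T γ ξ)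
    (hξ_rect : ∀ s ∈ NLY.square T, ∀ t ∈ NLY.square T, s.1 < t.1 → s.2 < t.2 →
      NLY.rectInc ξ s t = 0) :
    ∃ θ : ℝ × ℝ → EuclideanSpace ℝ (Fin d),
      (NLY.MemHolderTime T γ θ ∧ NLY.IsYoungSolution T A ξ θ) ∧
      ∀ θ' : ℝ × ℝ → EuclideanSpace ℝ (Fin d),
        NLY.MemHolderTime T γ θ' → NLY.IsYoungSolution T A ξ θ' →
          ∀ t ∈ NLY.square T, θ' t = θ t := by
  obtain ⟨L, hL, hField⟩ := hA.exists_fieldBound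
  obtain ⟨K, hK, hKξ⟩ := hξ.exists_holderBox
  obtain ⟨N, h, S⟩ := NLY.exists_youngSetting hT hη hγ₁.1 hγ₂.1 hηγ₁ hηγ₂ hL hField
    (hKξ K le_rfl) hξ_rect
  obtain ⟨θ, hθ, hfix⟩ := S.exists_fixed
  have hh := S.hh
  have hmem : NLY.MemHolderTime T γ θ :=
    (hθ.holderBox S.γ₁_nonneg S.γ₂_nonneg S.hh S.hN S.hT.le).memHolderTime (by positivity)
  have hsol : NLY.IsYoungSolution T A ξ θ := (S.isYoungSolution_iff hθ).2 hfix
  refine ⟨θ, ⟨hmem, hsol⟩, fun θ' hmem' hsol' => ?_⟩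
  obtain ⟨k, -, hkθ⟩ := hmem.exists_holderBox
  obtain ⟨k', -, hkθ'⟩ := hmem'.exists_holderBox
  -- The scale used for existence may be too coarse for `θ'`. Since `θ` is a fixed point at any
  -- scale where it is locally Hölder, a finer scale adapted to `ξ`, `θ` and `θ'` together is
  -- chosen.
  set K' := max K (max k k')
  have hK' : 1 ≤ K' := hK.trans (le_max_left _ _)
  obtain ⟨N', h', S'⟩ := NLY.exists_youngSetting hT hη hγ₁.1 hγ₂.1 hηγ₁ hηγ₂ hL hField
    (hKξ K' (le_max_left _ _)) hξ_rect
  have small₁ : K' * h' ^ γ.1 ≤ 1 := S'.init_small₁.trans (by norm_num)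
  have small₂ : K' * h' ^ γ.2 ≤ 1 := S'.init_small₂.trans (by norm_num)
  have hloc : NLY.LocalHolder γ.1 γ.2 T h' θ :=
    (hkθ K' ((le_max_left _ _).trans (le_max_right _ _))).localHolder hK' S'.hh small₁ small₂
  have hloc' : NLY.LocalHolder γ.1 γ.2 T h' θ' :=
    (hkθ' K' ((le_max_right _ _).trans (le_max_right _ _))).localHolder hK' S'.hh small₁ small₂
  exact S'.eq_of_fixed hloc hloc' ((S'.isYoungSolution_iff hloc).1 hsol)
    ((S'.isYoungSolution_iff hloc').1 hsol')
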